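/- **Lemma.** Let $C \subset S^3$ be a smooth knot and let $K = P(C)$ be the satellite of $C$ with pattern $P$: here $P$ is a smooth knot in the interior of $S^1\times D^2$, and $K$ is the image of $P$ under an orientation-preserving identification of $S^1\times D^2$ with a tubular neighbourhood of $C$ that takes $S^1\times\{1\}$ to the (null-homologous) longitude of $C$. Let $w \ge 0$ be the winding number of $P$, that is, the absolute value of the class of $P$ in $H_1(S^1\times D^2;\mathbb{Z}) = \mathbb{Z}$, and assume $w \ge 1$. Let $r \in \mathbb{Q}$. For a knot $J$ and $s\in\mathbb{Q}$ let $S^3_s(J)$ denote the result of $s$-surgery on $J$, and call a space $Y$ $\mathrm{SL}(2,\mathbb{C})$-abelian if every homomorphism $\pi_1(Y)\to \mathrm{SL}(2,\mathbb{C})$ has abelian image. If $S^3_r(C)$ is not $\mathrm{SL}(2,\mathbb{C})$-abelian, then $S^3_{rw^2}(K)$ is not $\mathrm{SL}(2,\mathbb{C})$-abelian either. (No further nontriviality assumption on $C$ or $P$ is made; in particular the statement covers all satellite knots in the usual sense, where $C$ is nontrivial and $P$ is not a core of the solid torus.) -/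

import Mathlib

open scoped Manifold ContDiff

noncomputable section

/-- A space `Y` is `G`-abelian if every homomorphism `π₁(Y) → G` has abelian image. -/
def IsGAbelian (G : Type*) [Group G] (Y : Type*) [TopologicalSpace Y] : Prop :=
  ∀ (y : Y) (φ : FundamentalGroup Y y →* G) (a b : FundamentalGroup Y y),
    φ a * φ b = φ b * φ a

/-- The 3-sphere, as the unit sphere of `ℝ⁴`. -/
abbrev S3 : Type := Metric.sphere (0 : EuclideanSpace ℝ (Fin 4)) 1

/-- An (oriented, parametrized) smooth knot in `S³`. -/
def IsKnot (K : Circle → S3) : Prop :=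
  Manifold.IsSmoothEmbedding (𝓡 1) (𝓡 3) ∞ K

/-- The complement `S³ \ K`. -/
abbrev KnotComplement (K : Circle → S3) : Type := {x : S3 // x ∉ Set.range K}

/-- A map defined on `S¹ × ℂ`, written in the coordinates `(t, z) ↦ (e^{it}, z)` and with values
in `ℝ⁴ ⊇ S³`. -/
def inCoordinates (ν : Circle × ℂ → S3) (x : ℝ × ℂ) : EuclideanSpace ℝ (Fin 4) :=
  (ν (Circle.exp x.1, x.2) : EuclideanSpace ℝ (Fin 4))

/-- The determinant of the outward normal of `S³` followed by the images of the three coordinate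
directions of `S¹ × ℂ` (along the circle, real axis, imaginary axis). The map `ν` is an
orientation-preserving local diffeomorphism to `S³` iff this is positive everywhere. -/
def orientationDet (ν : Circle × ℂ → S3) (x : ℝ × ℂ) : ℝ :=
  (Matrix.of ![(inCoordinates ν x).ofLp,
    (fderiv ℝ (inCoordinates ν) x (1, 0)).ofLp,
    (fderiv ℝ (inCoordinates ν) x (0, 1)).ofLp,
    (fderiv ℝ (inCoordinates ν) x (0, Complex.I)).ofLp]).det

/-- A parametrized open tubular neighbourhood of the knot `K`: an orientation-preserving smooth
embedding of `S¹ × ℂ` into `S³` with core `K`. The corresponding closed tubular neighbourhood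
is the image of `S¹ × D²`, where `D²` is the closed unit disk. -/
structure TubularNbhd (K : Circle → S3) where
  toFun : Circle × ℂ → S3
  smooth : ContMDiff ((𝓡 1).prod 𝓘(ℝ, ℂ)) (𝓡 3) ∞ toFun
  injective : Function.Injective toFun
  orientation : ∀ x, 0 < orientationDet toFun x
  core : ∀ u, toFun (u, 0) = K u

namespace TubularNbhd

variable {K : Circle → S3} (N : TubularNbhd K)

lemma not_mem_range {u : Circle} {z : ℂ} (hz : z ≠ 0) : N.toFun (u, z) ∉ Set.range K := by
  rintro ⟨s, hs⟩
  rw [← N.core] at hs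
  exact hz (congrArg Prod.snd (N.injective hs)).symm

/-- The parallel copy `u ↦ ν(u, 1)` of the knot, as a loop in the knot complement. -/
def parallel :
    Path (X := KnotComplement K) ⟨N.toFun (1, 1), N.not_mem_range one_ne_zero⟩
      ⟨N.toFun (1, 1), N.not_mem_range one_ne_zero⟩ where
  toFun t := ⟨N.toFun (Circle.exp (2 * Real.pi * t), 1), N.not_mem_range one_ne_zero⟩
  continuous_toFun := by
    have := N.smooth.continuous
    fun_prop
  source' := by simp
  target' := by simp

/-- The tubular neighbourhood is Seifert framed if the parallel copy `u ↦ ν(u, 1)` of the knot is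
null-homologous in the knot complement, that is, if its class is trivial in
`H₁(S³ \ K; ℤ) = π₁(S³ \ K)ᵃᵇ`. Then `v ↦ ν(1, v)` and `u ↦ ν(u, 1)` (with `u, v ∈ S¹`) are the
standard meridian and longitude of the knot. -/
def IsSeifertFramed : Prop :=
  Abelianization.of (FundamentalGroup.fromPath (Path.Homotopic.Quotient.mk N.parallel)) = 1

/-- The exterior `E_K`: the complement of the open tubular neighbourhood `ν(S¹ × int D²)`. -/
abbrev Exterior : Type := {x : S3 // x ∉ N.toFun '' {y | ‖y.2‖ < 1}}

/-- The point `ν(u, v)`, `u, v ∈ S¹`, of the boundary torus of the exterior. It has longitudinal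
coordinate `u` and meridional coordinate `v`. -/
def bdryPoint (u v : Circle) : N.Exterior :=
  ⟨N.toFun (u, v), by
    rintro ⟨y, hy, h⟩
    rw [N.injective h] at hy
    simp [Circle.norm_coe] at hy⟩

end TubularNbhd

/-- The closed solid torus `S¹ × D²`. -/
abbrev SolidTorus : Type := Circle × Metric.closedBall (0 : ℂ) 1

/-- The point `(u, v)`, `u, v ∈ S¹`, of the boundary torus of `S¹ × D²`. -/
def SolidTorus.bdryPoint (u v : Circle) : SolidTorus := (u, ⟨v, by simp [Circle.norm_coe]⟩)

/-- Bézout coefficients `a * p - b * q = 1` for `r = p / q` in lowest terms. They complete the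
column `(q, p)` to the matrix `(a, q; b, p)` of determinant one. -/
def bezoutA (r : ℚ) : ℤ := Int.gcdA r.num r.den

/-- See `bezoutA`. -/
def bezoutB (r : ℚ) : ℤ := -Int.gcdB r.num r.den

lemma bezout (r : ℚ) : bezoutA r * r.num - bezoutB r * r.den = 1 := by
  have h := Int.gcd_eq_gcd_ab r.num r.den
  have h1 : Int.gcd r.num r.den = 1 := by
    simpa [Int.gcd] using r.reduced
  rw [h1] at h
  simp only [bezoutA, bezoutB]
  push_cast at h
  linarith

/-- The gluing relation for `p / q`-surgery, where `r = p / q` in lowest terms: the boundary point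
`(u, v)` of `S¹ × D²` is glued to the boundary point of the exterior with longitudinal coordinate
`uᵃ v^q` and meridional coordinate `uᵇ v^p`, where `a * p - b * q = 1`. Thus the boundary
`{1} × ∂D²` of a meridian disk is glued to a curve in the class `μ^p λ^q`. -/
inductive DehnSurgery.Glue {K : Circle → S3} (N : TubularNbhd K) (r : ℚ) :
    N.Exterior ⊕ SolidTorus → N.Exterior ⊕ SolidTorus → Prop
  | glue (u v : Circle) : DehnSurgery.Glue N r
      (Sum.inr (SolidTorus.bdryPoint u v))
      (Sum.inl (N.bdryPoint (u ^ bezoutA r * v ^ (r.den : ℤ)) (u ^ bezoutB r * v ^ r.num)))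

/-- The result `S³_r(K)` of Dehn surgery of slope `r ∈ ℚ` on the knot `K`, the slope being measured
in the framing given by the tubular neighbourhood `N`: the exterior with a solid torus glued in.
For `r`-surgery in the usual sense, `N` is Seifert framed. -/
def DehnSurgery {K : Circle → S3} (N : TubularNbhd K) (r : ℚ) : Type :=
  Quot (DehnSurgery.Glue N r)

instance {K : Circle → S3} (N : TubularNbhd K) (r : ℚ) : TopologicalSpace (DehnSurgery N r) :=
  inferInstanceAs (TopologicalSpace (Quot (DehnSurgery.Glue N r)))

/-- A pattern: a smooth knot in the interior of the solid torus `S¹ × D²`. -/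
structure IsPattern (P : Circle → Circle × ℂ) : Prop where
  embedding : Manifold.IsSmoothEmbedding (𝓡 1) ((𝓡 1).prod 𝓘(ℝ, ℂ)) ∞ P
  mem_interior : ∀ u, ‖(P u).2‖ < 1

/-- The pattern `P` has winding number `w ≥ 0`: its class in `H₁(S¹ × D²) = ℤ` is `± w`, that is,
the projection `S¹ → S¹` of `P` to the first factor has degree `± w`. -/
def HasWindingNumber (P : Circle → Circle × ℂ) (w : ℕ) : Prop :=
  ∃ θ : ℝ → ℝ, Continuous θ ∧ (∀ t, (P (Circle.exp t)).1 = Circle.exp (θ t)) ∧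
    |θ (2 * Real.pi) - θ 0| = 2 * Real.pi * w

/-- `K = P(C)`: the knot `K` is the satellite with pattern `P` and companion `C`, that is, the
image of `P` under an identification of `S¹ × D²` with a tubular neighbourhood of `C` which takes
`S¹ × {1}` to the longitude of `C`. -/
def IsSatellite (K : Circle → S3) (P : Circle → Circle × ℂ) (C : Circle → S3) : Prop :=
  ∃ N : TubularNbhd C, N.IsSeifertFramed ∧ ∀ u, K u = N.toFun (P u)

end

/-! Write r = p/q in lowest terms, and let M and L be the images of the meridian and the longitude
of C under a nonabelian representation ρ of π₁(S³_r(C)), so that L^q M^p = 1. Loops in the exterior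
generate the group of the surgered manifold, so ρ is already nonabelian on the complement of C.

A torus around C splits S³ \ K into an outside, which is a copy of the complement of C, and an
inside, a solid torus minus the pattern. Outside, ρ is kept. Inside, an abelian representation A^m
L^n is used, where m is the linking number of a loop with K and n its winding number around the
solid torus. Let d = ± w be the signed winding number. On the common torus the longitude of C has
(m, n) = (0, 1) and the meridian has (d, 0), so the two representations match when A^d = M and A
commutes with L. A loop of slope p'/q' = r d² on a thin torus around K has m = p' and n = q' d, so
it must satisfy A^p' L^(d q') = 1.

Since p and q are coprime, L^q M^p = 1 forces M = Z^q and L = Z^(-p) for some Z. If Y^d = Z, then A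
= Y^q works: the exponent of Y in the last condition is q p' - d² p q' = 0, which is where the
square of the winding number comes from. In SL(2, ℂ) roots exist up to sign, and the sign -1 is
needed only for even d. In that case ρ is first twisted by a central character of the complement of
C, which leaves L alone and does not affect noncommutativity (`SL2.exists_slope_root`). The glued
representation kills the slope of K, so it extends over the surgery solid torus, and it is
nonabelian because ρ is (`TubularNbhd.exists_satellite_hol`).

Representations are treated as holonomies (`Hol`), that is, functors on the fundamental groupoid.
This removes base points, makes Seifert–van Kampen a gluing statement without connectivity
assumptions (`Hol.exists_glue`), and turns conjugation into gauge transformation. Homology enters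
only through degrees of circle-valued maps: linking with K is the degree of a map from S³ \ K to the
circle (`TubularNbhd.exists_angle`), which exists because circle bundles over S³ are trivial. That
the meridian of C links K exactly d times is a signed count of the crossings of K with a transverse
fibre disk (`IsPattern.hasDeg_meridian`). The tubular neighbourhood defining the satellite need not
be the one used for surgery on C, and `TubularNbhd.slope_eq_one` compares the two. -/

noncomputable section

/-! ### Holonomies: representations of the fundamental groupoid -/

section

open Set Filter Topology

/-- The straight segment from `a` to `b`, mapped by `σ`. -/
def ContinuousMap.seg {E X : Type*} [NormedAddCommGroup E] [NormedSpace ℝ E] [TopologicalSpace X]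
    (σ : C(E, X)) (a b : E) : C(ℝ, X) :=
  ⟨fun t => σ (a + t • (b - a)), by fun_prop⟩

/-- A holonomy on `X` with values in the group `G`: a functor from the fundamental groupoid of `X`
to `G`, given on singular 1-simplices (the values of the maps outside `[0, 1]` are irrelevant) and
subject to the cocycle condition for singular 2-simplices. -/
structure Hol (X G : Type*) [TopologicalSpace X] [Group G] where
  toFun : C(ℝ, X) → G
  cocycle : ∀ (σ : C(ℝ × ℝ, X)) (a b c : ℝ × ℝ),
    toFun (σ.seg a b) * toFun (σ.seg b c) = toFun (σ.seg a c)

namespace Hol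

variable {X Y G E : Type*} [TopologicalSpace X] [TopologicalSpace Y] [Group G]
  [NormedAddCommGroup E] [NormedSpace ℝ E]

instance : CoeFun (Hol X G) fun _ => C(ℝ, X) → G := ⟨toFun⟩

/-- Three points of `E` lie in the image of an affine map from the plane, so the planar cocycle
condition is enough. -/
theorem seg_trans (Φ : Hol X G) (σ : C(E, X)) (a b c : E) :
    Φ (σ.seg a b) * Φ (σ.seg b c) = Φ (σ.seg a c) := by
  let τ : C(ℝ × ℝ, E) := ⟨fun x => a + x.1 • (b - a) + x.2 • (c - a), by fun_prop⟩
  have h := Φ.cocycle (σ.comp τ) (0, 0) (1, 0) (0, 1)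
  have h1 : (σ.comp τ).seg (0, 0) (1, 0) = σ.seg a b := by
    ext t; simp [ContinuousMap.seg, τ]
  have h2 : (σ.comp τ).seg (1, 0) (0, 1) = σ.seg b c := by
    ext t; simp only [ContinuousMap.seg, τ, ContinuousMap.coe_mk, ContinuousMap.comp_apply]
    congr 1; simp; module
  have h3 : (σ.comp τ).seg (0, 0) (0, 1) = σ.seg a c := by
    ext t; simp [ContinuousMap.seg, τ]
  rwa [h1, h2, h3] at h

theorem seg_self (Φ : Hol X G) (σ : C(E, X)) (a : E) : Φ (σ.seg a a) = 1 := by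
  simpa using Φ.seg_trans σ a a a

theorem seg_symm (Φ : Hol X G) (σ : C(E, X)) (a b : E) : Φ (σ.seg b a) = (Φ (σ.seg a b))⁻¹ := by
  rw [eq_inv_iff_mul_eq_one, seg_trans, seg_self]

theorem const (Φ : Hol X G) (x : X) : Φ (ContinuousMap.const ℝ x) = 1 := by
  rw [← Φ.seg_self (ContinuousMap.const ℝ x) 0]
  rfl

theorem seg_zero_one (γ : C(ℝ, X)) : γ.seg 0 1 = γ := by
  ext t; simp [ContinuousMap.seg]

/-- Invariance under homotopies which are constant at the end points. -/
theorem eq_of_homotopy (Φ : Hol X G) (σ : C(ℝ × ℝ, X)) {γ γ' : C(ℝ, X)} (h0 : ∀ t, σ (0, t) = γ t)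
    (h1 : ∀ t, σ (1, t) = γ' t) (hl : ∀ s, σ (s, 0) = γ 0) (hr : ∀ s, σ (s, 1) = γ 1) :
    Φ γ = Φ γ' := by
  have e0 : γ = σ.seg (0, 0) (0, 1) := by ext t; simp [ContinuousMap.seg, h0]
  have e1 : γ' = σ.seg (1, 0) (1, 1) := by ext t; simp [ContinuousMap.seg, h1]
  have e2 : Φ (σ.seg (0, 0) (1, 0)) = 1 := by
    rw [← Φ.const (γ 0)]; congr 1; ext t; simp [ContinuousMap.seg, hl]
  have e3 : Φ (σ.seg (0, 1) (1, 1)) = 1 := by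
    rw [← Φ.const (γ 1)]; congr 1; ext t; simp [ContinuousMap.seg, hr]
  have := Φ.seg_trans σ (0, 0) (0, 1) (1, 1)
  rw [← Φ.seg_trans σ (0, 0) (1, 0) (1, 1), ← e0, ← e1, e2, e3] at this
  simpa using this

/-- The two parametrizations agree on [0, 1] and are joined by a linear homotopy. Clamping is the
device by which a path known only on [0, 1] is replaced by one with all of its values under control.
-/
theorem comp_clamp (Φ : Hol X G) (γ : C(ℝ, X)) :
    Φ (γ.comp ⟨fun t => max 0 (min 1 t), by fun_prop⟩) = Φ γ := by
  symm
  refine Φ.eq_of_homotopy (γ.comp ⟨fun x : ℝ × ℝ => (1 - x.1) * x.2 + x.1 * max 0 (min 1 x.2),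
    by fun_prop⟩) ?_ ?_ ?_ ?_ <;> intro s <;> simp

theorem congr_Icc (Φ : Hol X G) {γ γ' : C(ℝ, X)} (h : EqOn γ γ' (Icc 0 1)) : Φ γ = Φ γ' := by
  rw [← Φ.comp_clamp γ, ← Φ.comp_clamp γ']
  congr 1
  ext t
  exact h ⟨le_max_left _ _, max_le zero_le_one (min_le_left _ _)⟩

/-- In the convex space `E` any path is homotopic to the straight segment between its end points.
All uses of simple connectivity of planes and disks go through this. -/
theorem comp_eq_seg (Φ : Hol X G) (σ : C(E, X)) (δ : C(ℝ, E)) :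
    Φ (σ.comp δ) = Φ (σ.seg (δ 0) (δ 1)) := by
  refine Φ.eq_of_homotopy (σ.comp ⟨fun x : ℝ × ℝ => (1 - x.1) • δ x.2 +
    x.1 • (δ 0 + x.2 • (δ 1 - δ 0)), by fun_prop⟩) ?_ ?_ ?_ ?_ <;> intro s
  · simp
  · simp [ContinuousMap.seg]
  · simp only [ContinuousMap.comp_apply, ContinuousMap.coe_mk]; congr 1; module
  · simp only [ContinuousMap.comp_apply, ContinuousMap.coe_mk]; congr 1; module

/-- Naturality square for a homotopy. -/
theorem square (Φ : Hol X G) (σ : C(ℝ × ℝ, X)) :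
    Φ (σ.seg (0, 0) (0, 1)) * Φ (σ.seg (0, 1) (1, 1)) =
      Φ (σ.seg (0, 0) (1, 0)) * Φ (σ.seg (1, 0) (1, 1)) := by
  rw [seg_trans, seg_trans]

/-- Pull back of a holonomy. -/
def comap (Φ : Hol Y G) (f : C(X, Y)) : Hol X G where
  toFun γ := Φ (f.comp γ)
  cocycle σ a b c := Φ.cocycle (f.comp σ) a b c

@[simp] theorem comap_apply (Φ : Hol Y G) (f : C(X, Y)) (γ : C(ℝ, X)) :
    Φ.comap f γ = Φ (f.comp γ) := rfl

/-- Gauge transformation by a function, which need not be continuous. -/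
def gauge (Φ : Hol X G) (g : X → G) : Hol X G where
  toFun γ := (g (γ 0))⁻¹ * Φ γ * g (γ 1)
  cocycle σ a b c := by
    rw [← Φ.cocycle σ a b c]
    simp [ContinuousMap.seg]
    group

@[simp] theorem gauge_apply (Φ : Hol X G) (g : X → G) (γ : C(ℝ, X)) :
    Φ.gauge g γ = (g (γ 0))⁻¹ * Φ γ * g (γ 1) := rfl

/-- Product of commuting holonomies. -/
def mul (Φ Ψ : Hol X G) (h : ∀ γ γ', Commute (Φ γ) (Ψ γ')) : Hol X G where
  toFun γ := Φ γ * Ψ γ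
  cocycle σ a b c := by
    rw [← Φ.cocycle σ a b c, ← Ψ.cocycle σ a b c, mul_assoc, mul_assoc,
      ← mul_assoc (Ψ _) (Φ _), ← (h _ _).eq, mul_assoc]

theorem trans_path (Φ : Hol X G) {x y z : X} (p : Path x y) (q : Path y z) :
    Φ ⟨(p.trans q).extend, (p.trans q).continuous_extend⟩ =
      Φ ⟨p.extend, p.continuous_extend⟩ * Φ ⟨q.extend, q.continuous_extend⟩ := by
  set γ : C(ℝ, X) := ⟨(p.trans q).extend, (p.trans q).continuous_extend⟩ with hγ
  rw [← seg_zero_one γ, ← Φ.seg_trans γ 0 (1/2) 1]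
  congr 1
  · refine Φ.congr_Icc fun t ht => ?_
    have h1 : t * (1/2) ∈ Icc (0:ℝ) 1 := ⟨by linarith [ht.1], by linarith [ht.2]⟩
    simp only [ContinuousMap.seg, hγ, ContinuousMap.coe_mk, sub_zero, smul_eq_mul, zero_add]
    rw [Path.extend_apply _ h1, Path.extend_apply _ ht, Path.trans_apply, dif_pos]
    · congr 1; ext; simp only; ring
    · simpa using ht.2
  · refine Φ.congr_Icc fun t ht => ?_
    have h1 : 1/2 + t * (1 - 1/2) ∈ Icc (0:ℝ) 1 := ⟨by linarith [ht.1], by linarith [ht.2]⟩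
    simp only [ContinuousMap.seg, hγ, ContinuousMap.coe_mk, smul_eq_mul]
    rw [Path.extend_apply _ h1, Path.extend_apply _ ht]
    -- The midpoint t = 0 belongs to the first branch of `Path.trans`, so it is treated separately.
    rcases eq_or_lt_of_le ht.1 with h | h
    · subst h
      rw [Path.trans_apply, dif_pos]
      · have e1 : (⟨2 * (1 / 2 + 0 * (1 - 1 / 2) : ℝ), by norm_num⟩ : unitInterval) = 1 := by
          ext; norm_num
        have e2 : (⟨0, ht⟩ : unitInterval) = 0 := rfl
        simp only [e1, e2, Path.source, Path.target]
      · norm_num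
    · rw [Path.trans_apply, dif_neg]
      · congr 1; ext; simp only; ring
      · simp only [not_le]; linarith

theorem eq_of_homotopic (Φ : Hol X G) {x y : X} {p q : Path x y} (h : p.Homotopic q) :
    Φ ⟨p.extend, p.continuous_extend⟩ = Φ ⟨q.extend, q.continuous_extend⟩ := by
  obtain ⟨H⟩ := h
  refine Φ.eq_of_homotopy ⟨fun x : ℝ × ℝ => H (projIcc 0 1 zero_le_one x.1,
    projIcc 0 1 zero_le_one x.2), by fun_prop⟩ ?_ ?_ ?_ ?_
  · intro t; simp [Path.extend, IccExtend, Function.comp]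
  · intro t; simp [Path.extend, IccExtend, Function.comp]
  · intro t; simp
  · intro t; simp

/-- The homomorphism on the fundamental group given by a holonomy. -/
def toHom (Φ : Hol X G) (x : X) : FundamentalGroup X x →* G where
  toFun p := Quotient.liftOn (FundamentalGroup.toPath p)
    -- The product `p * q` in `FundamentalGroup` runs through `q` first, so the inverse is needed to
    -- get a homomorphism rather than an antihomomorphism.
    (fun p : Path x x => (Φ ⟨p.extend, p.continuous_extend⟩)⁻¹)
    fun _ _ h => by rw [Φ.eq_of_homotopic h]
  map_one' := by
    change (Φ ⟨(Path.refl x).extend, _⟩)⁻¹ = 1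
    rw [inv_eq_one, ← Φ.const x]
    congr 1
  map_mul' p q := by
    induction p using Quotient.inductionOn
    induction q using Quotient.inductionOn
    rename_i p q
    change (Φ ⟨(q.trans p).extend, _⟩)⁻¹ = (Φ ⟨p.extend, _⟩)⁻¹ * (Φ ⟨q.extend, _⟩)⁻¹
    rw [trans_path, mul_inv_rev]

theorem toHom_fromPath (Φ : Hol X G) {x : X} (p : Path x x) :
    Φ.toHom x (FundamentalGroup.fromPath (Path.Homotopic.Quotient.mk p)) =
      (Φ ⟨p.extend, p.continuous_extend⟩)⁻¹ := rfl

/-- A loop which is null-homologous has trivial holonomy in abelian groups. -/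
theorem eq_one_of_abelianization {A : Type*} [CommGroup A] (Φ : Hol X A) {x : X} (p : Path x x)
    (h : Abelianization.of (FundamentalGroup.fromPath (Path.Homotopic.Quotient.mk p)) = 1) :
    Φ ⟨p.extend, p.continuous_extend⟩ = 1 := by
  have := Abelianization.lift_apply_of (Φ.toHom x)
    (FundamentalGroup.fromPath (Path.Homotopic.Quotient.mk p))
  rw [h, map_one, toHom_fromPath] at this
  exact inv_eq_one.1 this.symm

/-- The path in the sense of Mathlib given by a map on `ℝ`. -/
def _root_.ContinuousMap.toPath (γ : C(ℝ, X)) : Path (γ 0) (γ 1) where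
  toFun t := γ t
  source' := by simp
  target' := by simp

theorem toPath_seg_homotopic (σ : C(E, X)) (a b c : E) :
    (((σ.seg a b).toPath.cast (by simp [ContinuousMap.seg]) (by simp [ContinuousMap.seg]) :
      Path (σ a) (σ b)).trans
    ((σ.seg b c).toPath.cast (by simp [ContinuousMap.seg]) (by simp [ContinuousMap.seg]) :
      Path (σ b) (σ c))).Homotopic
    ((σ.seg a c).toPath.cast (by simp [ContinuousMap.seg]) (by simp [ContinuousMap.seg]) :
      Path (σ a) (σ c)) := by
  let P (a b : E) : Path a b := ⟨⟨fun t => a + (t : ℝ) • (b - a), by fun_prop⟩, by simp, by simp⟩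
  have key : ((P a b).trans (P b c)).Homotopic (P a c) := SimplyConnectedSpace.paths_homotopic _ _
  have := key.map σ
  rw [Path.map_trans] at this
  convert this <;> rfl

open Classical in
/-- Every representation of a fundamental group comes from a holonomy. -/
theorem exists_of_hom (x₀ : X) (φ : FundamentalGroup X x₀ →* G) :
    ∃ Φ : Hol X G, ∀ p : Path x₀ x₀, Φ ⟨p.extend, p.continuous_extend⟩ =
      (φ (FundamentalGroup.fromPath (Path.Homotopic.Quotient.mk p)))⁻¹ := by
  -- Paths are closed up to loops at `x₀` along chosen connecting paths. The choice at `x₀` itself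
  -- is the constant path, so that loops at `x₀` keep their value. Paths outside the path component
  -- of `x₀` get the value 1.
  let c (x : X) (h : Joined x₀ x) : Path x₀ x :=
    if e : x = x₀ then (Path.refl x₀).cast rfl e else h.somePath
  have hc : c x₀ (Joined.refl x₀) = Path.refl x₀ := by simp [c]
  let L {x y : X} (p : Path x y) (hx : Joined x₀ x) : Path x₀ x₀ :=
    ((c x hx).trans p).trans (c y (hx.trans ⟨p⟩)).symm
  let F {x y : X} (p : Path x y) : G := if hx : Joined x₀ x then
    (φ (FundamentalGroup.fromPath (Path.Homotopic.Quotient.mk (L p hx))))⁻¹ else 1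
  have hFcast {x y x' y' : X} (p : Path x y) (hx : x' = x) (hy : y' = y) :
      F (p.cast hx hy) = F p := by subst hx hy; rfl
  have hF {x y z : X} (p : Path x y) (q : Path y z) : F (p.trans q) = F p * F q := by
    by_cases hx : Joined x₀ x
    · have hy : Joined x₀ y := hx.trans ⟨p⟩
      simp only [F, dif_pos hx, dif_pos hy]
      rw [← mul_inv_rev, ← map_mul]
      congr 2
      rw [FundamentalGroup.mul_def]
      change Path.Homotopic.Quotient.mk _ = (Path.Homotopic.Quotient.mk _).trans (.mk _)
      simp only [L, Path.Homotopic.Quotient.mk_trans, Path.Homotopic.Quotient.mk_symm,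
        Path.Homotopic.Quotient.trans_assoc]
      congr 2
      rw [← Path.Homotopic.Quotient.trans_assoc]
      simp
    · have hy : ¬ Joined x₀ y := fun h => hx (h.trans ⟨p.symm⟩)
      simp [F, hx, hy]
  have hF' {x y : X} {p q : Path x y} (h : p.Homotopic q) : F p = F q := by
    by_cases hx : Joined x₀ x
    · simp only [F, dif_pos hx]
      congr 3
      exact Quotient.sound (((Path.Homotopic.refl _).hcomp h).hcomp (Path.Homotopic.refl _))
    · simp [F, hx]
  refine ⟨⟨fun γ => F γ.toPath, fun σ a b c => ?_⟩, fun p => ?_⟩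
  · have := hF' (toPath_seg_homotopic σ a b c)
    rwa [hF, hFcast, hFcast, hFcast] at this
  · change F (ContinuousMap.toPath ⟨p.extend, p.continuous_extend⟩) = _
    have e0 : p.extend 0 = x₀ := by simp
    have e1 : p.extend 1 = x₀ := by simp
    have : p = (ContinuousMap.toPath ⟨p.extend, p.continuous_extend⟩).cast (by simp) (by simp) := by
      ext t; simp [ContinuousMap.toPath]
    rw [← hFcast (ContinuousMap.toPath ⟨p.extend, p.continuous_extend⟩) e0.symm e1.symm, ← this]
    simp only [F, dif_pos (Joined.refl x₀), L, hc]
    congr 3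
    simp only [Path.Homotopic.Quotient.mk_trans, Path.refl_symm, Path.Homotopic.Quotient.mk_refl]
    simp

end Hol

end

/-! ### Degrees of closed paths in the circle, and holonomies of tori -/

section

open Set Filter Topology

section Lift

variable {E : Type*} [NormedAddCommGroup E] [NormedSpace ℝ E]

theorem Circle.exists_lift (f : C(E, Circle)) :
    ∃ ψ : C(E, ℝ), ∀ x, f x = Circle.exp (ψ x) := by
  obtain ⟨F, ⟨-, hF⟩, -⟩ := Circle.isCoveringMap_exp.existsUnique_continuousMap_lifts f 0
    (f 0 : ℂ).arg (Circle.exp_arg _)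
  exact ⟨F, fun x => (congrFun hF x).symm⟩

/-- The difference divided by 2π is continuous with values in the countable, hence totally
disconnected, set of integers. -/
theorem Circle.lift_sub_lift_eqOn {X : Type*} [TopologicalSpace X] {S : Set X}
    (hS : IsPreconnected S) {ψ ψ' : X → ℝ} (hψ : ContinuousOn ψ S) (hψ' : ContinuousOn ψ' S)
    (h : ∀ x ∈ S, Circle.exp (ψ x) = Circle.exp (ψ' x)) :
    ∃ n : ℤ, ∀ x ∈ S, ψ x = ψ' x + n * (2 * Real.pi) := by
  rcases S.eq_empty_or_nonempty with rfl | ⟨x₀, hx₀⟩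
  · exact ⟨0, by simp⟩
  have h' (x) (hx : x ∈ S) : ∃ n : ℤ, (ψ x - ψ' x) / (2 * Real.pi) = n := by
    obtain ⟨n, hn⟩ := Circle.exp_eq_exp.1 (h x hx)
    exact ⟨n, by rw [hn]; field_simp; ring⟩
  obtain ⟨n, hn⟩ := h' x₀ hx₀
  refine ⟨n, fun x hx => ?_⟩
  have hc : ContinuousOn (fun x => (ψ x - ψ' x) / (2 * Real.pi)) S := by fun_prop
  have hpre : IsPreconnected ((fun x => (ψ x - ψ' x) / (2 * Real.pi)) '' S) := hS.image _ hc
  have hsub : ((fun x => (ψ x - ψ' x) / (2 * Real.pi)) '' S).Subsingleton := by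
    have : (fun x => (ψ x - ψ' x) / (2 * Real.pi)) '' S ⊆ range ((↑) : ℤ → ℝ) := by
      rintro _ ⟨x, hx, rfl⟩
      obtain ⟨n, hn⟩ := h' x hx
      exact ⟨n, hn.symm⟩
    have htd : IsTotallyDisconnected (range ((↑) : ℤ → ℝ)) :=
      (countable_range _).isTotallyDisconnected
    exact htd _ this hpre
  have := hsub ⟨x, hx, rfl⟩ ⟨x₀, hx₀, rfl⟩
  simp only [hn] at this
  field_simp at this
  linarith

/-- The degree of a closed path in the circle, parametrized by `[0, 1]`. -/
def HasDeg (γ : ℝ → Circle) (n : ℤ) : Prop :=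
  ∃ ψ : C(ℝ, ℝ), (∀ t, γ t = Circle.exp (ψ t)) ∧ ψ 1 - ψ 0 = n * (2 * Real.pi)

namespace HasDeg

variable {γ γ' : ℝ → Circle} {m n : ℤ}

theorem intro (ψ : ℝ → ℝ) (hψ : Continuous ψ) (h : ∀ t, γ t = Circle.exp (ψ t))
    (hn : ψ 1 - ψ 0 = n * (2 * Real.pi)) : HasDeg γ n := ⟨⟨ψ, hψ⟩, h, hn⟩

theorem exists_of_continuous (hγ : Continuous γ) (h : γ 0 = γ 1) : ∃ n, HasDeg γ n := by
  obtain ⟨ψ, hψ⟩ := Circle.exists_lift ⟨γ, hγ⟩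
  have h1 := hψ 0
  have h2 := hψ 1
  simp only [ContinuousMap.coe_mk] at h1 h2
  rw [h, h2] at h1
  obtain ⟨n, hn⟩ := Circle.exp_eq_exp.1 h1
  exact ⟨n, ψ, hψ, by rw [hn]; ring⟩

theorem lift_eq (h : HasDeg γ n) {ψ : ℝ → ℝ} (hψ : Continuous ψ)
    (hγ : ∀ t, γ t = Circle.exp (ψ t)) : ψ 1 - ψ 0 = n * (2 * Real.pi) := by
  obtain ⟨ψ', h', hn⟩ := h
  obtain ⟨k, hk⟩ := Circle.lift_sub_lift_eqOn isPreconnected_univ hψ.continuousOn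
    ψ'.continuous.continuousOn (fun x _ => by rw [← hγ, ← h'])
  rw [hk 1 trivial, hk 0 trivial, ← hn]; ring

theorem mul (h : HasDeg γ m) (h' : HasDeg γ' n) : HasDeg (fun t => γ t * γ' t) (m + n) := by
  obtain ⟨ψ, hψ, hm⟩ := h
  obtain ⟨ψ', hψ', hn⟩ := h'
  refine intro (fun t => ψ t + ψ' t) (by fun_prop) (fun t => ?_) ?_
  · rw [Circle.exp_add, hψ, hψ']
  · push_cast; linarith

theorem zpow (h : HasDeg γ m) (k : ℤ) : HasDeg (fun t => γ t ^ k) (k * m) := by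
  obtain ⟨ψ, hψ, hm⟩ := h
  refine intro (fun t => k * ψ t) (by fun_prop) (fun t => ?_) ?_
  · rw [Circle.exp_intCast_mul, hψ]
  · push_cast; rw [← mul_sub, hm]; ring

theorem const (u : Circle) : HasDeg (fun _ => u) 0 :=
  intro (fun _ => (u : ℂ).arg) (by fun_prop) (fun t => (Circle.exp_arg u).symm) (by simp)

theorem exp (n : ℤ) : HasDeg (fun t => Circle.exp (2 * Real.pi * t) ^ n) n := by
  refine intro (fun t => n * (2 * Real.pi * t)) (by fun_prop) (fun t => ?_) (by ring)
  rw [Circle.exp_intCast_mul]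

/-- A lift of the whole homotopy has increments in 2πℤ that vary continuously with s. Base points
may move, so this is invariance under free homotopy. -/
theorem homotopy (σ : ℝ × ℝ → Circle) (hσ : Continuous σ) (hp : ∀ s, σ (s, 0) = σ (s, 1))
    (s s' : ℝ) (h : HasDeg (fun t => σ (s, t)) n) : HasDeg (fun t => σ (s', t)) n := by
  obtain ⟨Ψ, hΨ⟩ := Circle.exists_lift ⟨σ, hσ⟩
  simp only [ContinuousMap.coe_mk] at hΨ
  obtain ⟨k, hk⟩ := Circle.lift_sub_lift_eqOn isPreconnected_univ (ψ := fun s => Ψ (s, 1))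
    (ψ' := fun s => Ψ (s, 0)) (by fun_prop) (by fun_prop)
    (fun s _ => by rw [← hΨ, ← hΨ, hp])
  have h1 := h.lift_eq (ψ := fun t => Ψ (s, t)) (by fun_prop) (fun t => hΨ _)
  have h2 := hk s trivial
  have h3 := hk s' trivial
  refine intro (fun t => Ψ (s', t)) (by fun_prop) (fun t => hΨ _) ?_
  linarith

/-- A closed path which avoids `-1` has degree zero. -/
theorem of_mem_slitPlane (hγ : Continuous γ) (h : γ 0 = γ 1)
    (hs : ∀ t, (γ t : ℂ) ∈ Complex.slitPlane) : HasDeg γ 0 := by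
  refine intro (fun t => (γ t : ℂ).arg) ?_ (fun t => (Circle.exp_arg _).symm) (by simp [h])
  refine continuous_iff_continuousAt.2 fun t => ?_
  exact (Complex.continuousAt_arg (hs t)).comp (f := fun t => (γ t : ℂ)) (by fun_prop)

end HasDeg

end Lift

namespace Hol

variable {X Y G E : Type*} [TopologicalSpace X] [TopologicalSpace Y] [Group G]
  [NormedAddCommGroup E] [NormedSpace ℝ E]

/-- The degree of a path in the circle, made integral by closing it up in a fixed way. -/
theorem exists_circleDeg (γ : C(ℝ, Circle)) : ∃ n : ℤ, ∃ ψ : C(ℝ, ℝ),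
    (∀ t, γ t = Circle.exp (ψ t)) ∧
      ψ 1 - ψ 0 = (γ 1 : ℂ).arg - (γ 0 : ℂ).arg + n * (2 * Real.pi) := by
  obtain ⟨ψ, hψ⟩ := Circle.exists_lift γ
  obtain ⟨k, hk⟩ := Circle.exp_eq_exp.1 ((Circle.exp_arg (γ 1)).trans (hψ 1))
  obtain ⟨l, hl⟩ := Circle.exp_eq_exp.1 ((Circle.exp_arg (γ 0)).trans (hψ 0))
  refine ⟨l - k, ψ, hψ, ?_⟩
  rw [hk, hl]; push_cast; ring

/-- See `exists_circleDeg`. -/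
def circleDeg (γ : C(ℝ, Circle)) : ℤ := (exists_circleDeg γ).choose

theorem circleDeg_eq (γ : C(ℝ, Circle)) {ψ : ℝ → ℝ} (hψ : Continuous ψ)
    (h : ∀ t, γ t = Circle.exp (ψ t)) :
    ψ 1 - ψ 0 = (γ 1 : ℂ).arg - (γ 0 : ℂ).arg + circleDeg γ * (2 * Real.pi) := by
  obtain ⟨ψ', h', hn⟩ := (exists_circleDeg γ).choose_spec
  obtain ⟨k, hk⟩ := Circle.lift_sub_lift_eqOn isPreconnected_univ hψ.continuousOn
    ψ'.continuous.continuousOn (fun x _ => by rw [← h, ← h'])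
  rw [hk 1 trivial, hk 0 trivial, circleDeg, ← hn]; ring

/-- The holonomy on the circle which sends the loop of degree one to `A`. -/
def circle (A : G) : Hol Circle G where
  toFun γ := A ^ circleDeg γ
  cocycle σ a b c := by
    obtain ⟨Ψ, hΨ⟩ := Circle.exists_lift σ
    have key (a b : ℝ × ℝ) := circleDeg_eq (σ.seg a b) (ψ := Ψ.seg a b) (Ψ.seg a b).continuous
      (fun t => hΨ _)
    have h1 := key a b
    have h2 := key b c
    have h3 := key a c
    simp only [ContinuousMap.seg, ContinuousMap.coe_mk, one_smul, zero_smul, add_zero,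
      add_sub_cancel] at h1 h2 h3
    rw [← zpow_add]
    congr 1
    -- The end point arguments in `circleDeg_eq` telescope, although `arg` is not continuous.
    have : ((circleDeg (σ.seg a b) + circleDeg (σ.seg b c) : ℤ) : ℝ) * (2 * Real.pi) =
        circleDeg (σ.seg a c) * (2 * Real.pi) := by
      push_cast
      simp only [ContinuousMap.seg]
      linarith
    exact_mod_cast mul_right_cancel₀ (by positivity) this

theorem circle_apply (A : G) {γ : C(ℝ, Circle)} {n : ℤ} (h : HasDeg γ n) : circle A γ = A ^ n := by
  change A ^ circleDeg γ = A ^ n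
  congr 1
  have h0 : γ 0 = γ 1 := by
    obtain ⟨ψ, hψ, hn⟩ := h
    rw [hψ, hψ, Circle.exp_eq_exp]
    exact ⟨-n, by push_cast; linarith⟩
  obtain ⟨ψ, hψ, hn⟩ := h
  have := circleDeg_eq γ ψ.continuous hψ
  rw [hn, h0, sub_self, zero_add] at this
  exact_mod_cast (mul_right_cancel₀ (by positivity) this).symm

theorem commute_circle {A B : G} (h : Commute A B) (γ γ' : C(ℝ, Circle)) :
    Commute (circle A γ) (circle B γ') := h.zpow_zpow _ _

/-! ### Holonomy on paths -/

/-- The holonomy of a path. -/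
def onPath (Φ : Hol X G) {x y : X} (p : Path x y) : G := Φ ⟨p.extend, p.continuous_extend⟩

theorem onPath_trans (Φ : Hol X G) {x y z : X} (p : Path x y) (q : Path y z) :
    Φ.onPath (p.trans q) = Φ.onPath p * Φ.onPath q := Φ.trans_path p q

theorem onPath_symm (Φ : Hol X G) {x y : X} (p : Path x y) :
    Φ.onPath p.symm = (Φ.onPath p)⁻¹ := by
  rw [eq_inv_iff_mul_eq_one, ← onPath_trans, onPath,
    Φ.eq_of_homotopic (q := Path.refl y) ⟨(Path.Homotopy.reflSymmTrans p).symm⟩, ← Φ.const y]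
  congr 1

theorem onPath_toPath (Φ : Hol X G) (γ : C(ℝ, X)) : Φ.onPath γ.toPath = Φ γ :=
  Φ.congr_Icc fun _ ht => Path.extend_apply γ.toPath ht

/-- Two holonomies on a path connected space which agree on the loops at some point are gauge
equivalent. -/
theorem exists_gauge_eq [PathConnectedSpace X] (Φ Ψ : Hol X G) (x₀ : X)
    (h : ∀ γ : C(ℝ, X), γ 0 = x₀ → γ 1 = x₀ → Φ γ = Ψ γ) :
    ∃ g : X → G, ∀ γ, Φ γ = Ψ.gauge g γ := by
  let c (x : X) := PathConnectedSpace.somePath x₀ x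
  refine ⟨fun x => (Ψ.onPath (c x))⁻¹ * Φ.onPath (c x), fun γ => ?_⟩
  have := h ⟨(((c (γ 0)).trans γ.toPath).trans (c (γ 1)).symm).extend, by fun_prop⟩ (by simp)
    (by simp)
  change Φ.onPath _ = Ψ.onPath _ at this
  simp only [onPath_trans, onPath_symm, onPath_toPath] at this
  rw [gauge_apply]
  have h2 : Φ γ = (Φ.onPath (c (γ 0)))⁻¹ * (Φ.onPath (c (γ 0)) * Φ γ *
    (Φ.onPath (c (γ 1)))⁻¹) * Φ.onPath (c (γ 1)) := by group
  rw [h2, this]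
  group

/-! ### The torus -/

/-- The universal cover of the torus, times a line. -/
def torusCover (τ : C(Circle × Circle × ℝ, X)) : C(ℝ × ℝ × ℝ, X) :=
  τ.comp ⟨fun v => (Circle.exp (2 * Real.pi * v.1), Circle.exp (2 * Real.pi * v.2.1), v.2.2),
    by fun_prop⟩

theorem _root_.Circle.exp_two_pi_mul_add_int (x : ℝ) (n : ℤ) :
    Circle.exp (2 * Real.pi * (x + n)) = Circle.exp (2 * Real.pi * x) :=
  Circle.exp_eq_exp.2 ⟨n, by ring⟩

theorem torus_periodic (Φ : Hol X G) (τ : C(Circle × Circle × ℝ, X)) (a b : ℝ × ℝ × ℝ) (m n : ℤ) :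
    Φ ((torusCover τ).seg (a + ((m : ℝ), (n : ℝ), (0 : ℝ))) (b + ((m : ℝ), (n : ℝ), (0 : ℝ)))) = Φ ((torusCover τ).seg a b) := by
  congr 1
  ext t
  simp only [ContinuousMap.seg, torusCover, ContinuousMap.comp_apply, ContinuousMap.coe_mk]
  congr 1
  refine Prod.ext ?_ (Prod.ext ?_ ?_)
  · simp only [Prod.fst_add, Prod.smul_fst, Prod.fst_sub, smul_eq_mul]
    rw [← Circle.exp_two_pi_mul_add_int (a.1 + t * (b.1 - a.1)) m]
    congr 1; ring
  · simp only [Prod.snd_add, Prod.fst_add, Prod.smul_fst, Prod.smul_snd, Prod.fst_sub,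
      Prod.snd_sub, smul_eq_mul]
    rw [← Circle.exp_two_pi_mul_add_int (a.2.1 + t * (b.2.1 - a.2.1)) n]
    congr 1; ring
  · simp

/-- The holonomy of the first generator of the fundamental group of the torus. -/
def longitude (Φ : Hol X G) (τ : C(Circle × Circle × ℝ, X)) : G :=
  Φ (τ.comp ⟨fun t => (Circle.exp (2 * Real.pi * t), 1, 0), by fun_prop⟩)

/-- The holonomy of the second generator of the fundamental group of the torus. -/
def meridian (Φ : Hol X G) (τ : C(Circle × Circle × ℝ, X)) : G :=
  Φ (τ.comp ⟨fun t => (1, Circle.exp (2 * Real.pi * t), 0), by fun_prop⟩)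

/-- The second segment is moved by a deck transformation so that it starts where the first one ends.
This yields a homomorphism from ℤ², and in particular the commutation of longitude and meridian. -/
theorem torus_add (Φ : Hol X G) (τ : C(Circle × Circle × ℝ, X)) (m n m' n' : ℤ) :
    Φ ((torusCover τ).seg 0 (↑(m + m'), ↑(n + n'), 0)) =
    Φ ((torusCover τ).seg 0 (↑m, ↑n, 0)) * Φ ((torusCover τ).seg 0 (↑m', ↑n', 0)) := by
  rw [← torus_periodic Φ τ 0 (↑m', ↑n', 0) m n, zero_add, seg_trans]
  simp only [Prod.mk_add_mk, add_zero]
  push_cast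
  rw [add_comm (m' : ℝ), add_comm (n' : ℝ)]

theorem torus_longitude_zpow (Φ : Hol X G) (τ : C(Circle × Circle × ℝ, X)) (m : ℤ) :
    Φ ((torusCover τ).seg 0 (↑m, 0, 0)) = Φ.longitude τ ^ m := by
  let f : Multiplicative ℤ →* G := MonoidHom.mk'
    (fun m => Φ ((torusCover τ).seg 0 (↑m.toAdd, ↑(0 : ℤ), 0)))
    (fun a b => by simpa using Φ.torus_add τ a.toAdd 0 b.toAdd 0)
  have h := map_zpow f (Multiplicative.ofAdd 1) m
  have h1 : f (Multiplicative.ofAdd 1) = Φ.longitude τ := by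
    simp only [f, MonoidHom.mk'_apply, longitude]
    congr 1; ext t
    simp [ContinuousMap.seg, torusCover]
  rw [h1, ← ofAdd_zsmul] at h
  simpa [f] using h

theorem torus_meridian_zpow (Φ : Hol X G) (τ : C(Circle × Circle × ℝ, X)) (m : ℤ) :
    Φ ((torusCover τ).seg 0 (0, ↑m, 0)) = Φ.meridian τ ^ m := by
  let f : Multiplicative ℤ →* G := MonoidHom.mk'
    (fun m => Φ ((torusCover τ).seg 0 (↑(0 : ℤ), ↑m.toAdd, 0)))
    (fun a b => by simpa using Φ.torus_add τ 0 a.toAdd 0 b.toAdd)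
  have h := map_zpow f (Multiplicative.ofAdd 1) m
  have h1 : f (Multiplicative.ofAdd 1) = Φ.meridian τ := by
    simp only [f, MonoidHom.mk'_apply, meridian]
    congr 1; ext t
    simp [ContinuousMap.seg, torusCover]
  rw [h1, ← ofAdd_zsmul] at h
  simpa [f] using h

theorem torus_zpow (Φ : Hol X G) (τ : C(Circle × Circle × ℝ, X)) (m n : ℤ) :
    Φ ((torusCover τ).seg 0 (↑m, ↑n, 0)) = Φ.longitude τ ^ m * Φ.meridian τ ^ n := by
  rw [← torus_longitude_zpow, ← torus_meridian_zpow]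
  simpa using Φ.torus_add τ m 0 0 n

theorem commute_longitude_meridian (Φ : Hol X G) (τ : C(Circle × Circle × ℝ, X)) :
    Commute (Φ.longitude τ) (Φ.meridian τ) := by
  have h1 := Φ.torus_add τ 1 0 0 1
  have h2 := Φ.torus_add τ 0 1 1 0
  rw [add_comm (0 : ℤ) 1] at h1 h2
  rw [h1, torus_zpow, torus_zpow] at h2
  simpa [commute_iff_eq] using h2

/-- The holonomy of a loop on the torus (times a line). -/
theorem torus_loop (Φ : Hol X G) (τ : C(Circle × Circle × ℝ, X)) {α β : ℝ → Circle} {ξ : ℝ → ℝ}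
    {m n : ℤ} (hα : HasDeg α m) (hβ : HasDeg β n) (hξ : Continuous ξ) (hξ' : ξ 0 = ξ 1)
    {γ : C(ℝ, X)} (hγ : ∀ t, γ t = τ (α t, β t, ξ t)) :
    ∃ g : G, Φ γ = g⁻¹ * (Φ.longitude τ ^ m * Φ.meridian τ ^ n) * g ∧
      (α 0 = 1 → β 0 = 1 → ξ 0 = 0 → Φ γ = Φ.longitude τ ^ m * Φ.meridian τ ^ n) := by
  obtain ⟨a, ha, hm⟩ := hα
  obtain ⟨b, hb, hn⟩ := hβ
  let δ : C(ℝ, ℝ × ℝ × ℝ) :=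
    ⟨fun t => (a t / (2 * Real.pi), b t / (2 * Real.pi), ξ t), by fun_prop⟩
  have hγ' : γ = (torusCover τ).comp δ := by
    ext t
    simp only [hγ, torusCover, ContinuousMap.comp_apply, ContinuousMap.coe_mk, δ, ha, hb]
    congr 4 <;> field_simp
  have hδ : δ 1 = δ 0 + ((m : ℝ), (n : ℝ), (0 : ℝ)) := by
    simp only [δ, ContinuousMap.coe_mk, Prod.mk_add_mk, Prod.mk.injEq, hξ', add_zero, and_true]
    constructor <;> field_simp <;> linarith
  -- The conjugating element is the holonomy from the origin of the cover to the starting point of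
  -- the lifted loop.
  have key : Φ γ = (Φ ((torusCover τ).seg 0 (δ 0)))⁻¹ *
      (Φ.longitude τ ^ m * Φ.meridian τ ^ n) * Φ ((torusCover τ).seg 0 (δ 0)) := by
    rw [hγ', comp_eq_seg, ← seg_symm, ← torus_zpow, seg_trans,
      ← torus_periodic Φ τ 0 (δ 0) m n, zero_add, seg_trans, hδ]
  refine ⟨_, key, fun h1 h2 h3 => ?_⟩
  rw [ha] at h1
  rw [hb] at h2
  obtain ⟨k, hk⟩ := Circle.exp_eq_one.1 h1
  obtain ⟨l, hl⟩ := Circle.exp_eq_one.1 h2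
  have h0 : δ 0 = ((k : ℝ), (l : ℝ), (0 : ℝ)) := by
    simp only [δ, ContinuousMap.coe_mk, Prod.mk.injEq, h3, and_true, hk, hl]
    constructor <;> field_simp
  -- A loop starting at the base point lifts to a path starting at a lattice point, so the
  -- conjugating element lies in the abelian image of ℤ².
  rw [key, h0, ← torus_zpow, mul_assoc, ← torus_add, add_comm m, add_comm n, torus_add]
  group

end Hol

end

/-! ### Seifert–van Kampen for holonomies -/

section

open Set Filter Topology

/-- Induction on the number of steps of length `δ`, splitting off the last one. With a Lebesgue
number for `δ`, this carries out the subdivision of paths, rectangles and boxes alike. -/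
theorem subdivide_Icc {P : ℝ → ℝ → Prop} {δ A B : ℝ} (hδ : 0 < δ) (hAB : A ≤ B)
    (hs : ∀ a b, A ≤ a → a ≤ b → b ≤ B → b - a ≤ δ → P a b)
    (hg : ∀ a b c, A ≤ a → a ≤ b → b ≤ c → c ≤ B → P a b → P b c → P a c) : P A B := by
  have key (n : ℕ) : ∀ b, A ≤ b → b ≤ B → b - A ≤ (n + 1) * δ → P A b := by
    induction n with
    | zero => intro b h1 h2 h3; exact hs A b le_rfl h1 h2 (by simpa using h3)
    | succ n ih =>
      intro b h1 h2 h3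
      push_cast at h3
      have hm : max A (b - δ) ≤ b := max_le h1 (by linarith)
      refine hg A (max A (b - δ)) b le_rfl (le_max_left _ _) hm h2
        (ih _ (le_max_left _ _) (hm.trans h2) ?_) (hs _ _ (le_max_left _ _) hm h2 ?_)
      · rcases max_cases A (b - δ) with ⟨h, -⟩ | ⟨h, -⟩ <;> rw [h]
        · rw [sub_self]; positivity
        · linarith
      · linarith [le_max_right A (b - δ)]
  obtain ⟨n, hn⟩ := exists_nat_ge ((B - A) / δ)
  refine key n B hAB le_rfl ?_
  rw [div_le_iff₀ hδ] at hn
  linarith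

namespace Hol

variable {X G : Type*} [TopologicalSpace X] [Group G]

/-- If the values of a holonomy on the paths in `U` and on the paths in `V` belong to a set closed
under multiplication, then so do all its values. -/
theorem mem_of_cover (Φ : Hol X G) {U V : Set X} (hU : IsOpen U) (hV : IsOpen V)
    (hUV : U ∪ V = univ) {S : Set G} (hS : ∀ a ∈ S, ∀ b ∈ S, a * b ∈ S)
    (h1 : ∀ γ : C(ℝ, X), (∀ t, γ t ∈ U) → Φ γ ∈ S) (h2 : ∀ γ : C(ℝ, X), (∀ t, γ t ∈ V) → Φ γ ∈ S)
    (γ : C(ℝ, X)) : Φ γ ∈ S := by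
  obtain ⟨δ, hδ, hL⟩ := lebesgue_number_lemma_of_metric (s := Icc (0 : ℝ) 1)
    (c := fun b : Bool => γ ⁻¹' (if b then U else V)) isCompact_Icc
    (fun b => by cases b <;> simp [hU.preimage γ.continuous, hV.preimage γ.continuous])
    (fun x _ => by
      rcases hUV.ge (mem_univ (γ x)) with h | h
      · exact mem_iUnion.2 ⟨true, by simpa using h⟩
      · exact mem_iUnion.2 ⟨false, by simpa using h⟩)
  have := subdivide_Icc (P := fun a b => Φ (γ.seg a b) ∈ S) (half_pos hδ) (zero_le_one' ℝ) ?_ ?_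
  · rwa [seg_zero_one] at this
  · intro a b ha hab hb hl
    -- After clamping, the whole map on ℝ, and not only its restriction to [0, 1], has values in a
    -- single member of the cover.
    rw [← Φ.comp_clamp]
    have hball (t : ℝ) : a + max 0 (min 1 t) * (b - a) ∈ Metric.ball a δ := by
      have h0 : 0 ≤ max 0 (min 1 t) := le_max_left _ _
      have h1 : max 0 (min 1 t) ≤ 1 := max_le zero_le_one (min_le_left _ _)
      rw [Metric.mem_ball, Real.dist_eq, add_sub_cancel_left, abs_of_nonneg (by
        apply mul_nonneg h0; linarith)]
      nlinarith
    obtain ⟨i, hi⟩ := hL a ⟨ha, hab.trans hb⟩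
    cases i
    · exact h2 _ fun t => by simpa [ContinuousMap.seg] using hi (hball t)
    · exact h1 _ fun t => by simpa [ContinuousMap.seg] using hi (hball t)
  · intro a b c _ _ _ _ h h'
    rw [← Φ.seg_trans γ a b c]
    exact hS _ h _ h'

section Glue

variable {U V : Set X} (Φ : Hol U G) (Ψ : Hol V G)
variable {E : Type*} [NormedAddCommGroup E] [NormedSpace ℝ E]

/-- `g` is the holonomy of the image of the segment from `x` to `y`, if this image is contained in
`U` or in `V`. -/
def IsLocalValue (F : C(E, X)) (x y : E) (g : G) : Prop :=
  (∀ γ : C(ℝ, U), (∀ t ∈ Icc (0 : ℝ) 1, (γ t : X) = F (x + t • (y - x))) → g = Φ γ) ∧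
  ∀ γ : C(ℝ, V), (∀ t ∈ Icc (0 : ℝ) 1, (γ t : X) = F (x + t • (y - x))) → g = Ψ γ

/-- `h` trivializes the pull back along `F` of the holonomies `Φ` and `Ψ` over `B`. -/
def IsDev (F : C(E, X)) (B : Set E) (h : E → G) : Prop :=
  ∀ x ∈ B, ∀ᶠ y in 𝓝[B] x, IsLocalValue Φ Ψ F x y ((h x)⁻¹ * h y)

variable {Φ Ψ}

theorem IsDev.mono {F : C(E, X)} {B B' : Set E} {h : E → G} (hh : IsDev Φ Ψ F B h) (hB : B' ⊆ B) :
    IsDev Φ Ψ F B' h := fun x hx => (hh x (hB hx)).filter_mono (nhdsWithin_mono _ hB)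

theorem IsDev.const_mul {F : C(E, X)} {B : Set E} {h : E → G} (hh : IsDev Φ Ψ F B h) (c : G) :
    IsDev Φ Ψ F B (fun x => c * h x) := fun x hx => by
  filter_upwards [hh x hx] with y hy
  convert hy using 1; group

theorem exists_local_path (hU : IsOpen U) (F : C(E, X)) (x : E) (hx : F x ∈ U) :
    ∀ᶠ y in 𝓝 x, ∃ γ : C(ℝ, U), ∀ t ∈ Icc (0 : ℝ) 1, (γ t : X) = F (x + t • (y - x)) := by
  obtain ⟨ε, hε, hb⟩ := Metric.isOpen_iff.1 (hU.preimage F.continuous) x hx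
  filter_upwards [Metric.ball_mem_nhds x hε] with y hy
  have hmem (t : ℝ) : F (x + max 0 (min 1 t) • (y - x)) ∈ U := by
    apply hb
    exact (convex_ball x ε).add_smul_sub_mem (Metric.mem_ball_self hε) hy
      ⟨le_max_left _ _, max_le zero_le_one (min_le_left _ _)⟩
  refine ⟨⟨fun t => ⟨F (x + max 0 (min 1 t) • (y - x)), hmem t⟩, by fun_prop⟩, fun t ht => ?_⟩
  simp only [ContinuousMap.coe_mk]
  rw [min_eq_right ht.2, max_eq_right ht.1]

/-- Near each point the image of a short segment lies in `U` or in `V`, so both developing maps have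
the same increments there. Their ratio is then locally constant. -/
theorem IsDev.unique (hU : IsOpen U) (hV : IsOpen V) (hUV : U ∪ V = univ) {F : C(E, X)} {B : Set E}
    (hB : IsPreconnected B) {h h' : E → G} (hh : IsDev Φ Ψ F B h) (hh' : IsDev Φ Ψ F B h') :
    ∃ c, ∀ x ∈ B, h' x = c * h x := by
  have : PreconnectedSpace B := isPreconnected_iff_preconnectedSpace.1 hB
  have hlc : IsLocallyConstant fun x : B => h' x * (h x)⁻¹ := by
    rw [IsLocallyConstant.iff_eventually_eq]
    rintro ⟨x, hx⟩
    suffices ∀ᶠ y in 𝓝[B] x, h' y * (h y)⁻¹ = h' x * (h x)⁻¹ by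
      rwa [nhdsWithin_eq_map_subtype_coe hx, eventually_map] at this
    have key {y : E} {g : G} (h1 : (h x)⁻¹ * h y = g) (h2 : (h' x)⁻¹ * h' y = g) :
        h' y * (h y)⁻¹ = h' x * (h x)⁻¹ := by
      rw [inv_mul_eq_iff_eq_mul] at h1 h2
      rw [h1, h2]; group
    rcases hUV.ge (mem_univ (F x)) with hx' | hx'
    · filter_upwards [hh x hx, hh' x hx,
        (exists_local_path hU F x hx').filter_mono nhdsWithin_le_nhds] with y h1 h2 ⟨γ, hγ⟩
      exact key (h1.1 γ hγ) (h2.1 γ hγ)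
    · filter_upwards [hh x hx, hh' x hx,
        (exists_local_path hV F x hx').filter_mono nhdsWithin_le_nhds] with y h1 h2 ⟨γ, hγ⟩
      exact key (h1.2 γ hγ) (h2.2 γ hγ)
  rcases B.eq_empty_or_nonempty with rfl | ⟨x₀, hx₀⟩
  · exact ⟨1, by simp⟩
  · refine ⟨h' x₀ * (h x₀)⁻¹, fun x hx => ?_⟩
    have := hlc.apply_eq_of_preconnectedSpace ⟨x, hx⟩ ⟨x₀, hx₀⟩
    simp only at this
    rw [← this]; group

open Classical in
-- By uniqueness on the connected overlap, the second developing map can be rescaled to agree with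
-- the first. Closedness of the pieces ensures that a point sees only those pieces that contain it.
theorem IsDev.union (hU : IsOpen U) (hV : IsOpen V) (hUV : U ∪ V = univ) {F : C(E, X)}
    {B₁ B₂ : Set E} (hB₁ : IsClosed B₁) (hB₂ : IsClosed B₂) (hB : IsPreconnected (B₁ ∩ B₂))
    (h₁ : ∃ h, IsDev Φ Ψ F B₁ h) (h₂ : ∃ h, IsDev Φ Ψ F B₂ h) :
    ∃ h, IsDev Φ Ψ F (B₁ ∪ B₂) h := by
  obtain ⟨h₁, hh₁⟩ := h₁
  obtain ⟨h₂, hh₂⟩ := h₂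
  obtain ⟨c, hc⟩ := (hh₂.mono inter_subset_right).unique hU hV hUV hB (hh₁.mono inter_subset_left)
  set h := fun x => if x ∈ B₁ then h₁ x else c * h₂ x
  have e1 {x : E} (hx : x ∈ B₁) : h x = h₁ x := if_pos hx
  have e2 {x : E} (hx : x ∈ B₂) : h x = c * h₂ x := by
    by_cases hx' : x ∈ B₁
    · rw [e1 hx', hc x ⟨hx', hx⟩]
    · exact if_neg hx'
  refine ⟨h, fun x _ => ?_⟩
  rw [nhdsWithin_union, eventually_sup]
  constructor
  · by_cases hx : x ∈ B₁
    · filter_upwards [hh₁ x hx, self_mem_nhdsWithin] with y hy hy'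
      rwa [e1 hx, e1 hy']
    · have : 𝓝[B₁] x = ⊥ := by rwa [← notMem_closure_iff_nhdsWithin_eq_bot, hB₁.closure_eq]
      simp [this]
  · by_cases hx : x ∈ B₂
    · filter_upwards [hh₂.const_mul c x hx, self_mem_nhdsWithin] with y hy hy'
      rwa [e2 hx, e2 hy']
    · have : 𝓝[B₂] x = ⊥ := by rwa [← notMem_closure_iff_nhdsWithin_eq_bot, hB₂.closure_eq]
      simp [this]

/-- `Φ` and `Ψ` agree on paths in `U ∩ V`. -/
def Compat (Φ : Hol U G) (Ψ : Hol V G) : Prop :=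
  ∀ (γ : C(ℝ, U)) (γ' : C(ℝ, V)), (∀ t, (γ t : X) = γ' t) → Φ γ = Ψ γ'

theorem Compat.of_Icc (hc : Compat Φ Ψ) (γ : C(ℝ, U)) (γ' : C(ℝ, V))
    (h : ∀ t ∈ Icc (0 : ℝ) 1, (γ t : X) = γ' t) : Φ γ = Ψ γ' := by
  rw [← Φ.comp_clamp, ← Ψ.comp_clamp]
  exact hc _ _ fun t => h _ ⟨le_max_left _ _, max_le zero_le_one (min_le_left _ _)⟩

/-- Over a convex set mapped into `U`, holonomy along straight segments from a fixed point
trivializes `Φ`. Compatibility covers the segments that also lie in `V`. -/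
theorem isDev_left (hc : Compat Φ Ψ) {F : C(E, X)} {B : Set E} (hB : Convex ℝ B) (σ : C(E, U))
    (hσ : ∀ x ∈ B, (σ x : X) = F x) (x₀ : E) : IsDev Φ Ψ F B fun y => Φ (σ.seg x₀ y) := by
  intro x hx
  filter_upwards [self_mem_nhdsWithin] with y hy
  rw [← seg_symm, seg_trans]
  have hs (t) (ht : t ∈ Icc (0 : ℝ) 1) : (σ.seg x y t : X) = F (x + t • (y - x)) :=
    hσ _ (hB.add_smul_sub_mem hx hy ht)
  refine ⟨fun γ hγ => Φ.congr_Icc fun t ht => ?_, fun γ hγ => hc.of_Icc _ _ fun t ht => ?_⟩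
  · exact Subtype.ext ((hs t ht).trans (hγ t ht).symm)
  · exact (hs t ht).trans (hγ t ht).symm

theorem isDev_right (hc : Compat Φ Ψ) {F : C(E, X)} {B : Set E} (hB : Convex ℝ B) (σ : C(E, V))
    (hσ : ∀ x ∈ B, (σ x : X) = F x) (x₀ : E) : IsDev Φ Ψ F B fun y => Ψ (σ.seg x₀ y) := by
  intro x hx
  filter_upwards [self_mem_nhdsWithin] with y hy
  rw [← seg_symm, seg_trans]
  have hs (t) (ht : t ∈ Icc (0 : ℝ) 1) : (σ.seg x y t : X) = F (x + t • (y - x)) :=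
    hσ _ (hB.add_smul_sub_mem hx hy ht)
  refine ⟨fun γ hγ => (hc.of_Icc _ _ fun t ht => ?_).symm, fun γ hγ => Ψ.congr_Icc fun t ht => ?_⟩
  · exact (hγ t ht).trans (hs t ht).symm
  · exact Subtype.ext ((hs t ht).trans (hγ t ht).symm)

/-- A continuous map on a rectangle with values in a set extends to the plane. -/
theorem exists_extend_rectangle (F : C(ℝ × ℝ, X)) {a b a' b' : ℝ} (hab : a ≤ b) (hab' : a' ≤ b')
    {W : Set X} (hW : ∀ x ∈ Icc a b ×ˢ Icc a' b', F x ∈ W) :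
    ∃ σ : C(ℝ × ℝ, W), ∀ x ∈ Icc a b ×ˢ Icc a' b', (σ x : X) = F x := by
  refine ⟨⟨fun x => ⟨F (max a (min b x.1), max a' (min b' x.2)), hW _ ?_⟩, by fun_prop⟩,
    fun x hx => ?_⟩
  · exact ⟨⟨le_max_left _ _, max_le hab (min_le_left _ _)⟩,
      ⟨le_max_left _ _, max_le hab' (min_le_left _ _)⟩⟩
  · obtain ⟨⟨h1, h2⟩, h3, h4⟩ := hx
    simp [h1, h2, h3, h4]

/-- Squares smaller than a Lebesgue number map into `U` or `V` and have developing maps. These are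
glued along edges, first into strips and then into the rectangle. -/
theorem exists_isDev (hU : IsOpen U) (hV : IsOpen V) (hUV : U ∪ V = univ) (hc : Compat Φ Ψ)
    (F : C(ℝ × ℝ, X)) {a b a' b' : ℝ} (hab : a ≤ b) (hab' : a' ≤ b') :
    ∃ h, IsDev Φ Ψ F (Icc a b ×ˢ Icc a' b') h := by
  obtain ⟨δ, hδ, hL⟩ := lebesgue_number_lemma_of_metric (s := Icc a b ×ˢ Icc a' b')
    (c := fun b : Bool => F ⁻¹' (if b then U else V)) (isCompact_Icc.prod isCompact_Icc)
    (fun b => by cases b <;> simp [hU.preimage F.continuous, hV.preimage F.continuous])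
    (fun x _ => by
      rcases hUV.ge (mem_univ (F x)) with h | h
      · exact mem_iUnion.2 ⟨true, by simpa using h⟩
      · exact mem_iUnion.2 ⟨false, by simpa using h⟩)
  have hconv (a b a' b' : ℝ) : Convex ℝ (Icc a b ×ˢ Icc a' b') :=
    (convex_Icc a b).prod (convex_Icc a' b')
  have hclosed (a b a' b' : ℝ) : IsClosed (Icc a b ×ˢ Icc a' b') := isClosed_Icc.prod isClosed_Icc
  refine subdivide_Icc (P := fun s t => ∃ h, IsDev Φ Ψ F (Icc s t ×ˢ Icc a' b') h)
    (half_pos hδ) hab (fun s t has hst htb hl => ?_) fun s t u _ hst htu _ h1 h2 => ?_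
  · refine subdivide_Icc (P := fun s' t' => ∃ h, IsDev Φ Ψ F (Icc s t ×ˢ Icc s' t') h)
      (half_pos hδ) hab' (fun s' t' has' hst' htb' hl' => ?_) fun s' t' u' _ hst hsu _ h1 h2 => ?_
    · have hball : Icc s t ×ˢ Icc s' t' ⊆ Metric.ball (s, s') δ := by
        rintro ⟨x, y⟩ ⟨⟨h1, h2⟩, h3, h4⟩
        simp only [Metric.mem_ball, Prod.dist_eq, Real.dist_eq, max_lt_iff, abs_lt]
        simp only at h1 h2 h3 h4
        refine ⟨⟨?_, ?_⟩, ?_, ?_⟩ <;> linarith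
      obtain ⟨i, hi⟩ := hL (s, s') ⟨⟨has, hst.trans htb⟩, has', hst'.trans htb'⟩
      cases i
      · obtain ⟨σ, hσ⟩ := exists_extend_rectangle F hst hst' (W := V)
          fun x hx => by simpa using hi (hball hx)
        exact ⟨_, isDev_right hc (hconv _ _ _ _) σ hσ 0⟩
      · obtain ⟨σ, hσ⟩ := exists_extend_rectangle F hst hst' (W := U)
          fun x hx => by simpa using hi (hball hx)
        exact ⟨_, isDev_left hc (hconv _ _ _ _) σ hσ 0⟩
    · have := IsDev.union hU hV hUV (hclosed _ _ _ _) (hclosed _ _ _ _)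
        ((hconv _ _ _ _).inter (hconv _ _ _ _)).isPreconnected h1 h2
      rwa [← prod_union, Icc_union_Icc_eq_Icc hst hsu] at this
  · have := IsDev.union hU hV hUV (hclosed _ _ _ _) (hclosed _ _ _ _)
      ((hconv _ _ _ _).inter (hconv _ _ _ _)).isPreconnected h1 h2
    rwa [← union_prod, Icc_union_Icc_eq_Icc hst htu] at this

/-- **Seifert–van Kampen**, as an existence statement for holonomies. -/
theorem exists_glue (hU : IsOpen U) (hV : IsOpen V) (hUV : U ∪ V = univ) (hc : Compat Φ Ψ) :
    ∃ Ω : Hol X G, (∀ γ : C(ℝ, U), Ω ((⟨Subtype.val, by fun_prop⟩ : C(U, X)).comp γ) = Φ γ) ∧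
      ∀ γ : C(ℝ, V), Ω ((⟨Subtype.val, by fun_prop⟩ : C(V, X)).comp γ) = Ψ γ := by
  -- A path is regarded as a map of the square that ignores the second variable, so that the planar
  -- result supplies its developing map.
  let fst : C(ℝ × ℝ, ℝ) := ⟨Prod.fst, continuous_fst⟩
  have hex (γ : C(ℝ, X)) := exists_isDev hU hV hUV hc (γ.comp fst) (zero_le_one' ℝ) (zero_le_one' ℝ)
  choose h hh using hex
  let Q : Set (ℝ × ℝ) := Icc 0 1 ×ˢ Icc 0 1
  have h00 : ((0, 0) : ℝ × ℝ) ∈ Q := by simp [Q]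
  have h10 : ((1, 0) : ℝ × ℝ) ∈ Q := by simp [Q]
  have hQ : Convex ℝ Q := (convex_Icc _ _).prod (convex_Icc _ _)
  let Ω (γ : C(ℝ, X)) : G := (h γ (0, 0))⁻¹ * h γ (1, 0)
  have hΩ (γ : C(ℝ, X)) {k : ℝ × ℝ → G} (hk : IsDev Φ Ψ (γ.comp fst) Q k) :
      Ω γ = (k (0, 0))⁻¹ * k (1, 0) := by
    obtain ⟨c, hc⟩ := hk.unique hU hV hUV hQ.isPreconnected (hh γ)
    simp only [Ω, hc _ h00, hc _ h10]; group
  -- A developing map of `σ` pulls back along the affine parametrization of a segment, so it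
  -- computes the holonomy of every segment in its domain.
  have key (σ : C(ℝ × ℝ, X)) {B : Set (ℝ × ℝ)} (hB : Convex ℝ B) {k : ℝ × ℝ → G}
      (hk : IsDev Φ Ψ σ B k) {a b : ℝ × ℝ} (ha : a ∈ B) (hb : b ∈ B) :
      Ω (σ.seg a b) = (k a)⁻¹ * k b := by
    let A (x : ℝ × ℝ) : ℝ × ℝ := a + x.1 • (b - a)
    have hA : MapsTo A Q B := fun x hx => hB.add_smul_sub_mem ha hb hx.1
    have hAc : Continuous A := by fun_prop
    rw [hΩ _ (k := fun x => k (A x))]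
    · simp [A]
    · intro x hx
      filter_upwards [(hAc.continuousWithinAt.tendsto_nhdsWithin hA).eventually (hk _ (hA hx))]
        with y hy
      have e (t : ℝ) : ((σ.seg a b).comp fst) (x + t • (y - x)) = σ (A x + t • (A y - A x)) := by
        simp only [ContinuousMap.seg, fst, ContinuousMap.comp_apply, ContinuousMap.coe_mk, A]
        congr 1
        simp only [Prod.fst_add, Prod.smul_fst, Prod.fst_sub]
        simp only [smul_eq_mul]
        module
      simp only [IsLocalValue, e]
      exact hy
  refine ⟨⟨Ω, fun σ a b c => ?_⟩, fun γ => ?_, fun γ => ?_⟩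
  -- One developing map on a square containing all three points computes the three values at once.
  · obtain ⟨R, hR⟩ := (isBounded_iff_forall_norm_le.1
      (Set.toFinite ({a, b, c} : Set (ℝ × ℝ))).isBounded)
    have hmem {x : ℝ × ℝ} (hx : x ∈ ({a, b, c} : Set (ℝ × ℝ))) :
        x ∈ Icc (-|R|) |R| ×ˢ Icc (-|R|) |R| := by
      have h1 := (norm_fst_le x).trans ((hR x hx).trans (le_abs_self R))
      have h2 := (norm_snd_le x).trans ((hR x hx).trans (le_abs_self R))
      exact ⟨abs_le.1 h1, abs_le.1 h2⟩
    have hR' : -|R| ≤ |R| := by linarith [abs_nonneg R]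
    obtain ⟨k, hk⟩ := exists_isDev hU hV hUV hc σ hR' hR'
    have hconv : Convex ℝ (Icc (-|R|) |R| ×ˢ Icc (-|R|) |R|) :=
      (convex_Icc _ _).prod (convex_Icc _ _)
    rw [key σ hconv hk (hmem (by simp)) (hmem (by simp)),
      key σ hconv hk (hmem (by simp)) (hmem (by simp)),
      key σ hconv hk (hmem (by simp)) (hmem (by simp))]
    group
  · refine (hΩ _ (isDev_left hc hQ (γ.comp fst) (fun _ _ => rfl) 0)).trans ?_
    rw [← seg_symm, seg_trans]
    congr 1; ext t; simp [ContinuousMap.seg, fst]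
  · refine (hΩ _ (isDev_right hc hQ (γ.comp fst) (fun _ _ => rfl) 0)).trans ?_
    rw [← seg_symm, seg_trans]
    congr 1; ext t; simp [ContinuousMap.seg, fst]

end Glue

end Hol

end

/-! ### Roots in SL(2, ℂ) -/

section

open Matrix (SpecialLinearGroup det trace det_fin_two trace_fin_two)

/-- Cayley–Hamilton in determinant one. -/
theorem SL2.mul_self {R : Type*} [CommRing R] (Z : SpecialLinearGroup (Fin 2) R) :
    (Z : Matrix (Fin 2) (Fin 2) R) * Z = (Z : Matrix (Fin 2) (Fin 2) R).trace • (Z : Matrix (Fin 2) (Fin 2) R) - 1 := by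
  have hd := Z.det_coe
  rw [det_fin_two] at hd
  ext i j
  fin_cases i <;> fin_cases j <;>
    simp [Matrix.mul_apply, Fin.sum_univ_two, trace_fin_two]
  all_goals first | linear_combination (0 : R) * hd | linear_combination hd | linear_combination -hd

/-- A matrix in `SL(2)` with distinct eigenvalues has roots which are linear polynomials in it. -/
theorem SL2.exists_pow_eq_of_trace_sq_ne {n : ℕ} (hn : n ≠ 0) (Z : SpecialLinearGroup (Fin 2) ℂ)
    (hZ : (Z : Matrix (Fin 2) (Fin 2) ℂ).trace ^ 2 ≠ 4) : ∃ Y : SpecialLinearGroup (Fin 2) ℂ, Y ^ n = Z := by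
  set T := (Z : Matrix (Fin 2) (Fin 2) ℂ).trace with hT
  obtain ⟨D, hD⟩ := IsAlgClosed.exists_pow_nat_eq (T ^ 2 - 4) (n := 2) (by norm_num)
  have hD0 : D ≠ 0 := by
    rintro rfl
    apply hZ; linear_combination -hD
  set a := (T + D) / 2
  set b := (T - D) / 2
  have hab : a * b = 1 := by simp only [a, b]; linear_combination -hD / 4
  have hsum : a + b = T := by simp only [a, b]; ring
  have hdiff : a - b = D := by simp only [a, b]; ring
  have ha : a ≠ 0 := left_ne_zero_of_mul_eq_one hab
  obtain ⟨α, hα⟩ := IsAlgClosed.exists_pow_nat_eq a (Nat.pos_of_ne_zero hn)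
  have hα0 : α ≠ 0 := by rintro rfl; rw [zero_pow hn] at hα; exact ha hα.symm
  have hb : b = a⁻¹ := eq_inv_of_mul_eq_one_right hab
  -- The linear polynomial s X + t is chosen to send the eigenvalues a and a⁻¹ to α and α⁻¹, with αⁿ
  -- = a. Its value at `Z` then has determinant α α⁻¹ = 1.
  set s := (α - α⁻¹) / D
  set t := α - s * a
  have h1 : s * a + t = α := by simp [t]
  have h2 : s * b + t = α⁻¹ := by
    simp only [t]
    have : s * (a - b) = α - α⁻¹ := by rw [hdiff]; simp only [s]; field_simp
    linear_combination -this
  have hdet : det (s • (Z : Matrix (Fin 2) (Fin 2) ℂ) + t • 1) = 1 := by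
    have hd := Z.det_coe
    rw [det_fin_two] at hd ⊢
    have h3 : (s * a + t) * (s * b + t) = 1 := by rw [h1, h2, mul_inv_cancel₀ hα0]
    have hT' := hT
    rw [trace_fin_two] at hT'
    simp
    linear_combination h3 - s ^ 2 * hab - s * t * hsum + s ^ 2 * hd - s * t * hT'
  obtain ⟨Y, hY⟩ : ∃ Y : SpecialLinearGroup (Fin 2) ℂ,
      (Y : Matrix (Fin 2) (Fin 2) ℂ) = s • (Z : Matrix (Fin 2) (Fin 2) ℂ) + t • 1 := ⟨⟨_, hdet⟩, rfl⟩
  refine ⟨Y, ?_⟩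
  apply Matrix.SpecialLinearGroup.ext
  intro i j
  rw [Matrix.SpecialLinearGroup.coe_pow, hY]
  refine congrFun (congrFun (?_ : _ = (Z : Matrix (Fin 2) (Fin 2) ℂ)) i) j
  change (s • (Z : Matrix (Fin 2) (Fin 2) ℂ) + t • 1) ^ n = Z
  -- (s X + t)ⁿ - X vanishes at both eigenvalues, so it is divisible by the characteristic
  -- polynomial, which annihilates `Z`.
  open Polynomial in
  have hdvd : (X - C a) * (X - C b) ∣ (C s * X + C t) ^ n - X := by
    apply IsCoprime.mul_dvd
    · apply isCoprime_X_sub_C_of_isUnit_sub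
      rw [hdiff]; exact hD0.isUnit
    · rw [dvd_iff_isRoot]; simp [h1, hα]
    · rw [dvd_iff_isRoot]; simp [h2, hα]; exact sub_eq_zero.2 hb.symm
  obtain ⟨q, hq⟩ := hdvd
  have := congrArg (Polynomial.aeval (Z : Matrix (Fin 2) (Fin 2) ℂ)) hq
  simp only [map_sub, map_mul, map_pow, map_add, Polynomial.aeval_X, Polynomial.aeval_C] at this
  rw [show ((Z : Matrix (Fin 2) (Fin 2) ℂ) - algebraMap ℂ _ a) * (Z - algebraMap ℂ _ b) = 0 by
    have h0 := SL2.mul_self Z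
    rw [Algebra.algebraMap_eq_smul_one, Algebra.algebraMap_eq_smul_one]
    simp only [mul_sub, sub_mul, h0, smul_mul_assoc, mul_smul_comm, one_mul, mul_one, smul_sub, smul_smul]
    rw [mul_comm b a, hab, ← hT, ← hsum]
    module, zero_mul, sub_eq_zero] at this
  rwa [Algebra.algebraMap_eq_smul_one, Algebra.algebraMap_eq_smul_one, smul_one_mul] at this

/-- `Z` is unipotent: N = Z - 1 squares to zero, so (1 + N/n)ⁿ = 1 + N by the truncated binomial
formula. -/
theorem SL2.exists_pow_eq_of_trace_eq_two {n : ℕ} (hn : n ≠ 0) (Z : SpecialLinearGroup (Fin 2) ℂ)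
    (hZ : (Z : Matrix (Fin 2) (Fin 2) ℂ).trace = 2) : ∃ Y : SpecialLinearGroup (Fin 2) ℂ, Y ^ n = Z := by
  have hn' : (n : ℂ) ≠ 0 := by exact_mod_cast hn
  set N := (Z : Matrix (Fin 2) (Fin 2) ℂ) - 1 with hN
  have hN2 : N * N = 0 := by
    have h0 := SL2.mul_self Z
    rw [hZ] at h0
    simp only [hN, mul_sub, sub_mul, h0, one_mul, mul_one]
    module
  have hdet : det (1 + (n : ℂ)⁻¹ • N) = 1 := by
    have hd := Z.det_coe
    rw [det_fin_two] at hd ⊢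
    rw [trace_fin_two] at hZ
    simp [hN]
    field_simp
    linear_combination hd + (n - 1) * hZ
  obtain ⟨Y, hY⟩ : ∃ Y : SpecialLinearGroup (Fin 2) ℂ,
      (Y : Matrix (Fin 2) (Fin 2) ℂ) = 1 + (n : ℂ)⁻¹ • N := ⟨⟨_, hdet⟩, rfl⟩
  refine ⟨Y, ?_⟩
  apply Matrix.SpecialLinearGroup.ext
  intro i j
  rw [Matrix.SpecialLinearGroup.coe_pow, hY]
  refine congrFun (congrFun (?_ : _ = (Z : Matrix (Fin 2) (Fin 2) ℂ)) i) j
  change (1 + (n : ℂ)⁻¹ • N) ^ n = Z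
  have key (k : ℕ) : (1 + (n : ℂ)⁻¹ • N) ^ k = 1 + (k * (n : ℂ)⁻¹) • N := by
    induction k with
    | zero => simp
    | succ k ih =>
      rw [pow_succ, ih]
      simp only [mul_add, add_mul, one_mul, mul_one, smul_mul_smul_comm, hN2]
      push_cast
      module
  rw [key, mul_inv_cancel₀ hn', one_smul, hN, add_sub_cancel]

/-- Up to sign, all elements of `SL(2, ℂ)` have roots. -/
theorem SL2.exists_zpow_eq_or_neg {d : ℤ} (hd : d ≠ 0) (Z : SpecialLinearGroup (Fin 2) ℂ) :
    ∃ Y : SpecialLinearGroup (Fin 2) ℂ, Y ^ d = Z ∨ (Even d ∧ Y ^ d = -Z) := by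
  have hn : d.natAbs ≠ 0 := by simpa
  have key : ∃ Y : SpecialLinearGroup (Fin 2) ℂ, Y ^ d.natAbs = Z ∨ (Even d.natAbs ∧ Y ^ d.natAbs = -Z) := by
    by_cases h1 : (Z : Matrix (Fin 2) (Fin 2) ℂ).trace ^ 2 = 4
    · have : (Z : Matrix (Fin 2) (Fin 2) ℂ).trace = 2 ∨
          (Z : Matrix (Fin 2) (Fin 2) ℂ).trace = -2 := by
        rw [← sq_eq_sq_iff_eq_or_eq_neg, h1]; norm_num
      rcases this with h2 | h2
      · obtain ⟨Y, hY⟩ := SL2.exists_pow_eq_of_trace_eq_two hn Z h2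
        exact ⟨Y, Or.inl hY⟩
      -- For trace -2 a root of `-Z` is taken. An odd exponent absorbs the sign into the root, and
      -- only for an even exponent does the sign remain.
      · obtain ⟨Y, hY⟩ := SL2.exists_pow_eq_of_trace_eq_two hn (-Z) (by simp [h2])
        rcases Nat.even_or_odd d.natAbs with he | ho
        · exact ⟨Y, Or.inr ⟨he, hY⟩⟩
        · exact ⟨-Y, Or.inl (by rw [ho.neg_pow, hY, neg_neg])⟩
    · obtain ⟨Y, hY⟩ := SL2.exists_pow_eq_of_trace_sq_ne hn Z h1
      exact ⟨Y, Or.inl hY⟩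
  obtain ⟨Y, hY⟩ := key
  rw [Int.natAbs_even] at hY
  rcases Int.natAbs_eq d with h | h
  · refine ⟨Y, ?_⟩
    rw [h, zpow_natCast, ← h]
    exact hY
  · refine ⟨Y⁻¹, ?_⟩
    rw [h, zpow_neg, zpow_natCast, inv_pow, inv_inv, ← h]
    exact hY

/-- A prescribed pair of commuting matrices with `M ^ p * L ^ q = 1` can be modified by a sign such
that `M` becomes a `d`-th power in a way compatible with the slope `p * d ^ 2 / q`. -/
theorem SL2.exists_slope_root {d : ℤ} (hd : d ≠ 0) (r : ℚ) {M L : SpecialLinearGroup (Fin 2) ℂ}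
    (hc : Commute L M) (h : L ^ (r.den : ℤ) * M ^ r.num = 1) :
    ∃ (ε A : SpecialLinearGroup (Fin 2) ℂ), (∀ B, Commute ε B) ∧ A ^ d = M * ε ∧ Commute A L ∧
      A ^ (r * d ^ 2).num * L ^ (d * (r * d ^ 2).den) = 1 := by
  have hbz := bezout r
  set x := bezoutB r
  set y := bezoutA r
  set p := r.num
  set q : ℤ := (r.den : ℤ)
  have hML : M ^ p = L ^ (-q) := by
    rw [zpow_neg]; exact eq_inv_of_mul_eq_one_right h
  have hLM : Commute M L := hc.symm
  -- Bézout makes `Z` a generator of the group generated by `M` and `L`, with M = Z^q and L =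
  -- Z^(-p).
  set Z := M ^ (-x) * L ^ (-y) with hZdef
  have hZp : ∀ k : ℤ, Z ^ k = M ^ (-x * k) * L ^ (-y * k) := fun k => by
    rw [hZdef, ((hLM.zpow_zpow _ _).mul_zpow), zpow_mul, zpow_mul]
  have hZq : Z ^ q = M := by
    rw [hZp, show -y * q = -q * y by ring, zpow_mul L, ← hML, ← zpow_mul, ← zpow_add,
      show -x * q + p * y = 1 by linarith, zpow_one]
  have hZp' : Z ^ (-p) = L := by
    rw [hZp, show -x * -p = p * x by ring, zpow_mul, hML, ← zpow_mul, ← zpow_add,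
      show -q * x + -y * -p = 1 by linarith, zpow_one]
  -- The equation p'/q' = (p/q) d² with denominators cleared.
  have hslope : q * (r * d ^ 2).num = p * d ^ 2 * (r * d ^ 2).den := by
    have h1 : (r * d ^ 2) * (r * d ^ 2).den = (r * d ^ 2).num := Rat.mul_den_eq_num _
    have h2 : r * (q : ℚ) = p := Rat.mul_den_eq_num r
    have : (q : ℚ) * (r * d ^ 2).num = p * d ^ 2 * (r * d ^ 2).den := by
      rw [← h1, ← h2]; ring
    exact_mod_cast this
  set p' := (r * d ^ 2).num
  set q' : ℤ := ((r * d ^ 2).den : ℤ)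
  obtain ⟨Y, hY | ⟨he, hY⟩⟩ := SL2.exists_zpow_eq_or_neg hd Z
  · refine ⟨1, Y ^ q, fun B => Commute.one_left B, ?_, ?_, ?_⟩
    · rw [← zpow_mul, mul_comm, zpow_mul, hY, hZq, mul_one]
    · rw [← hZp', ← hY]
      exact ((Commute.refl Y).zpow_zpow _ _ |>.zpow_right _)
    · rw [← hZp', ← hY, ← zpow_mul, ← zpow_mul, ← zpow_mul, ← zpow_add, hslope]
      rw [show p * d ^ 2 * q' + d * (-p * (d * q')) = 0 by ring, zpow_zero]
  -- Here Z = -Y^d with d even. The sign (-1)^q in M = Z^q goes into `ε`, and the sign in L = Z^(-p)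
  -- disappears from L^(d q') because d is even.
  · have hneg (B : SpecialLinearGroup (Fin 2) ℂ) : Commute (-1) B := by
      rw [commute_iff_eq]; simp
    have hY' : Z = -1 * Y ^ d := by rw [hY]; simp
    have hYz (k : ℤ) : Z ^ k = (-1) ^ k * Y ^ (d * k) := by
      rw [hY', (hneg _).mul_zpow, zpow_mul]
    refine ⟨(-1) ^ (-q), Y ^ q, fun B => (hneg B).zpow_left _, ?_, ?_, ?_⟩
    · rw [← hZq, hYz, ((hneg _).zpow_left _).eq, mul_assoc, ← zpow_add, add_neg_cancel, zpow_zero,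
        mul_one, ← zpow_mul, mul_comm]
    · rw [← hZp', hYz]
      exact ((hneg _).zpow_left _).symm.mul_right ((Commute.refl Y).zpow_zpow _ _)
    · have h1 : L ^ (d * q') = Y ^ (d * -p * (d * q')) := by
        rw [← hZp', hYz, ((hneg _).zpow_left _).mul_zpow, ← zpow_mul, ← zpow_mul]
        obtain ⟨e, he⟩ := he
        have h2 : (-1 : SpecialLinearGroup (Fin 2) ℂ) ^ (2 : ℤ) = 1 := by
          rw [zpow_two]; simp
        rw [show -p * (d * q') = 2 * (-p * e * q') by rw [he]; ring, zpow_mul (-1) 2, h2, one_zpow,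
          one_mul]
      rw [h1, ← zpow_mul, ← zpow_add, hslope]
      rw [show p * d ^ 2 * q' + d * -p * (d * q') = 0 by ring, zpow_zero]

end

/-! ### The surgered manifold: radius, retraction off the core, coordinates near the core -/

section

open Set Filter Topology

/-- The direction `z / ‖z‖` of a complex number (`1` if `z = 0`). -/
def Complex.dir (z : ℂ) : Circle :=
  if h : z = 0 then 1 else ⟨z / ‖z‖, by simp [Submonoid.unitSphere, h]⟩

namespace Complex

theorem coe_dir {z : ℂ} (h : z ≠ 0) : (dir z : ℂ) = z / ‖z‖ := by simp [dir, h]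

theorem norm_mul_dir (z : ℂ) : (‖z‖ : ℂ) * dir z = z := by
  by_cases h : z = 0
  · simp [h]
  · have : (‖z‖ : ℂ) ≠ 0 := by simpa using h
    rw [coe_dir h]; field_simp

theorem dir_circle (u : Circle) : dir u = u := by
  ext; rw [coe_dir u.coe_ne_zero, Circle.norm_coe]; simp

theorem dir_mul {z w : ℂ} (hz : z ≠ 0) (hw : w ≠ 0) : dir (z * w) = dir z * dir w := by
  ext
  rw [Circle.coe_mul, coe_dir hz, coe_dir hw, coe_dir (mul_ne_zero hz hw), norm_mul]
  push_cast
  field_simp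

theorem dir_ofReal {r : ℝ} (hr : 0 < r) : dir r = 1 := by
  ext
  rw [coe_dir (by exact_mod_cast hr.ne'), norm_real, Real.norm_of_nonneg hr.le]
  simp [hr.ne']

theorem dir_ofReal_mul {r : ℝ} (hr : 0 < r) (z : ℂ) : dir (r * z) = dir z := by
  by_cases hz : z = 0
  · simp [hz]
  · rw [dir_mul (by exact_mod_cast hr.ne') hz, dir_ofReal hr, one_mul]

theorem continuousOn_dir : ContinuousOn dir {z | z ≠ 0} := by
  have hi : IsInducing (fun u : Circle => (u : ℂ)) := ⟨rfl⟩
  refine hi.continuousOn_iff.2 ?_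
  refine ContinuousOn.congr (f := fun z : ℂ => z / ‖z‖) ?_ fun z hz => coe_dir hz
  exact continuousOn_id.div (by fun_prop) (fun z hz => by simpa using hz)

theorem continuousAt_dir {z : ℂ} (hz : z ≠ 0) : ContinuousAt dir z :=
  continuousOn_dir.continuousAt (isOpen_ne.mem_nhds hz)

end Complex

theorem _root_.Continuous.dir {X : Type*} [TopologicalSpace X] {f : X → ℂ} (hf : Continuous f)
    (h : ∀ x, f x ≠ 0) : Continuous fun x => Complex.dir (f x) :=
  Complex.continuousOn_dir.comp_continuous hf h

/-- The closed unit disk. -/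
abbrev Disk : Type := Metric.closedBall (0 : ℂ) 1

theorem Disk.norm_le (z : Disk) : ‖(z : ℂ)‖ ≤ 1 := mem_closedBall_zero_iff.1 z.2

/-- A unit complex number as a point of the closed disk. -/
def Circle.toDisk (u : Circle) : Disk := ⟨u, by simp [Circle.norm_coe]⟩

theorem Circle.continuous_toDisk : Continuous Circle.toDisk := by
  unfold Circle.toDisk; fun_prop

theorem Circle.continuous_toDisk_coe {f : ℝ → ℝ} (hf : Continuous f) :
    Continuous fun t => ((Circle.exp (f t)).toDisk : ℂ) :=
  continuous_subtype_val.comp (Circle.continuous_toDisk.comp (Circle.exp.continuous.comp hf))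

/-- Straight line segments in the disk, extended by constants. -/
def Disk.line : C(Disk × Disk × ℝ, Disk) where
  toFun x := ⟨(x.1 : ℂ) + max 0 (min 1 x.2.2) • ((x.2.1 : ℂ) - x.1),
    (convex_closedBall (0 : ℂ) 1).add_smul_sub_mem x.1.2 x.2.1.2
      ⟨le_max_left _ _, max_le zero_le_one (min_le_left _ _)⟩⟩
  continuous_toFun := by fun_prop

/-- The projection of the plane to the disk. -/
def Disk.proj : C(ℂ, Disk) where
  toFun z := ⟨((max 1 ‖z‖)⁻¹ : ℝ) • z, by
    rw [mem_closedBall_zero_iff, norm_smul, norm_inv, Real.norm_of_nonneg (by positivity),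
      inv_mul_le_one₀ (by positivity)]
    exact le_max_right _ _⟩
  continuous_toFun := by
    have h : Continuous fun z : ℂ => (max 1 ‖z‖)⁻¹ :=
      Continuous.inv₀ (by fun_prop) fun z => by positivity
    exact (h.smul continuous_id).subtype_mk _

theorem Disk.proj_coe (z : Disk) : Disk.proj z = z := by
  ext; simp [Disk.proj, max_eq_left z.norm_le]

namespace DehnSurgery

variable {K : Circle → S3} {N : TubularNbhd K} {r : ℚ} {G : Type*} [Group G]

variable (N r) in
/-- The gluing map of the boundary tori. -/
def glueMap : C(Circle × Circle, N.Exterior) where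
  toFun x := N.bdryPoint (x.1 ^ bezoutA r * x.2 ^ (r.den : ℤ)) (x.1 ^ bezoutB r * x.2 ^ r.num)
  continuous_toFun := by
    have h (a b : ℤ) : Continuous fun x : Circle × Circle => x.1 ^ a * x.2 ^ b := by fun_prop
    exact (N.smooth.continuous.comp
      ((h _ _).prodMk (continuous_induced_dom.comp (h _ _)))).subtype_mk _

variable (N r) in
/-- The inclusion of the exterior. -/
def inl : C(N.Exterior, DehnSurgery N r) where
  toFun x := Quot.mk _ (Sum.inl x)
  continuous_toFun := continuous_quot_mk.comp continuous_inl

variable (N r) in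
/-- The inclusion of the solid torus. -/
def inr : C(Circle × Disk, DehnSurgery N r) where
  toFun x := Quot.mk _ (Sum.inr x)
  continuous_toFun := continuous_quot_mk.comp continuous_inr

theorem inr_bdry (u v : Circle) : inr N r (u, v.toDisk) = inl N r (glueMap N r (u, v)) :=
  Quot.sound (Glue.glue u v)

/-- The radial coordinate in the solid torus, extended by `1`. -/
def radius : C(DehnSurgery N r, ℝ) where
  toFun := Quot.lift (Sum.elim (fun _ => 1) fun x : Circle × Disk => ‖(x.2 : ℂ)‖) (by
    rintro _ _ ⟨u, v⟩; simp [SolidTorus.bdryPoint, Circle.norm_coe])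
  continuous_toFun := continuous_quot_lift _
    (continuous_const.sumElim (by fun_prop : Continuous fun x : Circle × Disk => ‖(x.2 : ℂ)‖))

@[simp] theorem radius_inl (e : N.Exterior) : radius (inl N r e) = 1 := rfl
@[simp] theorem radius_inr (x : Circle × Disk) : radius (inr N r x) = ‖(x.2 : ℂ)‖ := rfl

@[elab_as_elim]
theorem induction {P : DehnSurgery N r → Prop} (h1 : ∀ e, P (inl N r e)) (h2 : ∀ x, P (inr N r x))
    (y) : P y := by
  obtain ⟨y | y⟩ := y
  · exact h1 y
  · exact h2 y

theorem continuousOn_of_comp {Z : Type*} [TopologicalSpace Z] {f : DehnSurgery N r → Z}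
    {S : Set (DehnSurgery N r)} (hS : IsOpen S)
    (h1 : ∀ e, inl N r e ∈ S → ContinuousAt (f ∘ inl N r) e)
    (h2 : ∀ x, inr N r x ∈ S → ContinuousAt (f ∘ inr N r) x) : ContinuousOn f S := by
  have hq : IsQuotientMap (Quot.mk (Glue N r)) := isQuotientMap_quot_mk
  refine (hq.continuousOn_isOpen_iff hS).2 ?_
  rintro (e | x) hx
  · exact ((IsOpenEmbedding.inl.continuousAt_iff).1 (h1 e hx)).continuousWithinAt
  · exact ((IsOpenEmbedding.inr.continuousAt_iff).1 (h2 x hx)).continuousWithinAt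

theorem isOpen_off_core : IsOpen {y : DehnSurgery N r | 0 < radius y} :=
  isOpen_lt continuous_const radius.continuous

theorem isOpen_interior : IsOpen {y : DehnSurgery N r | radius y < 1} :=
  isOpen_lt radius.continuous continuous_const

theorem cover : {y : DehnSurgery N r | 0 < radius y} ∪ {y | radius y < 1} = univ := by
  ext y
  simp only [mem_union, mem_ofPred_eq, mem_univ, iff_true]
  rcases lt_or_ge 0 (radius y) with h | h
  · exact Or.inl h
  · exact Or.inr (h.trans_lt one_pos)

/-- The radial retraction of the complement of the core to the exterior. -/
def retr : DehnSurgery N r → N.Exterior :=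
  Quot.lift (Sum.elim id fun x : Circle × Disk => glueMap N r (x.1, Complex.dir x.2)) (by
    rintro _ _ ⟨u, v⟩
    simp [SolidTorus.bdryPoint, Complex.dir_circle, glueMap])

@[simp] theorem retr_inl (e : N.Exterior) : retr (inl N r e) = e := rfl
@[simp] theorem retr_inr (x : Circle × Disk) :
    retr (inr N r x) = glueMap N r (x.1, Complex.dir x.2) := rfl

theorem continuousOn_retr : ContinuousOn (retr (N := N) (r := r)) {y | 0 < radius y} := by
  refine continuousOn_of_comp isOpen_off_core (fun e _ => continuousAt_id) fun x hx => ?_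
  refine (glueMap N r).continuous.continuousAt.comp
    (f := fun x : Circle × Disk => (x.1, Complex.dir x.2)) (x := x) ?_
  refine continuousAt_fst.prodMk ?_
  exact (Complex.continuousAt_dir (by simpa using hx)).comp (f := fun x : Circle × Disk => (x.2 : ℂ))
    (by fun_prop)

/-- Segments in the meridian disks. -/
def fiberLine : C(Circle × Disk × Disk, C(ℝ, DehnSurgery N r)) :=
  ContinuousMap.curry ((inr N r).comp
    ⟨fun x : (Circle × Disk × Disk) × ℝ => (x.1.1, Disk.line (x.1.2.1, x.1.2.2, x.2)), by fun_prop⟩)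

theorem fiberLine_apply (u : Circle) (z w : Disk) (s : ℝ) :
    fiberLine (N := N) (r := r) (u, z, w) s = inr N r (u, Disk.line (z, w, s)) := rfl

/-- The radial path from a point off the core to the exterior. -/
def track : DehnSurgery N r → C(ℝ, DehnSurgery N r) :=
  Quot.lift (Sum.elim (fun e => ContinuousMap.const ℝ (inl N r e))
    fun x : Circle × Disk => fiberLine (x.1, x.2, (Complex.dir x.2).toDisk)) (by
    rintro _ _ ⟨u, v⟩
    ext s
    simp only [SolidTorus.bdryPoint, Sum.elim_inr, Sum.elim_inl, Complex.dir_circle,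
      fiberLine_apply, ContinuousMap.const_apply]
    have : Disk.line (v.toDisk, v.toDisk, s) = v.toDisk := by ext; simp [Disk.line]
    exact (congrArg (fun z => inr N r (u, z)) this).trans (inr_bdry u v))

theorem track_inr (x : Circle × Disk) :
    track (inr N r x) = fiberLine (x.1, x.2, (Complex.dir x.2).toDisk) := rfl

theorem continuousOn_track : ContinuousOn (track (N := N) (r := r)) {y | 0 < radius y} := by
  refine continuousOn_of_comp isOpen_off_core (fun e _ => ?_) fun x hx => ?_
  · exact (ContinuousMap.continuous_const'.comp (inl N r).continuous).continuousAt
  · refine (fiberLine (N := N) (r := r)).continuous.continuousAt.comp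
      (f := fun x : Circle × Disk => (x.1, x.2, (Complex.dir x.2).toDisk)) (x := x) ?_
    refine continuousAt_fst.prodMk (continuousAt_snd.prodMk ?_)
    refine Circle.continuous_toDisk.continuousAt.comp ?_
    exact (Complex.continuousAt_dir (by simpa using hx)).comp
      (f := fun x : Circle × Disk => (x.2 : ℂ)) (by fun_prop)

theorem track_zero (y : DehnSurgery N r) : track y 0 = y := by
  induction y using induction with
  | h1 e => rfl
  | h2 x =>
    rw [track_inr, fiberLine_apply]
    congr 1
    ext1
    · rfl
    · ext; simp [Disk.line]

theorem track_one (y : DehnSurgery N r) : track y 1 = inl N r (retr y) := by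
  induction y using induction with
  | h1 e => rfl
  | h2 x =>
    rw [track_inr, fiberLine_apply, retr_inr, ← inr_bdry]
    congr 2
    ext; simp [Disk.line]

open Classical in
/-- The coordinates in the interior of the solid torus. -/
def coord : DehnSurgery N r → Circle × Disk :=
  Quot.lift (Sum.elim (fun _ => (1, Disk.proj 0))
    fun x : Circle × Disk => if ‖(x.2 : ℂ)‖ < 1 then x else (1, Disk.proj 0))
    (by rintro _ _ ⟨u, v⟩; simp [SolidTorus.bdryPoint, Circle.norm_coe])

theorem inr_coord {y : DehnSurgery N r} (hy : radius y < 1) : inr N r (coord y) = y := by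
  induction y using induction with
  | h1 e => simp at hy
  | h2 x =>
    have : coord (inr N r x) = if ‖(x.2 : ℂ)‖ < 1 then x else (1, Disk.proj 0) := rfl
    rw [this, if_pos (by simpa using hy)]

theorem continuousOn_coord : ContinuousOn (coord (N := N) (r := r)) {y | radius y < 1} := by
  refine continuousOn_of_comp isOpen_interior (fun e he => by simp at he) fun x hx => ?_
  have hx' : ‖(x.2 : ℂ)‖ < 1 := by simpa using hx
  have ho : IsOpen {x : Circle × Disk | ‖(x.2 : ℂ)‖ < 1} := isOpen_lt (by fun_prop) (by fun_prop)
  refine continuousAt_id.congr ?_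
  filter_upwards [ho.mem_nhds hx'] with y hy
  have : coord (inr N r y) = if ‖(y.2 : ℂ)‖ < 1 then y else (1, Disk.proj 0) := rfl
  rw [Function.comp, this, if_pos hy, id]

end DehnSurgery

end

/-! ### Passing holonomies between the exterior and the surgered manifold -/

section

open Set Filter Topology

namespace DehnSurgery

variable {K : Circle → S3} {N : TubularNbhd K} {r : ℚ} {G : Type*} [Group G]

/-- The torus in the exterior along which the solid torus is glued in. -/
def torus : C(Circle × Circle × ℝ, N.Exterior) :=
  (glueMap N r).comp ⟨fun x => (x.1, x.2.1), by fun_prop⟩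

/-- The loop `v ↦ ν(v ^ q, v ^ p)` which bounds a disk in the surgered manifold. -/
def slopeLoop (N : TubularNbhd K) (r : ℚ) : C(ℝ, N.Exterior) :=
  (glueMap N r).comp ⟨fun t => (1, Circle.exp (2 * Real.pi * t)), by fun_prop⟩

/-- A path in the boundary torus, along a meridian of the solid torus. -/
def fiberArc (N : TubularNbhd K) (r : ℚ) (u : Circle) : C(ℝ, N.Exterior) :=
  (glueMap N r).comp ⟨fun t => (u, Circle.exp t), by fun_prop⟩

/-- Two lifts of the same end point differ by turns around the boundary of a meridian disk, whose
holonomy is conjugate to a power of that of the slope. This makes the use of the discontinuous `arg`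
in `exists_extend` harmless. -/
theorem fiberArc_eq (ρ : Hol N.Exterior G) (h : ρ (slopeLoop N r) = 1) (u : Circle) {b b' : ℝ}
    (hb : Circle.exp b = Circle.exp b') :
    ρ ((fiberArc N r u).seg 0 b) = ρ ((fiberArc N r u).seg 0 b') := by
  obtain ⟨n, hn⟩ := Circle.exp_eq_exp.1 hb
  have hM : ρ.meridian (torus (r := r)) = 1 := h
  have h1 : ρ ((fiberArc N r u).seg 0 (n * (2 * Real.pi))) = 1 := by
    obtain ⟨g, hg, -⟩ := ρ.torus_loop (torus (r := r)) (HasDeg.const u) (HasDeg.exp n)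
      (ξ := fun _ => 0) continuous_const rfl (γ := (fiberArc N r u).seg 0 (n * (2 * Real.pi)))
      (fun t => by
        simp only [ContinuousMap.seg, fiberArc, torus, ContinuousMap.comp_apply,
          ContinuousMap.coe_mk]
        rw [← Circle.exp_intCast_mul]
        congr 3; simp only [smul_eq_mul]; ring)
    rw [hg, hM]; simp
  rw [← ρ.seg_trans _ 0 (n * (2 * Real.pi)) b, h1, one_mul]
  congr 1; ext1 t
  simp only [ContinuousMap.seg, fiberArc, ContinuousMap.comp_apply, ContinuousMap.coe_mk]
  congr 2
  exact Circle.exp_eq_exp.2 ⟨n, by rw [hn]; simp only [smul_eq_mul]; ring⟩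

/-- A holonomy on the exterior which is trivial on the slope extends to the surgered manifold. -/
theorem exists_extend (ρ : Hol N.Exterior G) (h : ρ (slopeLoop N r) = 1) :
    ∃ Ω : Hol (DehnSurgery N r) G, ∀ γ, Ω ((inl N r).comp γ) = ρ γ := by
  let U : Set (DehnSurgery N r) := {y | 0 < radius y}
  let V : Set (DehnSurgery N r) := {y | radius y < 1}
  let fU : C(U, N.Exterior) := ⟨fun y => retr y.1, continuousOn_retr.domRestrict⟩
  let cV : C(V, Circle × Disk) := ⟨fun y => coord y.1, continuousOn_coord.domRestrict⟩
  let fV : C(V, N.Exterior) := (glueMap N r).comp ⟨fun y => ((cV y).1, 1), by fun_prop⟩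
  -- Inside the solid torus each meridian disk is collapsed to the boundary point with angle 1. The
  -- gauge factor transports from that point to the radial projection of `y` along the boundary of
  -- the disk.
  let g (y : V) : G := ρ ((fiberArc N r (cV y).1).seg 0 ((Complex.dir (cV y).2 : Circle) : ℂ).arg)
  have hc : Hol.Compat (ρ.comap fU) ((ρ.comap fV).gauge g) := by
    intro γ γ' hγ
    let x : C(ℝ, Circle × Disk) := cV.comp γ'
    have hx (t : ℝ) : inr N r (x t) = γ t := by rw [hγ]; exact inr_coord (γ' t).2
    have hx0 (t : ℝ) : ((x t).2 : ℂ) ≠ 0 := by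
      have : 0 < radius (γ t : DehnSurgery N r) := (γ t).2
      rw [← hx, radius_inr] at this
      exact norm_pos_iff.1 this
    have hdir : Continuous fun t => Complex.dir (x t).2 := Continuous.dir (by fun_prop) hx0
    obtain ⟨b, hb⟩ := Circle.exists_lift ⟨_, hdir⟩
    simp only [ContinuousMap.coe_mk] at hb
    -- The homotopy turns the angular coordinate continuously from 1 to the actual direction of the
    -- path.
    let σ : C(ℝ × ℝ, N.Exterior) := (glueMap N r).comp
      ⟨fun s => ((x s.2).1, Circle.exp (s.1 * b s.2)), by fun_prop⟩
    have hsq := ρ.square σ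
    have e1 : σ.seg (0, 0) (0, 1) = fV.comp γ' := by
      ext1 t; simp [ContinuousMap.seg, σ, fV, x]
    have e2 : σ.seg (1, 0) (1, 1) = fU.comp γ := by
      ext1 t
      have e : σ.seg (1, 0) (1, 1) t = glueMap N r ((x t).1, Circle.exp (b t)) := by
        simp [ContinuousMap.seg, σ]
      rw [e, ← hb, ← retr_inr, hx]
      rfl
    have e3 (t : ℝ) : ρ (σ.seg (0, t) (1, t)) = g (γ' t) := by
      have : σ.seg (0, t) (1, t) = (fiberArc N r (x t).1).seg 0 (b t) := by
        ext1 s; simp [ContinuousMap.seg, σ, fiberArc]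
      rw [this]
      refine fiberArc_eq ρ h _ ?_
      rw [← hb, Circle.exp_arg]
      rfl
    rw [e1, e2, e3, e3] at hsq
    simp only [Hol.comap_apply, Hol.gauge_apply]
    rw [mul_assoc, hsq, inv_mul_cancel_left]
  obtain ⟨Ω, hΩ, -⟩ := Hol.exists_glue isOpen_off_core isOpen_interior cover hc
  refine ⟨Ω, fun γ => ?_⟩
  have := hΩ ⟨fun t => ⟨inl N r (γ t), by simp⟩, by fun_prop⟩
  exact this

/-- A loop in a meridian disk has trivial holonomy; more precisely, the holonomy of a path in such a
disk depends on its end points only. -/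
theorem hol_slopeLoop (Φ : Hol (DehnSurgery N r) G) : Φ ((inl N r).comp (slopeLoop N r)) = 1 := by
  have e : (inl N r).comp (slopeLoop N r) = ((inr N r).comp
      ⟨fun z : ℂ => (1, Disk.proj z), by fun_prop⟩).comp
      ⟨fun t : ℝ => ((Circle.exp (2 * Real.pi * t)).toDisk : ℂ),
        Circle.continuous_toDisk_coe (by fun_prop)⟩ := by
    ext1 t
    simp only [slopeLoop, ContinuousMap.comp_apply, ContinuousMap.coe_mk, Disk.proj_coe]
    rw [← inr_bdry]
  rw [e, Φ.comp_eq_seg]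
  simp only [ContinuousMap.coe_mk, mul_zero, Circle.exp_zero, mul_one, Circle.exp_two_pi]
  exact Φ.seg_self _ _

/-- The meridian disk over `u`, extended to the plane. -/
def fiberPlane (N : TubularNbhd K) (r : ℚ) (u : Circle) : C(ℂ, DehnSurgery N r) :=
  (inr N r).comp ⟨fun z : ℂ => (u, Disk.proj z), by fun_prop⟩

theorem hol_fiberLine (Φ : Hol (DehnSurgery N r) G) (u : Circle) (z w : Disk) :
    Φ (fiberLine (u, z, w)) = Φ ((fiberPlane N r u).seg z w) := by
  refine Φ.congr_Icc fun t ht => ?_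
  have h : ((Disk.line (z, w, t) : Disk) : ℂ) = z + t • ((w : ℂ) - z) := by
    simp [Disk.line, min_eq_right ht.2, max_eq_right ht.1]
  rw [fiberLine_apply]
  simp only [fiberPlane, ContinuousMap.seg, ContinuousMap.comp_apply, ContinuousMap.coe_mk]
  rw [← h, Disk.proj_coe]

open Classical in
/-- The loops in the exterior generate the fundamental group of the surgered manifold. -/
theorem exists_conj [PathConnectedSpace N.Exterior] (Φ : Hol (DehnSurgery N r) G) :
    ∃ (e₀ : N.Exterior) (h : DehnSurgery N r → G), ∀ γ : C(ℝ, DehnSurgery N r),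
      ∃ p : Path e₀ e₀, Φ γ = (h (γ 0))⁻¹ * (Φ.comap (inl N r)).onPath p * h (γ 1) := by
  set ρ := Φ.comap (inl N r) with hρ
  set e₀ : N.Exterior := glueMap N r (1, 1)
  let q (e : N.Exterior) : Path e₀ e := PathConnectedSpace.somePath e₀ e
  let ι (u : Circle) : Disk → G := fun z => Φ (fiberLine (u, z, (1 : Circle).toDisk))
  let U : Set (DehnSurgery N r) := {y | 0 < radius y}
  let V : Set (DehnSurgery N r) := {y | radius y < 1}
  -- `h y` is the holonomy of a path from `e₀` to `y` that runs through the exterior and then enters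
  -- the solid torus: radially off the core, or within the meridian disk from its boundary point of
  -- angle 1 on the core.
  let h (y : DehnSurgery N r) : G := if y ∈ U then ρ.onPath (q (retr y)) * (Φ (track y))⁻¹
    else ρ.onPath (q (glueMap N r ((coord y).1, 1))) * (ι (coord y).1 (coord y).2)⁻¹
  -- On the overlap the two ways of entering the solid torus differ by an arc in the boundary of a
  -- meridian disk. The disk is simply connected, so the discrepancy is the holonomy of a path in
  -- the exterior.
  have hV (y) (hy : y ∈ V) : ∃ p : Path e₀ (glueMap N r ((coord y).1, 1)),
      h y * ι (coord y).1 (coord y).2 = ρ.onPath p := by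
    by_cases hyU : y ∈ U
    · obtain ⟨x, rfl⟩ : ∃ x, y = inr N r x := ⟨coord y, (inr_coord hy).symm⟩
      have hx : coord (inr N r x) = x := by
        have : coord (inr N r x) = if ‖(x.2 : ℂ)‖ < 1 then x else (1, Disk.proj 0) := rfl
        rw [this, if_pos (show ‖(x.2 : ℂ)‖ < 1 from hy)]
      rw [hx]
      set b := (Complex.dir x.2 : ℂ).arg with hb
      have hb' : Complex.dir x.2 = Circle.exp b := (Circle.exp_arg _).symm
      let arc : C(ℝ, N.Exterior) := (fiberArc N r x.1).seg b 0
      have a0 : arc 0 = retr (inr N r x) := by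
        simp [arc, ContinuousMap.seg, fiberArc, hb']
      have a1 : arc 1 = glueMap N r (x.1, 1) := by
        simp [arc, ContinuousMap.seg, fiberArc]
      refine ⟨(q _).trans (arc.toPath.cast a0.symm a1.symm), ?_⟩
      have harc : ρ.onPath (arc.toPath.cast a0.symm a1.symm) = ρ arc := ρ.onPath_toPath arc
      simp only [h, if_pos hyU, Hol.onPath_trans, harc]
      rw [mul_assoc]
      congr 1
      simp only [track_inr, ι, hol_fiberLine]
      rw [← Φ.seg_symm, Φ.seg_trans]
      have : (inl N r).comp arc = (fiberPlane N r x.1).comp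
          ⟨fun t => ((Circle.exp (b + t • (0 - b))).toDisk : ℂ),
            Circle.continuous_toDisk_coe (by fun_prop)⟩ := by
        ext1 t
        simp only [arc, ContinuousMap.seg, fiberArc, ContinuousMap.comp_apply,
          ContinuousMap.coe_mk, fiberPlane, Disk.proj_coe]
        rw [← inr_bdry]
      rw [hρ, Hol.comap_apply, this, Φ.comp_eq_seg]
      simp only [ContinuousMap.coe_mk, zero_smul, add_zero, one_smul, add_sub_cancel, hb',
        Circle.exp_zero]
    · exact ⟨q _, by simp only [h, if_neg hyU]; group⟩
  have key := (Φ.gauge fun y => (h y)⁻¹).mem_of_cover isOpen_off_core isOpen_interior cover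
    (S := {a | ∃ p : Path e₀ e₀, a = ρ.onPath p}) ?_ ?_ ?_
  · refine ⟨e₀, h, fun γ => ?_⟩
    obtain ⟨p, hp⟩ := key γ
    refine ⟨p, ?_⟩
    rw [← hp, Hol.gauge_apply]
    group
  · rintro _ ⟨p, rfl⟩ _ ⟨p', rfl⟩
    exact ⟨p.trans p', (ρ.onPath_trans p p').symm⟩
  · intro γ hγ
    let fγ : C(ℝ, N.Exterior) :=
      ⟨fun t => retr (γ t), continuousOn_retr.comp_continuous γ.continuous hγ⟩
    have htr : Continuous fun t => track (γ t) :=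
      continuousOn_track.comp_continuous γ.continuous hγ
    let σ : C(ℝ × ℝ, DehnSurgery N r) := ⟨fun s => track (γ s.2) s.1, (htr.comp continuous_snd).eval continuous_fst⟩
    have hsq := Φ.square σ
    have e1 : σ.seg (0, 0) (0, 1) = γ := by
      ext1 t; simp [ContinuousMap.seg, σ, track_zero]
    have e2 : σ.seg (1, 0) (1, 1) = (inl N r).comp fγ := by
      ext1 t; simp [ContinuousMap.seg, σ, track_one, fγ]
    have e3 (t : ℝ) : σ.seg (0, t) (1, t) = track (γ t) := by
      ext1 s; simp [ContinuousMap.seg, σ]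
    rw [e1, e2, e3, e3] at hsq
    refine ⟨((q (fγ 0)).trans fγ.toPath).trans (q (fγ 1)).symm, ?_⟩
    have h0 : γ 0 ∈ U := hγ 0
    have h1 : γ 1 ∈ U := hγ 1
    rw [Hol.onPath_trans, Hol.onPath_trans, Hol.onPath_symm, Hol.onPath_toPath, Hol.gauge_apply,
      hρ, Hol.comap_apply]
    simp only [h, if_pos h0, if_pos h1]
    rw [eq_mul_inv_of_mul_eq hsq]
    simp only [fγ, ContinuousMap.coe_mk, hρ]
    group
  · intro γ hγ
    let x : C(ℝ, Circle × Disk) :=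
      ⟨fun t => coord (γ t), continuousOn_coord.comp_continuous γ.continuous hγ⟩
    have hx (t : ℝ) : inr N r (x t) = γ t := inr_coord (hγ t)
    let fγ : C(ℝ, N.Exterior) := (glueMap N r).comp ⟨fun t => ((x t).1, 1), by fun_prop⟩
    let σ : C(ℝ × ℝ, DehnSurgery N r) :=
      ⟨fun s => fiberLine ((x s.2).1, (x s.2).2, (1 : Circle).toDisk) s.1, by fun_prop⟩
    have hsq := Φ.square σ
    have e1 : σ.seg (0, 0) (0, 1) = γ := by
      ext1 t
      simp only [ContinuousMap.seg, σ, ContinuousMap.coe_mk, fiberLine_apply]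
      rw [← hx]
      congr 1
      ext1 <;> simp [Disk.line]
    have e2 : σ.seg (1, 0) (1, 1) = (inl N r).comp fγ := by
      ext1 t
      simp only [ContinuousMap.seg, σ, ContinuousMap.coe_mk, fiberLine_apply, fγ,
        ContinuousMap.comp_apply]
      rw [← inr_bdry]
      congr 1
      ext1 <;> simp [Disk.line]
    have e3 (t : ℝ) : Φ (σ.seg (0, t) (1, t)) = ι (x t).1 (x t).2 := by
      congr 1
      ext1 s; simp [ContinuousMap.seg, σ]
    rw [e1, e2, e3, e3] at hsq
    obtain ⟨p, hp⟩ := hV _ (hγ 0)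
    obtain ⟨p', hp'⟩ := hV _ (hγ 1)
    refine ⟨(p.trans fγ.toPath).trans p'.symm, ?_⟩
    have e4 : ρ.onPath fγ.toPath = ρ fγ := ρ.onPath_toPath fγ
    have e5 : ρ.onPath (p.trans fγ.toPath) = ρ.onPath p * ρ.onPath fγ.toPath :=
      ρ.onPath_trans p fγ.toPath
    rw [Hol.onPath_trans, e5, Hol.onPath_symm, e4, Hol.gauge_apply, ← hp, ← hp', hρ,
      Hol.comap_apply, eq_mul_inv_of_mul_eq hsq]
    simp only [x, ContinuousMap.coe_mk]
    group

end DehnSurgery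

end

/-! ### Tubular neighbourhoods are open embeddings; winding around a nondegenerate zero -/

section

open Set Filter Topology

namespace TubularNbhd

variable {K : Circle → S3} (N : TubularNbhd K)

theorem contDiff_inCoordinates : ContDiff ℝ ∞ (inCoordinates N.toFun) := by
  rw [← contMDiff_iff_contDiff]
  have : Fact (Module.finrank ℝ (EuclideanSpace ℝ (Fin 4)) = 3 + 1) := ⟨by simp⟩
  have h1 : ContMDiff 𝓘(ℝ, ℝ × ℂ) 𝓘(ℝ, ℝ) ∞ (Prod.fst : ℝ × ℂ → ℝ) := contDiff_fst.contMDiff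
  have h2 : ContMDiff 𝓘(ℝ, ℝ × ℂ) 𝓘(ℝ, ℂ) ∞ (Prod.snd : ℝ × ℂ → ℂ) := contDiff_snd.contMDiff
  have h3 : ContMDiff 𝓘(ℝ, ℝ × ℂ) ((𝓡 1).prod 𝓘(ℝ, ℂ)) ∞
      (fun x : ℝ × ℂ => (Circle.exp x.1, x.2)) := (contMDiff_circleExp.comp h1).prodMk h2
  exact (contMDiff_coe_sphere (n := 3)).comp (N.smooth.comp h3)

/-- The derivative of `(x, ρ) ↦ ρ • ν(x)` at `ρ = 1`. -/
def coneDeriv (x : ℝ × ℂ) : (ℝ × ℂ) × ℝ →L[ℝ] EuclideanSpace ℝ (Fin 4) :=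
  (fderiv ℝ (inCoordinates N.toFun) x).comp (.fst ℝ (ℝ × ℂ) ℝ) +
    (ContinuousLinearMap.snd ℝ (ℝ × ℂ) ℝ).smulRight (inCoordinates N.toFun x)

theorem hasStrictFDerivAt_cone (x : ℝ × ℂ) :
    HasStrictFDerivAt (fun y : (ℝ × ℂ) × ℝ => y.2 • inCoordinates N.toFun y.1)
      (N.coneDeriv x) (x, 1) := by
  have h1 : HasStrictFDerivAt (inCoordinates N.toFun) (fderiv ℝ (inCoordinates N.toFun) x) x :=
    N.contDiff_inCoordinates.contDiffAt.hasStrictFDerivAt (by simp)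
  have h2 : HasStrictFDerivAt (fun y : (ℝ × ℂ) × ℝ => inCoordinates N.toFun y.1)
      ((fderiv ℝ (inCoordinates N.toFun) x).comp (.fst ℝ (ℝ × ℂ) ℝ)) (x, (1 : ℝ)) :=
    HasStrictFDerivAt.comp (x, (1 : ℝ)) h1 hasStrictFDerivAt_fst
  have h3 : N.coneDeriv x =
      (1 : ℝ) • (fderiv ℝ (inCoordinates N.toFun) x).comp (.fst ℝ (ℝ × ℂ) ℝ) +
        (ContinuousLinearMap.snd ℝ (ℝ × ℂ) ℝ).smulRight (inCoordinates N.toFun x) := by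
    rw [one_smul, coneDeriv]
  rw [h3]
  exact (hasStrictFDerivAt_snd (𝕜 := ℝ) (p := (x, (1 : ℝ)))).smul h2

theorem fderiv_apply (x : ℝ × ℂ) (v : ℝ × ℂ) : fderiv ℝ (inCoordinates N.toFun) x v =
    v.1 • fderiv ℝ (inCoordinates N.toFun) x (1, 0) +
    v.2.re • fderiv ℝ (inCoordinates N.toFun) x (0, 1) +
    v.2.im • fderiv ℝ (inCoordinates N.toFun) x (0, Complex.I) := by
  rw [← map_smul, ← map_smul, ← map_smul, ← map_add, ← map_add]
  congr 1
  ext <;> simp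

/-- The rows of the matrix in `orientationDet` are the images of a basis under `coneDeriv`, so its
nonvanishing determinant gives injectivity. -/
theorem coneDeriv_injective (x : ℝ × ℂ) : Function.Injective (N.coneDeriv x) := by
  rw [injective_iff_map_eq_zero]
  rintro ⟨v, ρ⟩ h
  have h' : ρ • inCoordinates N.toFun x + (v.1 • fderiv ℝ (inCoordinates N.toFun) x (1, 0) +
    v.2.re • fderiv ℝ (inCoordinates N.toFun) x (0, 1) +
    v.2.im • fderiv ℝ (inCoordinates N.toFun) x (0, Complex.I)) = 0 := by
    rw [← N.fderiv_apply, add_comm]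
    simpa [coneDeriv] using h
  have := Matrix.eq_zero_of_vecMul_eq_zero (v := ![ρ, v.1, v.2.re, v.2.im]) (N.orientation x).ne' (by
    ext i
    have := congrArg (fun w : EuclideanSpace ℝ (Fin 4) => w.ofLp i) h'
    simp only [WithLp.ofLp_add, WithLp.ofLp_smul, Pi.add_apply, Pi.smul_apply, smul_eq_mul,
      WithLp.ofLp_zero, Pi.zero_apply] at this
    simp [Matrix.vecMul, dotProduct, Fin.sum_univ_four]
    linarith)
  have e0 := congrFun this 0
  have e1 := congrFun this 1
  have e2 := congrFun this 2
  have e3 := congrFun this 3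
  simp at e0 e1 e2 e3
  exact Prod.ext (Prod.ext e1 (Complex.ext e2 e3)) e0

/-- The derivative of the cone as a linear equivalence. -/
def coneEquiv (x : ℝ × ℂ) : ((ℝ × ℂ) × ℝ) ≃L[ℝ] EuclideanSpace ℝ (Fin 4) :=
  (LinearEquiv.ofInjectiveOfFinrankEq (N.coneDeriv x : (ℝ × ℂ) × ℝ →ₗ[ℝ] _)
    (N.coneDeriv_injective x) (by simp [Complex.finrank_real_complex])).toContinuousLinearEquiv

/-- The inverse function theorem is applied in ℝ⁴ to the cone (x, ρ) ↦ ρ ν(x), which avoids charts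
of the sphere. The functional `ρ` in the conclusion is the radial part of the inverse derivative. -/
theorem exists_localInverse (x : ℝ × ℂ) : ∃ (ψ : EuclideanSpace ℝ (Fin 4) → ℝ × ℂ)
    (ψ' : EuclideanSpace ℝ (Fin 4) →L[ℝ] ℝ × ℂ) (ρ : EuclideanSpace ℝ (Fin 4) → ℝ),
    HasStrictFDerivAt ψ ψ' (inCoordinates N.toFun x) ∧ ψ (inCoordinates N.toFun x) = x ∧
    (∀ w, w = ρ w • inCoordinates N.toFun x + fderiv ℝ (inCoordinates N.toFun) x (ψ' w)) ∧
    ∀ᶠ y : S3 in 𝓝 (N.toFun (Circle.exp x.1, x.2)),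
      N.toFun (Circle.exp (ψ y).1, (ψ y).2) = y := by
  have hs : HasStrictFDerivAt (fun y : (ℝ × ℂ) × ℝ => y.2 • inCoordinates N.toFun y.1)
      (N.coneEquiv x : (ℝ × ℂ) × ℝ →L[ℝ] _) (x, 1) := by
    exact N.hasStrictFDerivAt_cone x
  have hx : (1 : ℝ) • inCoordinates N.toFun x = inCoordinates N.toFun x := one_smul _ _
  set I := hs.localInverse with hI
  have hI1 : HasStrictFDerivAt I _ _ := hs.to_localInverse
  have hI2 : I _ = _ := hs.localInverse_apply_image
  have hI3 := hs.eventually_right_inverse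
  simp only [hx] at hI1 hI2 hI3
  refine ⟨fun y => (I y).1, (ContinuousLinearMap.fst ℝ (ℝ × ℂ) ℝ).comp
    ((N.coneEquiv x).symm : EuclideanSpace ℝ (Fin 4) →L[ℝ] (ℝ × ℂ) × ℝ),
    fun w => ((N.coneEquiv x).symm w).2, ?_, ?_, ?_, ?_⟩
  · exact (ContinuousLinearMap.fst ℝ _ _).hasStrictFDerivAt.comp _ hI1
  · simp [hI2]
  · intro w
    conv_lhs => rw [← (N.coneEquiv x).apply_symm_apply w]
    change N.coneDeriv x _ = _
    simp only [coneDeriv, _root_.add_apply, ContinuousLinearMap.comp_apply,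
      ContinuousLinearMap.smulRight_apply]
    rw [add_comm]
    rfl
  · have hcoe : Tendsto (fun y : S3 => (y : EuclideanSpace ℝ (Fin 4)))
        (𝓝 (N.toFun (Circle.exp x.1, x.2))) (𝓝 (inCoordinates N.toFun x)) :=
      continuous_subtype_val.continuousAt
    have hpos : ∀ᶠ y in 𝓝 (inCoordinates N.toFun x), 0 < (I y).2 := by
      have hc : ContinuousAt (fun y => (I y).2) (inCoordinates N.toFun x) :=
        continuousAt_snd.comp hI1.continuousAt
      exact hc.eventually (lt_mem_nhds (by simp [hI2]))
    filter_upwards [hcoe.eventually hI3, hcoe.eventually hpos] with y h1 h2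
    have hn (z : S3) : ‖(z : EuclideanSpace ℝ (Fin 4))‖ = 1 := mem_sphere_zero_iff_norm.1 z.2
    -- On the unit sphere the positive radial coordinate has to be 1, so the inverse of the cone
    -- inverts ν itself.
    have h3 : (I y).2 = 1 := by
      have := congrArg norm h1
      rw [norm_smul, hn, inCoordinates, hn, mul_one, Real.norm_of_nonneg h2.le] at this
      exact this
    rw [h3, one_smul] at h1
    exact Subtype.ext h1

theorem isOpenMap : IsOpenMap N.toFun := by
  rw [isOpenMap_iff_nhds_le]
  rintro ⟨u, z⟩ S hS
  obtain ⟨t, rfl⟩ := Circle.exp_surjective u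
  obtain ⟨ψ, ψ', ρ, h1, h2, -, h4⟩ := N.exists_localInverse (t, z)
  have hc : ContinuousAt (fun y : S3 => (Circle.exp (ψ y).1, (ψ y).2))
      (N.toFun (Circle.exp t, z)) := by
    have : ContinuousAt (fun y : S3 => ψ y) (N.toFun (Circle.exp t, z)) :=
      h1.continuousAt.comp (f := fun y : S3 => (y : EuclideanSpace ℝ (Fin 4)))
        (x := N.toFun (Circle.exp t, z)) continuous_subtype_val.continuousAt
    exact (Circle.exp.continuous.continuousAt.comp (continuousAt_fst.comp this)).prodMk
      (continuousAt_snd.comp this)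
  have hval : (Circle.exp (ψ (N.toFun (Circle.exp t, z))).1, (ψ (N.toFun (Circle.exp t, z))).2) =
      (Circle.exp t, z) := by
    have : ψ (N.toFun (Circle.exp t, z)) = (t, z) := h2
    rw [this]
  rw [ContinuousAt, hval] at hc
  filter_upwards [h4, hc hS] with y hy hy'
  rw [← hy]
  exact hy'

theorem isOpenEmbedding : IsOpenEmbedding N.toFun :=
  .of_continuous_injective_isOpenMap N.smooth.continuous N.injective N.isOpenMap

end TubularNbhd

/-- This is Rouché's principle: the quotient of h by c e^(2πint) stays within distance less than 1
of 1, so it lies in the right half-plane and contributes degree zero. -/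
theorem Complex.hasDeg_dir {h : ℝ → ℂ} (hc : Continuous h) (h01 : h 0 = h 1) {c : ℂ} {n : ℤ}
    (hn : ∀ t, ‖h t - c * (Circle.exp (2 * Real.pi * t) : ℂ) ^ n‖ < ‖c‖) :
    HasDeg (fun t => dir (h t)) n := by
  have hc0 : c ≠ 0 := by rintro rfl; simpa using (norm_nonneg _).trans_lt (hn 0)
  have hu (t : ℝ) : ‖(Circle.exp (2 * Real.pi * t) : ℂ) ^ n‖ = 1 := by
    rw [norm_zpow, Circle.norm_coe, one_zpow]
  have hu0 (t : ℝ) : (Circle.exp (2 * Real.pi * t) : ℂ) ^ n ≠ 0 := by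
    rw [← norm_ne_zero_iff, hu]; simp
  let w (t : ℝ) : ℂ := h t / (c * (Circle.exp (2 * Real.pi * t) : ℂ) ^ n)
  have hwc : Continuous w := by
    refine hc.div ?_ fun t => mul_ne_zero hc0 (hu0 t)
    have h1 : Continuous fun t : ℝ => Circle.exp (2 * Real.pi * t) := by fun_prop
    have h2 : Continuous fun t : ℝ => ((Circle.exp (2 * Real.pi * t) ^ n : Circle) : ℂ) :=
      continuous_induced_dom.comp (h1.zpow n)
    simp only [Circle.coe_zpow] at h2
    exact continuous_const.mul h2
  have hw (t : ℝ) : ‖w t - 1‖ < 1 := by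
    have : w t - 1 = (h t - c * (Circle.exp (2 * Real.pi * t) : ℂ) ^ n) /
        (c * (Circle.exp (2 * Real.pi * t) : ℂ) ^ n) := by
      simp only [w]; rw [sub_div, div_self (mul_ne_zero hc0 (hu0 t))]
    rw [this, norm_div, norm_mul, hu, mul_one, div_lt_one (norm_pos_iff.2 hc0)]
    exact hn t
  have hre (t : ℝ) : 0 < (w t).re := by
    have := (abs_lt.1 ((Complex.abs_re_le_norm _).trans_lt (hw t))).1
    simp at this; linarith
  have hw0 (t : ℝ) : w t ≠ 0 := fun h => by simpa [h] using hre t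
  have hdw : HasDeg (fun t => dir (w t)) 0 := by
    refine HasDeg.of_mem_slitPlane (hwc.dir hw0) ?_ fun t => ?_
    · simp [w, h01]
    · left
      rw [coe_dir (hw0 t), Complex.div_ofReal_re]
      exact div_pos (hre t) (norm_pos_iff.2 (hw0 t))
  have := ((HasDeg.const (dir c)).mul (HasDeg.exp n)).mul hdw
  rw [zero_add, add_zero] at this
  convert this using 2 with t
  have e1 : dir ((Circle.exp (2 * Real.pi * t) : ℂ) ^ n) = Circle.exp (2 * Real.pi * t) ^ n := by
    rw [← Circle.coe_zpow, dir_circle]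
  rw [← e1, ← dir_mul hc0 (hu0 t), ← dir_mul (mul_ne_zero hc0 (hu0 t)) (hw0 t),
    mul_div_cancel₀ _ (mul_ne_zero hc0 (hu0 t))]

/-- The winding number of a real differentiable map of the plane around a nondegenerate zero. -/
theorem Complex.eventually_hasDeg_dir {k : ℂ → ℂ} {A : ℂ →L[ℝ] ℂ} {z₀ : ℂ}
    (hk : HasFDerivAt k A z₀) (hk0 : k z₀ = 0)
    {δ : ℝ} (hδ : 0 < δ) (hkc : ContinuousOn k (Metric.ball z₀ δ)) {θ' : ℝ}
    (hdet : 0 < θ' * ((A 1).re * (A Complex.I).im - (A 1).im * (A Complex.I).re)) :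
    ∀ᶠ ε : ℝ in 𝓝[>] 0, HasDeg (fun t => dir (k (z₀ + ε * Circle.exp (2 * Real.pi * t))))
      (SignType.sign θ' : ℤ) ∧ ∀ t, k (z₀ + ε * Circle.exp (2 * Real.pi * t)) ≠ 0 := by
  -- Write A v = α v + β v̄. The Jacobian is |α|² - |β|², so its sign decides which term dominates,
  -- and with it whether the winding number is 1 or -1.
  set α : ℂ := (A 1 - Complex.I * A Complex.I) / 2
  set β : ℂ := (A 1 + Complex.I * A Complex.I) / 2
  have hA (v : ℂ) : A v = α * v + β * (starRingEnd ℂ) v := by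
    have h0 : A v = v.re * A 1 + v.im * A Complex.I := by
      have : v = v.re • (1 : ℂ) + v.im • Complex.I := by simp
      conv_lhs => rw [this, map_add, map_smul, map_smul]
      rfl
    have h1 : v = v.re + v.im * Complex.I := (Complex.re_add_im v).symm
    have h2 : (starRingEnd ℂ) v = v.re - v.im * Complex.I := by
      apply Complex.ext <;> simp
    rw [h0, h2]
    linear_combination (-α) * h1 + (v.im * A Complex.I) * Complex.I_sq
  have hnorm : ‖α‖ ^ 2 - ‖β‖ ^ 2 = (A 1).re * (A Complex.I).im - (A 1).im * (A Complex.I).re := by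
    rw [← Complex.normSq_eq_norm_sq, ← Complex.normSq_eq_norm_sq]
    simp only [α, β, Complex.normSq_apply]
    simp
    ring
  rw [← hnorm] at hdet
  have main (c c' : ℂ) (hcc : ‖c'‖ < ‖c‖) (n : ℤ) (hAc : ∀ (ε : ℝ) (t : ℝ),
      ‖A (ε * Circle.exp (2 * Real.pi * t)) - (ε * c) * (Circle.exp (2 * Real.pi * t) : ℂ) ^ n‖ ≤
        |ε| * ‖c'‖) :
      ∀ᶠ ε : ℝ in 𝓝[>] 0, HasDeg (fun t => dir (k (z₀ + ε * Circle.exp (2 * Real.pi * t)))) n ∧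
        ∀ t, k (z₀ + ε * Circle.exp (2 * Real.pi * t)) ≠ 0 := by
    -- The remainder is kept below half of the gap between the dominant coefficient `c` and the
    -- other coefficient `c'`.
    have hlit := hk.isLittleO.def (half_pos (sub_pos.2 hcc))
    rw [Metric.eventually_nhds_iff] at hlit
    obtain ⟨η, hη, hb⟩ := hlit
    filter_upwards [Ioo_mem_nhdsGT (lt_min hη hδ)] with ε hε
    have hε0 : 0 < ε := hε.1
    have hnrm (t : ℝ) : ‖(ε * Circle.exp (2 * Real.pi * t) : ℂ)‖ = ε := by
      rw [norm_mul, Circle.norm_coe, mul_one, Complex.norm_real, Real.norm_of_nonneg hε0.le]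
    have hmem (t : ℝ) : dist (z₀ + ε * Circle.exp (2 * Real.pi * t)) z₀ = ε := by
      rw [dist_eq_norm, add_sub_cancel_left, hnrm]
    have hcont : Continuous fun t : ℝ => k (z₀ + ε * Circle.exp (2 * Real.pi * t)) := by
      refine hkc.comp_continuous (by fun_prop) fun t => ?_
      rw [Metric.mem_ball, hmem]; exact hε.2.trans_le (min_le_right _ _)
    have hest (t : ℝ) : ‖k (z₀ + ε * Circle.exp (2 * Real.pi * t)) -
        (ε * c) * (Circle.exp (2 * Real.pi * t) : ℂ) ^ n‖ < ‖(ε * c : ℂ)‖ := by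
      have h1 := hb (y := z₀ + ε * Circle.exp (2 * Real.pi * t)) (by
        rw [hmem]; exact hε.2.trans_le (min_le_left _ _))
      rw [hk0, sub_zero, add_sub_cancel_left, hnrm] at h1
      have h2 := hAc ε t
      rw [abs_of_pos hε0] at h2
      calc _ = ‖(k (z₀ + ε * Circle.exp (2 * Real.pi * t)) - A (ε * Circle.exp (2 * Real.pi * t))) +
            (A (ε * Circle.exp (2 * Real.pi * t)) -
              (ε * c) * (Circle.exp (2 * Real.pi * t) : ℂ) ^ n)‖ := by congr 1; ring
        _ ≤ (‖c‖ - ‖c'‖) / 2 * ε + ε * ‖c'‖ := (norm_add_le _ _).trans (add_le_add h1 h2)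
        _ < ‖(ε * c : ℂ)‖ := by
          rw [norm_mul, Complex.norm_real, Real.norm_of_nonneg hε0.le]
          nlinarith
    refine ⟨hasDeg_dir hcont (by simp) hest, fun t h0 => ?_⟩
    have := hest t
    rw [h0, zero_sub, norm_neg, norm_mul, norm_zpow, Circle.norm_coe, one_zpow, mul_one] at this
    exact lt_irrefl _ this
  rcases lt_or_gt_of_ne (show θ' ≠ 0 by rintro rfl; simp at hdet) with hθ | hθ
  · have hlt : ‖α‖ < ‖β‖ := by
      apply lt_of_pow_lt_pow_left₀ 2 (norm_nonneg _)
      nlinarith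
    rw [sign_neg hθ]
    refine main β α hlt (-1) fun ε t => le_of_eq ?_
    rw [hA, RingHom.map_mul, Complex.conj_ofReal, ← Circle.coe_inv_eq_conj, Circle.coe_inv]
    rw [zpow_neg_one, show ∀ a b c d : ℂ, a * (b * c) + d * (b * c⁻¹) - b * d * c⁻¹ = a * (b * c) from
      fun _ _ _ _ => by ring, norm_mul, norm_mul, Circle.norm_coe, Complex.norm_real,
      Real.norm_eq_abs]
    ring
  · have hlt : ‖β‖ < ‖α‖ := by
      apply lt_of_pow_lt_pow_left₀ 2 (norm_nonneg _)
      nlinarith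
    rw [sign_pos hθ]
    refine main α β hlt 1 fun ε t => le_of_eq ?_
    rw [hA, RingHom.map_mul, Complex.conj_ofReal]
    rw [zpow_one, show ∀ a b c d e : ℂ, a * (b * c) + d * (b * e) - b * a * c = d * (b * e) from
      fun _ _ _ _ _ => by ring, norm_mul, norm_mul, RCLike.norm_conj, Circle.norm_coe,
      Complex.norm_real, Real.norm_eq_abs]
    ring

end

/-! ### The local degree at a transverse crossing of a knot with a fibre -/

section

open Set Filter Topology

namespace TubularNbhd

variable {K : Circle → S3} (N : TubularNbhd K)

/-- The coordinates on the image of the tubular neighbourhood. -/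
def coords (y : S3) : Circle × ℂ :=
  (N.isOpenEmbedding.toOpenPartialHomeomorph N.toFun).symm y

@[simp] theorem coords_apply (x : Circle × ℂ) : N.coords (N.toFun x) = x :=
  (N.isOpenEmbedding.toOpenPartialHomeomorph N.toFun).left_inv (mem_univ x)

theorem apply_coords {y : S3} (hy : y ∈ range N.toFun) : N.toFun (N.coords y) = y := by
  obtain ⟨x, rfl⟩ := hy
  rw [coords_apply]

theorem continuousOn_coords : ContinuousOn N.coords (range N.toFun) := by
  have := (N.isOpenEmbedding.toOpenPartialHomeomorph N.toFun).continuousOn_symm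
  rwa [IsOpenEmbedding.toOpenPartialHomeomorph_target] at this

theorem isOpen_range : IsOpen (range N.toFun) := N.isOpenEmbedding.isOpen_range

theorem differentiable_inCoordinates : Differentiable ℝ (inCoordinates N.toFun) :=
  N.contDiff_inCoordinates.differentiable (by simp)

end TubularNbhd

/-- Both sides are the determinant of the mixed frame n, T', X, Y, expanded once in each of the two
given frames. -/
theorem Matrix.det_change_rows (n T X Y T' X' Y' : Fin 4 → ℝ) (θ a b ρ a₁ b₁ c₁ ρ' a₂ b₂ c₂ : ℝ)
    (hT : T' = θ • T + a • X + b • Y) (hX : X = ρ • n + a₁ • T' + b₁ • X' + c₁ • Y')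
    (hY : Y = ρ' • n + a₂ • T' + b₂ • X' + c₂ • Y') :
    θ * (Matrix.of ![n, T, X, Y]).det = (b₁ * c₂ - c₁ * b₂) * (Matrix.of ![n, T', X', Y']).det := by
  have h1 : Matrix.of ![n, T', X, Y] =
      !![1, 0, 0, 0; 0, θ, a, b; 0, 0, 1, 0; 0, 0, 0, 1] * Matrix.of ![n, T, X, Y] := by
    ext i j
    fin_cases i <;> simp [Matrix.mul_apply, Fin.sum_univ_four, hT]
  have h2 : Matrix.of ![n, T', X, Y] =
      !![1, 0, 0, 0; 0, 1, 0, 0; ρ, a₁, b₁, c₁; ρ', a₂, b₂, c₂] * Matrix.of ![n, T', X', Y'] := by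
    ext i j
    fin_cases i
    · simp [Matrix.mul_apply, Fin.sum_univ_four]
    · simp [Matrix.mul_apply, Fin.sum_univ_four]
    · simp only [Matrix.mul_apply, Fin.sum_univ_four]
      exact (congrFun hX j).trans (by simp)
    · simp only [Matrix.mul_apply, Fin.sum_univ_four]
      exact (congrFun hY j).trans (by simp)
  have e1 : (!![1, 0, 0, 0; 0, θ, a, b; 0, 0, 1, 0; 0, 0, 0, 1] : Matrix _ _ ℝ).det = θ := by
    simp [Matrix.det_succ_row_zero, Fin.sum_univ_succ, Fin.succAbove]
  have e2 : (!![1, 0, 0, 0; 0, 1, 0, 0; ρ, a₁, b₁, c₁; ρ', a₂, b₂, c₂] : Matrix _ _ ℝ).det =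
      b₁ * c₂ - c₁ * b₂ := by
    simp [Matrix.det_succ_row_zero, Fin.sum_univ_succ, Fin.succAbove, sub_eq_add_neg]
  have h3 := congrArg Matrix.det (h1.symm.trans h2)
  rwa [Matrix.det_mul, Matrix.det_mul, e1, e2] at h3

namespace TubularNbhd

variable {K₁ K₂ : Circle → S3} (N₁ : TubularNbhd K₁) (N₂ : TubularNbhd K₂)

/-- Let the core of `N₂` be transverse at a point to the fibre of `N₁`. Then the normal coordinate
of `N₂`, restricted to the fibre, is differentiable with a Jacobian whose sign is the direction in
which the core crosses the fibre. -/
theorem exists_fderiv_fibre {t₀ : ℝ} {θ : ℝ → ℝ} {ζ : ℝ → ℂ} {θ' : ℝ} {ζ' : ℂ}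
    (hθ : HasDerivAt θ θ' t₀) (hζ : HasDerivAt ζ ζ' t₀) (hθ' : θ' ≠ 0)
    (h : ∀ᶠ t in 𝓝 t₀, N₂.toFun (Circle.exp t, 0) = N₁.toFun (Circle.exp (θ t), ζ t)) :
    ∃ A : ℂ →L[ℝ] ℂ,
      HasFDerivAt (fun z => (N₂.coords (N₁.toFun (Circle.exp (θ t₀), z))).2) A (ζ t₀) ∧
      0 < θ' * ((A 1).re * (A Complex.I).im - (A 1).im * (A Complex.I).re) := by
  have hp := h.self_of_nhds
  obtain ⟨ψ, ψ', ρ, h1, -, h3, h4⟩ := N₂.exists_localInverse (t₀, 0)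
  set F₁ := inCoordinates N₁.toFun
  set F₂ := inCoordinates N₂.toFun
  have hp' : F₂ (t₀, 0) = F₁ (θ t₀, ζ t₀) := congrArg Subtype.val hp
  have d₁ : HasFDerivAt F₁ (fderiv ℝ F₁ (θ t₀, ζ t₀)) (θ t₀, ζ t₀) :=
    N₁.differentiable_inCoordinates.differentiableAt.hasFDerivAt
  have d₂ : HasFDerivAt F₂ (fderiv ℝ F₂ (t₀, 0)) (t₀, 0) :=
    N₂.differentiable_inCoordinates.differentiableAt.hasFDerivAt
  have hT : fderiv ℝ F₂ (t₀, 0) (1, 0) = fderiv ℝ F₁ (θ t₀, ζ t₀) (θ', ζ') := by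
    have e1 : HasDerivAt (fun t : ℝ => F₂ (t, 0)) (fderiv ℝ F₂ (t₀, 0) (1, 0)) t₀ :=
      HasFDerivAt.comp_hasDerivAt (f := fun t : ℝ => (t, (0 : ℂ))) t₀ d₂ ((hasDerivAt_id t₀).prodMk (hasDerivAt_const t₀ (0 : ℂ)))
    have e2 : HasDerivAt (fun t : ℝ => F₁ (θ t, ζ t)) (fderiv ℝ F₁ (θ t₀, ζ t₀) (θ', ζ')) t₀ :=
      HasFDerivAt.comp_hasDerivAt (f := fun t : ℝ => (θ t, ζ t)) t₀ d₁ (hθ.prodMk hζ)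
    refine e1.unique (e2.congr_of_eventuallyEq ?_)
    filter_upwards [h] with t ht
    exact congrArg Subtype.val ht
  let ι : ℂ →L[ℝ] ℝ × ℂ := ContinuousLinearMap.inr ℝ ℝ ℂ
  let A : ℂ →L[ℝ] ℂ := (ContinuousLinearMap.snd ℝ ℝ ℂ).comp
    (ψ'.comp ((fderiv ℝ F₁ (θ t₀, ζ t₀)).comp ι))
  have hA (v : ℂ) : A v = (ψ' (fderiv ℝ F₁ (θ t₀, ζ t₀) (0, v))).2 := rfl
  refine ⟨A, ?_, ?_⟩
  · have d₃ : HasFDerivAt (fun z : ℂ => F₁ (θ t₀, z)) ((fderiv ℝ F₁ (θ t₀, ζ t₀)).comp ι) (ζ t₀) :=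
      d₁.comp (ζ t₀) (hasFDerivAt_prodMk_right (θ t₀) (ζ t₀))
    have d₄ : HasFDerivAt ψ ψ' (F₁ (θ t₀, ζ t₀)) := hp' ▸ h1.hasFDerivAt
    have d₅ : HasFDerivAt (fun z : ℂ => (ψ (F₁ (θ t₀, z))).2) A (ζ t₀) :=
      (hasFDerivAt_snd).comp (ζ t₀) (d₄.comp (ζ t₀) d₃)
    refine d₅.congr_of_eventuallyEq ?_
    have hc : Tendsto (fun z => N₁.toFun (Circle.exp (θ t₀), z)) (𝓝 (ζ t₀))
        (𝓝 (N₂.toFun (Circle.exp t₀, 0))) := by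
      rw [hp]
      exact (N₁.smooth.continuous.comp (by fun_prop : Continuous fun z : ℂ =>
        (Circle.exp (θ t₀), z))).continuousAt
    filter_upwards [hc.eventually h4] with z hz
    rw [← hz, N₂.coords_apply]
    rfl
  · have o₁ := N₁.orientation (θ t₀, ζ t₀)
    have o₂ := N₂.orientation (t₀, 0)
    rw [orientationDet] at o₁ o₂
    have hX (v : ℂ) : (fderiv ℝ F₁ (θ t₀, ζ t₀) (0, v)).ofLp =
        ρ (fderiv ℝ F₁ (θ t₀, ζ t₀) (0, v)) • (F₁ (θ t₀, ζ t₀)).ofLp +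
          (ψ' (fderiv ℝ F₁ (θ t₀, ζ t₀) (0, v))).1 • (fderiv ℝ F₂ (t₀, 0) (1, 0)).ofLp +
          (A v).re • (fderiv ℝ F₂ (t₀, 0) (0, 1)).ofLp +
          (A v).im • (fderiv ℝ F₂ (t₀, 0) (0, Complex.I)).ofLp := by
      have := h3 (fderiv ℝ F₁ (θ t₀, ζ t₀) (0, v))
      rw [N₂.fderiv_apply, ← hA] at this
      conv_lhs => rw [this]
      rw [hp']
      simp only [WithLp.ofLp_add, WithLp.ofLp_smul, add_assoc]
      rfl
    have key := Matrix.det_change_rows _ (fderiv ℝ F₁ (θ t₀, ζ t₀) (1, 0)).ofLp _ _ _ _ _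
      θ' ζ'.re ζ'.im _ _ _ _ _ _ _ _ (by
        rw [hT, N₁.fderiv_apply]
        simp only [WithLp.ofLp_add, WithLp.ofLp_smul]; rfl) (hX 1) (hX Complex.I)
    rw [show inCoordinates N₂.toFun (t₀, 0) = F₁ (θ t₀, ζ t₀) from hp'] at o₂
    set D₁ := (Matrix.of ![(F₁ (θ t₀, ζ t₀)).ofLp, (fderiv ℝ F₁ (θ t₀, ζ t₀) (1, 0)).ofLp,
      (fderiv ℝ F₁ (θ t₀, ζ t₀) (0, 1)).ofLp, (fderiv ℝ F₁ (θ t₀, ζ t₀) (0, Complex.I)).ofLp]).det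
    set D₂ := (Matrix.of ![(F₁ (θ t₀, ζ t₀)).ofLp, (fderiv ℝ F₂ (t₀, 0) (1, 0)).ofLp,
      (fderiv ℝ F₂ (t₀, 0) (0, 1)).ofLp, (fderiv ℝ F₂ (t₀, 0) (0, Complex.I)).ofLp]).det
    set J := (A 1).re * (A Complex.I).im - (A 1).im * (A Complex.I).re
    -- The change of frame gives θ' D₁ = J D₂, so θ' J D₂ = θ'² D₁. Both neighbourhoods preserve
    -- orientation, which makes D₁ and D₂ positive.
    have : 0 < θ' * J * D₂ := by
      rw [mul_assoc, ← key, ← mul_assoc]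
      exact mul_pos (mul_self_pos.2 hθ') o₁
    exact (pos_iff_pos_of_mul_pos this).2 o₂

/-- The local degree of a meridional angle function `f` of `N₂` at a transverse crossing of the
core of `N₂` with a fibre of `N₁`. -/
theorem eventually_hasDeg_fibre {f : S3 → Circle} {g : Circle × ℂ → Circle} (hg : Continuous g)
    (hfg : ∀ u z, z ≠ 0 → f (N₂.toFun (u, z)) = g (u, z) * Complex.dir z)
    {t₀ : ℝ} {θ : ℝ → ℝ} {ζ : ℝ → ℂ} {θ' : ℝ} {ζ' : ℂ}
    (hθ : HasDerivAt θ θ' t₀) (hζ : HasDerivAt ζ ζ' t₀) (hθ' : θ' ≠ 0)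
    (h : ∀ᶠ t in 𝓝 t₀, N₂.toFun (Circle.exp t, 0) = N₁.toFun (Circle.exp (θ t), ζ t)) :
    ∀ᶠ ε : ℝ in 𝓝[>] 0, HasDeg (fun t => f (N₁.toFun
      (Circle.exp (θ t₀), ζ t₀ + ε * Circle.exp (2 * Real.pi * t)))) (SignType.sign θ' : ℤ) := by
  obtain ⟨A, hA, hdet⟩ := exists_fderiv_fibre N₁ N₂ hθ hζ hθ' h
  have hp := h.self_of_nhds
  set q : ℂ → Circle × ℂ := fun z => N₂.coords (N₁.toFun (Circle.exp (θ t₀), z)) with hq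
  have hi : Continuous fun z => N₁.toFun (Circle.exp (θ t₀), z) :=
    N₁.smooth.continuous.comp (by fun_prop)
  have hz₀ : N₁.toFun (Circle.exp (θ t₀), ζ t₀) ∈ range N₂.toFun := ⟨_, hp⟩
  have hO : IsOpen {z | N₁.toFun (Circle.exp (θ t₀), z) ∈ range N₂.toFun} :=
    N₂.isOpen_range.preimage hi
  have hqc : ContinuousOn q {z | N₁.toFun (Circle.exp (θ t₀), z) ∈ range N₂.toFun} :=
    N₂.continuousOn_coords.comp hi.continuousOn fun z hz => hz
  have hgq : ContinuousOn (fun z => (g (q (ζ t₀)))⁻¹ * g (q z))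
      {z | N₁.toFun (Circle.exp (θ t₀), z) ∈ range N₂.toFun} :=
    continuousOn_const.mul (hg.comp_continuousOn hqc)
  -- Near the crossing the factor `g` stays close to its value at the crossing, so it contributes
  -- degree zero on small circles.
  have hslit : ∀ᶠ z in 𝓝 (ζ t₀), (((g (q (ζ t₀)))⁻¹ * g (q z) : Circle) : ℂ) ∈ Complex.slitPlane ∧
      N₁.toFun (Circle.exp (θ t₀), z) ∈ range N₂.toFun := by
    refine Filter.Eventually.and ?_ (hO.mem_nhds hz₀)
    have h1 : ContinuousAt (fun z => (g (q (ζ t₀)))⁻¹ * g (q z)) (ζ t₀) :=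
      hgq.continuousAt (hO.mem_nhds hz₀)
    have h2 : ContinuousAt (fun z => (((g (q (ζ t₀)))⁻¹ * g (q z) : Circle) : ℂ)) (ζ t₀) :=
      continuous_induced_dom.continuousAt.comp h1
    refine h2.eventually (Complex.isOpen_slitPlane.mem_nhds ?_)
    change (((g (q (ζ t₀)))⁻¹ * g (q (ζ t₀)) : Circle) : ℂ) ∈ Complex.slitPlane
    rw [inv_mul_cancel]
    exact Complex.one_mem_slitPlane
  obtain ⟨δ, hδ, hball⟩ := Metric.eventually_nhds_iff_ball.1 hslit
  have hk0 : (q (ζ t₀)).2 = 0 := by rw [hq]; simp only; rw [← hp, N₂.coords_apply]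
  have hmain := Complex.eventually_hasDeg_dir (k := fun z => (q z).2) hA hk0 hδ
    (continuous_snd.comp_continuousOn (hqc.mono fun z hz => (hball z hz).2)) hdet
  filter_upwards [hmain, Ioo_mem_nhdsGT hδ] with ε ⟨hdeg, hne⟩ hε
  have hmem (t : ℝ) : ζ t₀ + ε * Circle.exp (2 * Real.pi * t) ∈ Metric.ball (ζ t₀) δ := by
    rw [Metric.mem_ball, dist_eq_norm, add_sub_cancel_left, norm_mul, Circle.norm_coe, mul_one,
      Complex.norm_real, Real.norm_of_nonneg hε.1.le]
    exact hε.2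
  have h0 : HasDeg (fun t => (g (q (ζ t₀)))⁻¹ *
      g (q (ζ t₀ + ε * Circle.exp (2 * Real.pi * t)))) 0 := by
    refine HasDeg.of_mem_slitPlane ?_ ?_ fun t => (hball _ (hmem t)).1
    · exact (hgq.mono fun z hz => (hball z hz).2).comp_continuous (by fun_prop) hmem
    · simp
  have := ((HasDeg.const (g (q (ζ t₀)))).mul h0).mul hdeg
  rw [zero_add, zero_add] at this
  convert this using 2 with t
  rw [mul_inv_cancel_left, ← hfg _ _ (hne t), hq, N₂.apply_coords (hball _ (hmem t)).2]

end TubularNbhd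

end

/-! ### Meridional angle functions: triviality of circle bundles over the 3-sphere -/

section

open Set Filter Topology

section Gluing

variable {Y Z : Type*} [TopologicalSpace Y] [TopologicalSpace Z]

theorem ContinuousOn.union_inter_of_isClosed {f : Y → Z} {Q₁ Q₂ W : Set Y} (h₁ : IsClosed Q₁)
    (h₂ : IsClosed Q₂) (hf₁ : ContinuousOn f (Q₁ ∩ W)) (hf₂ : ContinuousOn f (Q₂ ∩ W)) :
    ContinuousOn f ((Q₁ ∪ Q₂) ∩ W) := by
  intro y hy
  rw [union_inter_distrib_right, continuousWithinAt_union]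
  constructor
  · by_cases h : y ∈ Q₁
    · exact hf₁ y ⟨h, hy.2⟩
    · exact continuousWithinAt_of_notMem_closure fun hc =>
        h (h₁.closure_subset_iff.2 inter_subset_left hc)
  · by_cases h : y ∈ Q₂
    · exact hf₂ y ⟨h, hy.2⟩
    · exact continuousWithinAt_of_notMem_closure fun hc =>
        h (h₂.closure_subset_iff.2 inter_subset_left hc)

open Classical in
/-- Two continuous functions on closed sets which agree on the overlap. -/
theorem ContinuousOn.piecewise_union {f g : Y → Z} {Q₁ Q₂ W : Set Y} (h₁ : IsClosed Q₁)
    (h₂ : IsClosed Q₂) (hf : ContinuousOn f (Q₁ ∩ W)) (hg : ContinuousOn g (Q₂ ∩ W))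
    (hfg : ∀ y ∈ Q₁ ∩ Q₂ ∩ W, f y = g y) :
    ContinuousOn (Q₁.piecewise f g) ((Q₁ ∪ Q₂) ∩ W) := by
  refine .union_inter_of_isClosed h₁ h₂ (hf.congr fun y hy => ?_) (hg.congr fun y hy => ?_)
  · exact piecewise_eq_of_mem _ _ _ hy.1
  · by_cases h : y ∈ Q₁
    · rw [piecewise_eq_of_mem _ _ _ h, hfg y ⟨⟨h, hy.1⟩, hy.2⟩]
    · exact piecewise_eq_of_notMem _ _ _ h

/-- The function `ρ` has a continuous logarithm on `Q`. -/
def HasLog (ρ : Y → Circle) (Q : Set Y) : Prop :=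
  ∃ ℓ : Y → ℝ, ContinuousOn ℓ Q ∧ ∀ y ∈ Q, ρ y = Circle.exp (ℓ y)

/-- On the connected overlap the two logarithms differ by a constant in 2πℤ, which can be added to
one of them. -/
theorem HasLog.union {ρ : Y → Circle} {Q₁ Q₂ : Set Y} (h₁ : IsClosed Q₁) (h₂ : IsClosed Q₂)
    (hQ : IsPreconnected (Q₁ ∩ Q₂)) (hl₁ : HasLog ρ Q₁) (hl₂ : HasLog ρ Q₂) :
    HasLog ρ (Q₁ ∪ Q₂) := by
  classical
  obtain ⟨ℓ₁, hc₁, he₁⟩ := hl₁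
  obtain ⟨ℓ₂, hc₂, he₂⟩ := hl₂
  obtain ⟨n, hn⟩ := Circle.lift_sub_lift_eqOn hQ (hc₁.mono inter_subset_left)
    (hc₂.mono inter_subset_right) fun y hy => by rw [← he₁ y hy.1, ← he₂ y hy.2]
  refine ⟨Q₁.piecewise ℓ₁ fun y => ℓ₂ y + n * (2 * Real.pi), ?_, fun y hy => ?_⟩
  · rw [← inter_univ (Q₁ ∪ Q₂)]
    refine .piecewise_union h₁ h₂ (by rwa [inter_univ])
      (by rw [inter_univ]; exact hc₂.add continuousOn_const) fun y hy => ?_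
    rw [hn y hy.1]
  · by_cases h : y ∈ Q₁
    · rw [piecewise_eq_of_mem _ _ _ h, he₁ y h]
    · rw [piecewise_eq_of_notMem _ _ _ h, he₂ y (hy.resolve_left h)]
      exact Circle.exp_eq_exp.2 ⟨-n, by push_cast; ring⟩

/-- A function with a logarithm on a closed set extends continuously. -/
theorem HasLog.exists_extend [NormalSpace Y] {ρ : Y → Circle} {Q : Set Y} (hQ : IsClosed Q)
    (h : HasLog ρ Q) : ∃ ρ' : C(Y, Circle), EqOn ρ' ρ Q := by
  obtain ⟨ℓ, hc, he⟩ := h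
  obtain ⟨L, hL⟩ := ContinuousMap.exists_restrict_eq hQ ⟨Q.domRestrict ℓ, hc.domRestrict⟩
  refine ⟨⟨fun y => Circle.exp (L y), by fun_prop⟩, fun y hy => ?_⟩
  have : L y = ℓ y := congrArg (fun f : C(Q, ℝ) => f ⟨y, hy⟩) hL
  simp only [ContinuousMap.coe_mk]
  rw [this, he y hy]

end Gluing

namespace TubularNbhd

variable {K : Circle → S3} (N : TubularNbhd K)

include N in
theorem isOpen_compl : IsOpen (range K)ᶜ := by
  have : range K = (fun u : Circle => N.toFun (u, 0)) '' univ := by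
    rw [image_univ]; congr 1; ext1 u; exact (N.core u).symm
  rw [this]
  exact (isCompact_univ.image (N.smooth.continuous.comp (by fun_prop))).isClosed.isOpen_compl

theorem cover : (range K)ᶜ ∪ range N.toFun = univ := by
  rw [eq_univ_iff_forall]
  intro y
  by_cases h : y ∈ range K
  · obtain ⟨u, rfl⟩ := h
    exact Or.inr ⟨(u, 0), N.core u⟩
  · exact Or.inl h

theorem coords_snd_ne_zero {y : S3} (hy : y ∉ range K) (hy' : y ∈ range N.toFun) :
    (N.coords y).2 ≠ 0 := by
  obtain ⟨⟨u, z⟩, rfl⟩ := hy'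
  rw [coords_apply]
  rintro rfl
  exact hy ⟨u, (N.core u).symm⟩

variable {Y : Type*} [TopologicalSpace Y]

/-- The pullback under `F` of the circle bundle of the knot is trivial over `Q`: there is a function
off the knot and a function near the knot whose quotient is the meridional angle. -/
def HasSection (F : Y → S3) (Q : Set Y) : Prop :=
  ∃ a b : Y → Circle, ContinuousOn a (Q ∩ F ⁻¹' (range K)ᶜ) ∧
    ContinuousOn b (Q ∩ F ⁻¹' range N.toFun) ∧
    ∀ y ∈ Q, F y ∉ range K → F y ∈ range N.toFun → a y = b y * Complex.dir (N.coords (F y)).2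

variable {N} {F : Y → S3} (hF : Continuous F) {Q Q₁ Q₂ : Set Y}

include hF in
theorem continuousOn_angle : ContinuousOn (fun y => Complex.dir (N.coords (F y)).2)
    (F ⁻¹' (range K)ᶜ ∩ F ⁻¹' range N.toFun) := by
  refine Complex.continuousOn_dir.comp ?_ fun y hy => N.coords_snd_ne_zero hy.1 hy.2
  exact continuous_snd.comp_continuousOn (N.continuousOn_coords.comp hF.continuousOn fun y hy => hy.2)

include hF in
theorem HasSection.of_subset_compl (h : Q ⊆ F ⁻¹' (range K)ᶜ) : N.HasSection F Q := by
  refine ⟨fun _ => 1, fun y => (Complex.dir (N.coords (F y)).2)⁻¹, continuousOn_const, ?_,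
    fun y _ _ _ => by simp⟩
  exact (continuousOn_angle hF).inv.mono fun y hy => ⟨h hy.1, hy.2⟩

include hF in
theorem HasSection.of_subset_range (h : Q ⊆ F ⁻¹' range N.toFun) : N.HasSection F Q := by
  refine ⟨fun y => Complex.dir (N.coords (F y)).2, fun _ => 1, ?_, continuousOn_const,
    fun y _ _ _ => by simp⟩
  exact (continuousOn_angle hF).mono fun y hy => ⟨hy.2, h hy.1⟩

include hF in
/-- Two trivializations over closed sets can be glued if their ratio on the overlap extends. -/
theorem HasSection.union (h₁ : IsClosed Q₁) (h₂ : IsClosed Q₂) (hs₁ : N.HasSection F Q₁)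
    (hs₂ : N.HasSection F Q₂)
    (hext : ∀ ρ : Y → Circle, ContinuousOn ρ (Q₁ ∩ Q₂) →
      ∃ ρ' : Y → Circle, ContinuousOn ρ' Q₂ ∧ EqOn ρ' ρ (Q₁ ∩ Q₂)) :
    N.HasSection F (Q₁ ∪ Q₂) := by
  classical
  obtain ⟨a₁, b₁, ha₁, hb₁, hab₁⟩ := hs₁
  obtain ⟨a₂, b₂, ha₂, hb₂, hab₂⟩ := hs₂
  -- The ratio of the two trivializations is defined on the whole overlap: where both quotients make
  -- sense the meridional angle cancels.
  let ρ (y : Y) : Circle := if F y ∈ range K then b₁ y / b₂ y else a₁ y / a₂ y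
  have hρU (y : Y) (hy : F y ∉ range K) : ρ y = a₁ y / a₂ y := if_neg hy
  have hρV (y : Y) (hy : y ∈ Q₁ ∩ Q₂) (hyV : F y ∈ range N.toFun) : ρ y = b₁ y / b₂ y := by
    by_cases h : F y ∈ range K
    · exact if_pos h
    · rw [hρU y h, hab₁ y hy.1 h hyV, hab₂ y hy.2 h hyV, mul_div_mul_right_eq_div]
  have hρ : ContinuousOn ρ (Q₁ ∩ Q₂) := by
    have hU : ContinuousOn ρ (Q₁ ∩ Q₂ ∩ F ⁻¹' (range K)ᶜ) :=
      ((ha₁.mono fun y hy => ⟨hy.1.1, hy.2⟩).div' (ha₂.mono fun y hy => ⟨hy.1.2, hy.2⟩)).congr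
        fun y hy => hρU y hy.2
    have hV : ContinuousOn ρ (Q₁ ∩ Q₂ ∩ F ⁻¹' range N.toFun) :=
      ((hb₁.mono fun y hy => ⟨hy.1.1, hy.2⟩).div' (hb₂.mono fun y hy => ⟨hy.1.2, hy.2⟩)).congr
        fun y hy => hρV y hy.1 hy.2
    intro y hy
    rcases N.cover.ge (mem_univ (F y)) with h | h
    · exact (continuousWithinAt_inter ((N.isOpen_compl.preimage hF).mem_nhds h)).1 (hU y ⟨hy, h⟩)
    · exact (continuousWithinAt_inter ((N.isOpen_range.preimage hF).mem_nhds h)).1 (hV y ⟨hy, h⟩)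
  obtain ⟨ρ', hρ', he⟩ := hext ρ hρ
  refine ⟨Q₁.piecewise a₁ fun y => a₂ y * ρ' y, Q₁.piecewise b₁ fun y => b₂ y * ρ' y,
    .piecewise_union h₁ h₂ ha₁ (ha₂.mul (hρ'.mono inter_subset_left)) fun y hy => ?_,
    .piecewise_union h₁ h₂ hb₁ (hb₂.mul (hρ'.mono inter_subset_left)) fun y hy => ?_,
    fun y hy hU hV => ?_⟩
  · rw [he hy.1, hρU y hy.2, mul_div_cancel]
  · rw [he hy.1, hρV y hy.1 hy.2, mul_div_cancel]
  · by_cases h : y ∈ Q₁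
    · rw [piecewise_eq_of_mem _ _ _ h, piecewise_eq_of_mem _ _ _ h, hab₁ y h hU hV]
    · rw [piecewise_eq_of_notMem _ _ _ h, piecewise_eq_of_notMem _ _ _ h,
        hab₂ y (hy.resolve_left h) hU hV, mul_right_comm]

include hF in
-- If `Q₂` retracts to the overlap, any ratio extends over `Q₂` by composition with the retraction.
theorem HasSection.union_of_retract (h₁ : IsClosed Q₁) (h₂ : IsClosed Q₂)
    (hs₁ : N.HasSection F Q₁) (hs₂ : N.HasSection F Q₂) (π : Y → Y) (hπ : Continuous π)
    (hm : MapsTo π Q₂ (Q₁ ∩ Q₂)) (hid : ∀ y ∈ Q₁ ∩ Q₂, π y = y) :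
    N.HasSection F (Q₁ ∪ Q₂) :=
  hs₁.union hF h₁ h₂ hs₂ fun ρ hρ => ⟨ρ ∘ π, hρ.comp hπ.continuousOn hm,
    fun y hy => congrArg ρ (hid y hy)⟩

/-- Boxes smaller than a Lebesgue number map into the complement or into the neighbourhood, where a
section is immediate. They are then glued along faces, onto which a box retracts. -/
theorem HasSection.box {F : ℝ × ℝ × ℝ → S3} (hF : Continuous F) :
    N.HasSection F (Icc (-1) 1 ×ˢ Icc (-1) 1 ×ˢ Icc (-1) 1) := by
  obtain ⟨δ, hδ, hL⟩ := lebesgue_number_lemma_of_metric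
    (s := (Icc (-1) 1 ×ˢ Icc (-1) 1 ×ˢ Icc (-1) 1 : Set (ℝ × ℝ × ℝ)))
    (c := fun b : Bool => F ⁻¹' (if b then (range K)ᶜ else range N.toFun))
    (isCompact_Icc.prod (isCompact_Icc.prod isCompact_Icc))
    (fun b => by
      cases b
      · exact N.isOpen_range.preimage hF
      · exact N.isOpen_compl.preimage hF)
    (fun x _ => by
      rcases N.cover.ge (mem_univ (F x)) with h | h
      · exact mem_iUnion.2 ⟨true, by simpa using h⟩
      · exact mem_iUnion.2 ⟨false, by simpa using h⟩)
  have hcl (a b c d e f : ℝ) : IsClosed (Icc a b ×ˢ Icc c d ×ˢ Icc e f) :=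
    isClosed_Icc.prod (isClosed_Icc.prod isClosed_Icc)
  have h11 : (-1 : ℝ) ≤ 1 := by norm_num
  refine subdivide_Icc (P := fun a b => N.HasSection F (Icc a b ×ˢ Icc (-1) 1 ×ˢ Icc (-1) 1))
    (half_pos hδ) h11 (fun a b ha hab hb hl => ?_) fun a b c _ hab hbc _ h1 h2 => ?_
  · refine subdivide_Icc (P := fun a' b' => N.HasSection F (Icc a b ×ˢ Icc a' b' ×ˢ Icc (-1) 1))
      (half_pos hδ) h11 (fun a' b' ha' hab' hb' hl' => ?_) fun a' b' c' _ hab' hbc' _ h1 h2 => ?_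
    · refine subdivide_Icc (P := fun s t => N.HasSection F (Icc a b ×ˢ Icc a' b' ×ˢ Icc s t))
        (half_pos hδ) h11 (fun s t hs hst ht hl'' => ?_) fun s t u _ hst htu _ h1 h2 => ?_
      · have hball : Icc a b ×ˢ Icc a' b' ×ˢ Icc s t ⊆ Metric.ball (a, a', s) δ := by
          rintro ⟨x, y, z⟩ ⟨⟨h1, h2⟩, ⟨h3, h4⟩, h5, h6⟩
          simp only [Metric.mem_ball, Prod.dist_eq, Real.dist_eq, max_lt_iff, abs_lt]
          simp only at h1 h2 h3 h4 h5 h6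
          refine ⟨⟨?_, ?_⟩, ⟨?_, ?_⟩, ?_, ?_⟩ <;> linarith
        obtain ⟨i, hi⟩ := hL (a, a', s) ⟨⟨ha, hab.trans hb⟩, ⟨ha', hab'.trans hb'⟩, hs, hst.trans ht⟩
        cases i
        · exact .of_subset_range hF fun x hx => by simpa using hi (hball hx)
        · exact .of_subset_compl hF fun x hx => by simpa using hi (hball hx)
      · rw [← Icc_union_Icc_eq_Icc hst htu, prod_union, prod_union]
        refine h1.union_of_retract hF (hcl _ _ _ _ _ _) (hcl _ _ _ _ _ _) h2
          (fun x => (x.1, x.2.1, t)) (by fun_prop) ?_ ?_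
        · rintro ⟨x, y, z⟩ ⟨h1, h2, h3⟩
          exact ⟨⟨h1, h2, hst, le_rfl⟩, h1, h2, le_rfl, htu⟩
        · rintro ⟨x, y, z⟩ ⟨⟨h1, h2, h3⟩, h1', h2', h3'⟩
          exact Prod.ext rfl (Prod.ext rfl (le_antisymm h3'.1 h3.2))
    · rw [← Icc_union_Icc_eq_Icc hab' hbc', union_prod, prod_union]
      refine h1.union_of_retract hF (hcl _ _ _ _ _ _) (hcl _ _ _ _ _ _) h2
        (fun x => (x.1, b', x.2.2)) (by fun_prop) ?_ ?_
      · rintro ⟨x, y, z⟩ ⟨h1, h2, h3⟩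
        exact ⟨⟨h1, ⟨hab', le_rfl⟩, h3⟩, h1, ⟨le_rfl, hbc'⟩, h3⟩
      · rintro ⟨x, y, z⟩ ⟨⟨h1, h2, h3⟩, h1', h2', h3'⟩
        exact Prod.ext rfl (Prod.ext (le_antisymm h2'.1 h2.2) rfl)
  · rw [← Icc_union_Icc_eq_Icc hab hbc, union_prod]
    refine h1.union_of_retract hF (hcl _ _ _ _ _ _) (hcl _ _ _ _ _ _) h2
      (fun x => (b, x.2)) (by fun_prop) ?_ ?_
    · rintro ⟨x, y, z⟩ ⟨h1, h2, h3⟩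
      exact ⟨⟨⟨hab, le_rfl⟩, h2, h3⟩, ⟨le_rfl, hbc⟩, h2, h3⟩
    · rintro ⟨x, y, z⟩ ⟨⟨h1, h2, h3⟩, h1', h2', h3'⟩
      exact Prod.ext (le_antisymm h1'.1 h1.2) rfl

end TubularNbhd

namespace S3

/-- The point of the sphere with the given coordinates. -/
def ofCoords (x : Fin 4 → ℝ) (h : x 0 ^ 2 + x 1 ^ 2 + x 2 ^ 2 + x 3 ^ 2 = 1) : S3 :=
  ⟨WithLp.toLp 2 x, by
    rw [mem_sphere_zero_iff_norm, EuclideanSpace.norm_eq, Real.sqrt_eq_one, Fin.sum_univ_four]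
    simpa using h⟩

theorem sum_sq (x : S3) : x.1 0 ^ 2 + x.1 1 ^ 2 + x.1 2 ^ 2 + x.1 3 ^ 2 = 1 := by
  have h := mem_sphere_zero_iff_norm.1 x.2
  rw [EuclideanSpace.norm_eq, Real.sqrt_eq_one, Fin.sum_univ_four] at h
  simpa using h

@[ext] theorem ext' {x y : S3} (h : ∀ i, x.1 i = y.1 i) : x = y := by
  apply Subtype.ext; ext i; exact h i

@[simp] theorem ofCoords_apply (x : Fin 4 → ℝ) (h) (i : Fin 4) : (ofCoords x h).1 i = x i := rfl

theorem continuous_ofCoords {Y : Type*} [TopologicalSpace Y] {x : Y → Fin 4 → ℝ}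
    (hx : ∀ i, Continuous fun y => x y i)
    (h : ∀ y, x y 0 ^ 2 + x y 1 ^ 2 + x y 2 ^ 2 + x y 3 ^ 2 = 1) : Continuous fun y => ofCoords (x y) (h y) :=
  Continuous.subtype_mk ((PiLp.continuous_toLp 2 _).comp (continuous_pi hx)) _

theorem continuous_coord (i : Fin 4) : Continuous fun x : S3 => x.1 i :=
  (EuclideanSpace.proj i : EuclideanSpace ℝ (Fin 4) →L[ℝ] ℝ).continuous.comp continuous_subtype_val

/-- Inverse stereographic projection; the unit ball covers the hemisphere `0 ≤ s * x₃`. -/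
def stereo (s : ℝ) (hs : s ^ 2 = 1) (v : ℝ × ℝ × ℝ) : S3 :=
  ofCoords ((1 + v.1 ^ 2 + v.2.1 ^ 2 + v.2.2 ^ 2)⁻¹ •
    ![2 * v.1, 2 * v.2.1, 2 * v.2.2, s * (1 - v.1 ^ 2 - v.2.1 ^ 2 - v.2.2 ^ 2)]) (by
    have : 1 + v.1 ^ 2 + v.2.1 ^ 2 + v.2.2 ^ 2 ≠ 0 := by positivity
    simp
    field_simp
    rw [hs]
    ring)

theorem continuous_stereo (s : ℝ) (hs : s ^ 2 = 1) : Continuous (stereo s hs) := by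
  refine continuous_ofCoords (fun i => ?_) _
  have : Continuous fun v : ℝ × ℝ × ℝ => (1 + v.1 ^ 2 + v.2.1 ^ 2 + v.2.2 ^ 2)⁻¹ :=
    Continuous.inv₀ (by fun_prop) fun v => by positivity
  refine Continuous.smul this ?_
  fin_cases i <;> simp <;> fun_prop

/-- Stereographic projection. -/
def stereoInv (s : ℝ) (x : S3) : ℝ × ℝ × ℝ :=
  (x.1 0 / (1 + s * x.1 3), x.1 1 / (1 + s * x.1 3), x.1 2 / (1 + s * x.1 3))

theorem continuousOn_stereoInv (s : ℝ) : ContinuousOn (stereoInv s) {x : S3 | 0 ≤ s * x.1 3} := by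
  have h (i : Fin 4) : ContinuousOn (fun x : S3 => x.1 i / (1 + s * x.1 3))
      {x : S3 | 0 ≤ s * x.1 3} :=
    (continuous_coord i).continuousOn.div (by
      exact (continuous_const.add (continuous_const.mul (continuous_coord 3))).continuousOn)
      fun x (hx : 0 ≤ s * x.1 3) => by positivity
  exact (h 0).prodMk ((h 1).prodMk (h 2))

theorem stereo_stereoInv {s : ℝ} (hs : s ^ 2 = 1) {x : S3} (hx : 0 ≤ s * x.1 3) :
    stereo s hs (stereoInv s x) = x := by
  have h := sum_sq x
  have hD : 1 + s * x.1 3 ≠ 0 := by positivity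
  have h1 : 1 + (x.1 0 / (1 + s * x.1 3)) ^ 2 + (x.1 1 / (1 + s * x.1 3)) ^ 2 +
      (x.1 2 / (1 + s * x.1 3)) ^ 2 = 2 / (1 + s * x.1 3) := by
    field_simp
    linear_combination h + (x.1 3 ^ 2) * hs
  have h2 : 1 - (x.1 0 / (1 + s * x.1 3)) ^ 2 - (x.1 1 / (1 + s * x.1 3)) ^ 2 -
      (x.1 2 / (1 + s * x.1 3)) ^ 2 = 2 * s * x.1 3 / (1 + s * x.1 3) := by
    field_simp
    linear_combination -h - (x.1 3 ^ 2) * hs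
  ext i
  simp only [stereo, stereoInv, ofCoords_apply, h1, h2, Pi.smul_apply, smul_eq_mul]
  fin_cases i
  · simp; field_simp
  · simp; field_simp
  · simp; field_simp
  · simp; field_simp; linear_combination (x.1 3) * hs

theorem stereoInv_mem {s : ℝ} {x : S3} (hx : 0 ≤ s * x.1 3) :
    stereoInv s x ∈ Icc (-1 : ℝ) 1 ×ˢ Icc (-1 : ℝ) 1 ×ˢ Icc (-1 : ℝ) 1 := by
  have h := sum_sq x
  have hi (a : ℝ) (ha : a ^ 2 ≤ 1) : a / (1 + s * x.1 3) ∈ Icc (-1 : ℝ) 1 := by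
    rw [mem_Icc, ← abs_le, abs_div, abs_of_pos (by positivity : 0 < 1 + s * x.1 3),
      div_le_one (by positivity)]
    linarith [(sq_le_one_iff_abs_le_one a).1 ha]
  refine ⟨hi _ ?_, hi _ ?_, hi _ ?_⟩ <;> nlinarith [sq_nonneg (x.1 0), sq_nonneg (x.1 1),
    sq_nonneg (x.1 2), sq_nonneg (x.1 3)]

/-- Exchange of the last two coordinates. -/
def swap (x : S3) : S3 :=
  ofCoords ![x.1 0, x.1 1, x.1 3, x.1 2] (by
    have := sum_sq x
    simp
    linarith)

theorem continuous_swap : Continuous swap := by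
  refine continuous_ofCoords (fun i => ?_) _
  fin_cases i
  exacts [continuous_coord 0, continuous_coord 1, continuous_coord 3, continuous_coord 2]

theorem swap_swap (x : S3) : swap (swap x) = x := by
  ext i
  fin_cases i <;> rfl

/-- A function from the equator to the circle has a logarithm on each half. -/
theorem hasLog_half_equator {ρ : S3 → Circle} (hρ : ContinuousOn ρ {x : S3 | x.1 3 = 0}) {s : ℝ}
    (hs : s ^ 2 = 1) : HasLog ρ {x : S3 | x.1 3 = 0 ∧ 0 ≤ s * x.1 2} := by
  have he : Continuous fun v : ℝ × ℝ => swap (stereo s hs (v.1, v.2, 0)) :=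
    continuous_swap.comp ((continuous_stereo s hs).comp (by fun_prop))
  obtain ⟨ψ, hψ⟩ := Circle.exists_lift (E := ℝ × ℝ)
    ⟨fun v => ρ (swap (stereo s hs (v.1, v.2, 0))), hρ.comp_continuous he fun v => by
      change (1 + v.1 ^ 2 + v.2 ^ 2 + 0 ^ 2)⁻¹ * (2 * 0) = 0
      ring⟩
  refine ⟨fun x => ψ ((stereoInv s (swap x)).1, (stereoInv s (swap x)).2.1), ?_, fun x hx => ?_⟩
  · have h1 : ContinuousOn (fun x => stereoInv s (swap x)) {x : S3 | x.1 3 = 0 ∧ 0 ≤ s * x.1 2} :=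
      (continuousOn_stereoInv s).comp continuous_swap.continuousOn fun x hx => hx.2
    exact ψ.continuous.comp_continuousOn
      ((continuous_fst.comp_continuousOn h1).prodMk
        ((continuous_fst.comp continuous_snd).comp_continuousOn h1))
  · have h1 := hψ ((stereoInv s (swap x)).1, (stereoInv s (swap x)).2.1)
    have h2 : ((stereoInv s (swap x)).1, (stereoInv s (swap x)).2.1, (0 : ℝ)) =
        stereoInv s (swap x) := by
      refine Prod.ext rfl (Prod.ext rfl ?_)
      change 0 = x.1 3 / (1 + s * x.1 2)
      rw [hx.1, zero_div]
    simp only [ContinuousMap.coe_mk] at h1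
    rw [h2, stereo_stereoInv hs (x := swap x) hx.2, swap_swap] at h1
    exact h1

/-- The equator is a 2-sphere made of two disks that meet in a connected circle. Lifts over the
disks therefore agree after a constant shift. -/
theorem hasLog_equator {ρ : S3 → Circle} (hρ : ContinuousOn ρ {x : S3 | x.1 3 = 0}) :
    HasLog ρ {x : S3 | x.1 3 = 0} := by
  have hcl (s : ℝ) : IsClosed {x : S3 | x.1 3 = 0 ∧ 0 ≤ s * x.1 2} :=
    (isClosed_eq (continuous_coord 3) continuous_const).inter
      (isClosed_le continuous_const (continuous_const.mul (continuous_coord 2)))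
  have hU : {x : S3 | x.1 3 = 0} =
      {x : S3 | x.1 3 = 0 ∧ 0 ≤ 1 * x.1 2} ∪ {x : S3 | x.1 3 = 0 ∧ 0 ≤ -1 * x.1 2} := by
    ext x
    rcases le_total 0 (x.1 2) with h | h <;> simp +contextual [h]
  have hI : {x : S3 | x.1 3 = 0 ∧ 0 ≤ 1 * x.1 2} ∩ {x : S3 | x.1 3 = 0 ∧ 0 ≤ -1 * x.1 2} =
      range fun t : ℝ => ofCoords ![Real.cos t, Real.sin t, 0, 0] (by simp) := by
    ext x
    constructor
    · rintro ⟨⟨h3, h2⟩, -, h2'⟩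
      have h2'' : x.1 2 = 0 := by linarith
      have hs := sum_sq x
      rw [h2'', h3] at hs
      have hn : ‖(⟨x.1 0, x.1 1⟩ : ℂ)‖ = 1 := by
        rw [← pow_eq_one_iff_of_nonneg (norm_nonneg _) two_ne_zero, ← Complex.normSq_eq_norm_sq, Complex.normSq_mk]
        linarith
      refine ⟨Complex.arg ⟨x.1 0, x.1 1⟩, ?_⟩
      ext i
      have hz : (⟨x.1 0, x.1 1⟩ : ℂ) ≠ 0 := by rw [← norm_ne_zero_iff, hn]; simp
      fin_cases i
      · simp [Complex.cos_arg hz, hn]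
      · simp [Complex.sin_arg, hn]
      · simp [h2'']
      · simp [h3]
    · rintro ⟨t, rfl⟩
      simp
  rw [hU]
  refine HasLog.union (hcl _) (hcl _) ?_ (hasLog_half_equator hρ (by norm_num))
    (hasLog_half_equator hρ (by norm_num))
  rw [hI]
  refine isPreconnected_range (continuous_ofCoords (fun i => ?_) _)
  fin_cases i <;> simp <;> fun_prop

end S3

namespace TubularNbhd

variable {K : Circle → S3} (N : TubularNbhd K)

theorem hasSection_hemisphere {s : ℝ} (hs : s ^ 2 = 1) :
    N.HasSection id {x : S3 | 0 ≤ s * x.1 3} := by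
  obtain ⟨a, b, ha, hb, hab⟩ := HasSection.box (N := N) (S3.continuous_stereo s hs)
  have hc := S3.continuousOn_stereoInv s
  refine ⟨a ∘ S3.stereoInv s, b ∘ S3.stereoInv s,
    ha.comp (hc.mono inter_subset_left) fun x hx => ⟨S3.stereoInv_mem hx.1, ?_⟩,
    hb.comp (hc.mono inter_subset_left) fun x hx => ⟨S3.stereoInv_mem hx.1, ?_⟩,
    fun x hx => ?_⟩
  · rw [mem_preimage, S3.stereo_stereoInv hs hx.1]
    exact hx.2
  · rw [mem_preimage, S3.stereo_stereoInv hs hx.1]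
    exact hx.2
  · have := hab _ (S3.stereoInv_mem hx)
    rwa [S3.stereo_stereoInv hs hx] at this

/-- A knot in the sphere has a meridional angle function: there is a map from its complement to the
circle which differs from the meridional angle by a factor defined on the whole neighbourhood. -/
theorem exists_angle : ∃ (f : S3 → Circle) (g : Circle × ℂ → Circle),
    ContinuousOn f (range K)ᶜ ∧ Continuous g ∧
      ∀ u z, z ≠ 0 → f (N.toFun (u, z)) = g (u, z) * Complex.dir z := by
  have hcl (s : ℝ) : IsClosed {x : S3 | 0 ≤ s * x.1 3} :=
    isClosed_le continuous_const (continuous_const.mul (S3.continuous_coord 3))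
  have hU : {x : S3 | 0 ≤ 1 * x.1 3} ∪ {x : S3 | 0 ≤ -1 * x.1 3} = univ := by
    ext x
    rcases le_total 0 (x.1 3) with h | h <;> simp [h]
  have hI : {x : S3 | 0 ≤ 1 * x.1 3} ∩ {x : S3 | 0 ≤ -1 * x.1 3} = {x : S3 | x.1 3 = 0} := by
    ext x
    simp only [mem_inter_iff, mem_ofPred_eq]
    constructor
    · rintro ⟨h1, h2⟩; linarith
    · intro h; simp [h]
  -- The sections over the two hemispheres differ on the equatorial 2-sphere by a circle-valued map,
  -- which has a logarithm and so extends. This is the vanishing of H²(S³; ℤ) in the form needed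
  -- here.
  obtain ⟨a, b, ha, hb, hab⟩ := (N.hasSection_hemisphere (s := 1) (by norm_num)).union continuous_id
    (hcl _) (hcl _) (N.hasSection_hemisphere (s := -1) (by norm_num)) fun ρ hρ => by
      rw [hI] at hρ ⊢
      obtain ⟨ρ', h⟩ := (S3.hasLog_equator hρ).exists_extend
        (isClosed_eq (S3.continuous_coord 3) continuous_const)
      exact ⟨ρ', ρ'.continuous.continuousOn, h⟩
  rw [hU, univ_inter] at ha hb
  refine ⟨a, b ∘ N.toFun, ha, hb.comp_continuous N.smooth.continuous fun x => mem_range_self x,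
    fun u z hz => ?_⟩
  have := hab (N.toFun (u, z)) (hU.ge trivial) (N.not_mem_range hz) (mem_range_self _)
  rwa [id, coords_apply] at this

end TubularNbhd

end

/-! ### Pushing the knot complement into the exterior -/

section

open Set Filter Topology

namespace TubularNbhd

variable {K : Circle → S3} (N : TubularNbhd K)

theorem max_mul_dir_ne_zero {z : ℂ} (hz : z ≠ 0) (R : ℝ) :
    ((max ‖z‖ R : ℝ) : ℂ) * Complex.dir z ≠ 0 := by
  rw [← norm_ne_zero_iff, norm_mul, Circle.norm_coe, mul_one, Complex.norm_real, Real.norm_eq_abs,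
    abs_ne_zero]
  exact ((norm_pos_iff.2 hz).trans_le (le_max_left _ _)).ne'

theorem norm_max_mul_dir (z : ℂ) (R : ℝ) :
    ‖((max ‖z‖ R : ℝ) : ℂ) * (Complex.dir z : ℂ)‖ = max ‖z‖ R := by
  rw [norm_mul, Circle.norm_coe, mul_one, Complex.norm_real, Real.norm_of_nonneg]
  exact (norm_nonneg z).trans (le_max_left _ _)

open Classical in
/-- Push the tubular neighbourhood outwards, to distance at least `R` from the knot. -/
def pushFun (x : S3 × ℝ) : S3 :=
  if x.1 ∈ range N.toFun then N.toFun ((N.coords x.1).1,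
    ((max ‖(N.coords x.1).2‖ x.2 : ℝ) : ℂ) * (Complex.dir (N.coords x.1).2 : ℂ)) else x.1

theorem pushFun_apply (u : Circle) (z : ℂ) (R : ℝ) : N.pushFun (N.toFun (u, z), R) =
    N.toFun (u, ((max ‖z‖ R : ℝ) : ℂ) * (Complex.dir z : ℂ)) := by
  rw [pushFun, if_pos (mem_range_self _), coords_apply]

theorem pushFun_of_notMem {x : S3} {R : ℝ} (h : x ∉ N.toFun '' {y | ‖y.2‖ < R}) :
    N.pushFun (x, R) = x := by
  by_cases hx : x ∈ range N.toFun
  · obtain ⟨⟨u, z⟩, rfl⟩ := hx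
    have : R ≤ ‖z‖ := not_lt.1 fun hz => h ⟨(u, z), hz, rfl⟩
    rw [pushFun_apply, max_eq_left this, Complex.norm_mul_dir]
  · exact if_neg hx

theorem pushFun_notMem {x : S3} {R : ℝ} : N.pushFun (x, R) ∉ N.toFun '' {y | ‖y.2‖ < R} := by
  by_cases hx : x ∈ range N.toFun
  · obtain ⟨⟨u, z⟩, rfl⟩ := hx
    rw [pushFun_apply]
    rintro ⟨y, hy, h⟩
    rw [N.injective h] at hy
    change ‖((max ‖z‖ R : ℝ) : ℂ) * (Complex.dir z : ℂ)‖ < R at hy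
    rw [norm_max_mul_dir] at hy
    exact absurd hy (not_lt.2 (le_max_right _ _))
  · rw [pushFun, if_neg hx]
    exact fun h => hx (image_subset_range _ _ h)

theorem pushFun_notMem_range {x : S3} (hx : x ∉ range K) (R : ℝ) : N.pushFun (x, R) ∉ range K := by
  by_cases h : x ∈ range N.toFun
  · obtain ⟨⟨u, z⟩, rfl⟩ := h
    rw [pushFun_apply]
    refine N.not_mem_range (max_mul_dir_ne_zero ?_ R)
    rintro rfl
    exact hx ⟨u, (N.core u).symm⟩
  · rwa [pushFun, if_neg h]

theorem continuousOn_pushFun : ContinuousOn N.pushFun ((range K)ᶜ ×ˢ univ) := by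
  rintro ⟨x, R⟩ ⟨hx, -⟩
  by_cases h : x ∈ range N.toFun
  · have hc : ContinuousAt N.coords x := N.continuousOn_coords.continuousAt (N.isOpen_range.mem_nhds h)
    have hfst : ContinuousAt (fun y : S3 × ℝ => N.coords y.1) (x, R) :=
      ContinuousAt.comp (f := Prod.fst) hc continuousAt_fst
    have hz : ContinuousAt (fun y : S3 × ℝ => (N.coords y.1).2) (x, R) := continuousAt_snd.comp hfst
    have hd : ContinuousAt (fun y : S3 × ℝ => Complex.dir (N.coords y.1).2) (x, R) :=
      ContinuousAt.comp (f := fun y : S3 × ℝ => (N.coords y.1).2)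
        (Complex.continuousAt_dir (N.coords_snd_ne_zero hx h)) hz
    have hd' : ContinuousAt (fun y : S3 × ℝ => (Complex.dir (N.coords y.1).2 : ℂ)) (x, R) :=
      continuous_induced_dom.continuousAt.comp hd
    have hm : ContinuousAt (fun y : S3 × ℝ => ((max ‖(N.coords y.1).2‖ y.2 : ℝ) : ℂ)) (x, R) :=
      Complex.continuous_ofReal.continuousAt.comp (hz.norm.max continuousAt_snd)
    have : ContinuousAt (fun y : S3 × ℝ => N.toFun ((N.coords y.1).1,
        ((max ‖(N.coords y.1).2‖ y.2 : ℝ) : ℂ) * (Complex.dir (N.coords y.1).2 : ℂ))) (x, R) :=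
      N.smooth.continuous.continuousAt.comp ((continuousAt_fst.comp hfst).prodMk (hm.mul hd'))
    refine (this.congr ?_).continuousWithinAt
    filter_upwards [(N.isOpen_range.preimage continuous_fst).mem_nhds h] with y hy
    exact (if_pos hy).symm
  -- Off the neighbourhood, the closed tube of radius R + 1 is compact and misses the point, so
  -- pushing by any radius near R is the identity nearby.
  · have hcl : IsClosed (N.toFun '' (univ ×ˢ Metric.closedBall 0 (R + 1))) :=
      ((isCompact_univ.prod (isCompact_closedBall _ _)).image N.smooth.continuous).isClosed
    refine (continuousAt_fst.congr ?_).continuousWithinAt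
    filter_upwards [(hcl.isOpen_compl.preimage continuous_fst).mem_nhds (show (x, R) ∈ _ from
      fun hm => h (image_subset_range _ _ hm)),
      continuousAt_snd.eventually (gt_mem_nhds (lt_add_one R))] with y hy hy'
    refine (N.pushFun_of_notMem ?_).symm
    rintro ⟨⟨u, z⟩, hz, hy''⟩
    exact hy ⟨(u, z), ⟨trivial, mem_closedBall_zero_iff.2 (hz.le.trans hy'.le)⟩, hy''⟩

/-- See `pushFun`. -/
def push : C(KnotComplement K × ℝ, KnotComplement K) where
  toFun x := ⟨N.pushFun (x.1, x.2), N.pushFun_notMem_range x.1.2 x.2⟩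
  continuous_toFun := Continuous.subtype_mk
    (N.continuousOn_pushFun.comp_continuous (by fun_prop) fun x => ⟨x.1.2, trivial⟩) _

theorem push_of_notMem {x : KnotComplement K} {R : ℝ} (h : (x : S3) ∉ N.toFun '' {y | ‖y.2‖ < R}) :
    N.push (x, R) = x := Subtype.ext (N.pushFun_of_notMem h)

theorem push_zero (x : KnotComplement K) : N.push (x, 0) = x := by
  refine N.push_of_notMem ?_
  rintro ⟨y, hy, -⟩
  exact absurd hy (not_lt.2 (norm_nonneg _))

/-- The retraction of the knot complement to the exterior. -/
def toExterior : C(KnotComplement K, N.Exterior) where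
  toFun x := ⟨N.pushFun (x, 1), N.pushFun_notMem⟩
  continuous_toFun := Continuous.subtype_mk
    (N.continuousOn_pushFun.comp_continuous (by fun_prop) fun x => ⟨x.2, trivial⟩) _

theorem exterior_notMem_range (x : N.Exterior) : (x : S3) ∉ range K := by
  rintro ⟨u, hu⟩
  exact x.2 ⟨(u, 0), by simp, by rw [N.core, hu]⟩

/-- The inclusion of the exterior in the knot complement. -/
def ofExterior : C(N.Exterior, KnotComplement K) where
  toFun x := ⟨x, N.exterior_notMem_range x⟩
  continuous_toFun := Continuous.subtype_mk continuous_subtype_val _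

theorem toExterior_ofExterior (x : N.Exterior) : N.toExterior (N.ofExterior x) = x :=
  Subtype.ext (N.pushFun_of_notMem x.2)

include N in
-- A continuous two-valued function on the complement is constant on the connected punctured
-- neighbourhood, so it extends over the knot to the connected sphere. An open connected set in a
-- manifold is path connected.
theorem isPathConnected_compl : IsPathConnected (range K)ᶜ := by
  have hrank : Module.rank ℝ (EuclideanSpace ℝ (Fin 4)) = 4 := by
    rw [← Module.finrank_eq_rank]; simp
  have hS : IsPreconnected (univ : Set S3) := by
    have := isPreconnected_sphere (E := EuclideanSpace ℝ (Fin 4)) (by rw [hrank]; norm_num) 0 1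
    exact (isPreconnected_iff_preconnectedSpace.1 this).isPreconnected_univ
  have hFact : Fact (Module.finrank ℝ (EuclideanSpace ℝ (Fin 4)) = 3 + 1) := ⟨by simp⟩
  have := ChartedSpace.locallyPathConnectedSpace (EuclideanSpace ℝ (Fin 3)) S3
  rw [← N.isOpen_compl.isConnected_iff_isPathConnected]
  refine ⟨⟨N.toFun (1, 1), N.not_mem_range one_ne_zero⟩, ?_⟩
  have hC : IsPreconnected (univ ×ˢ {0}ᶜ : Set (Circle × ℂ)) :=
    isPreconnected_univ.prod (isConnected_compl_singleton_of_one_lt_rank (by simp) _).isPreconnected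
  refine isPreconnected_of_forall_constant fun f hf x hx y hy => ?_
  have hfc : ∀ u z, z ≠ 0 → f (N.toFun (u, z)) = f (N.toFun (1, 1)) := fun u z hz =>
    hC.constant (f := f ∘ N.toFun) (x := (u, z)) (y := (1, 1))
      (hf.comp N.smooth.continuous.continuousOn fun p hp => N.not_mem_range hp.2)
      ⟨trivial, hz⟩ ⟨trivial, one_ne_zero⟩
  classical
  let F (p : S3) : Bool := if p ∈ range K then f (N.toFun (1, 1)) else f p
  have hF : Continuous F := by
    rw [continuous_iff_continuousAt]
    intro p
    rcases N.cover.ge (mem_univ p) with h | h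
    · refine (hf.continuousAt (N.isOpen_compl.mem_nhds h)).congr ?_
      filter_upwards [N.isOpen_compl.mem_nhds h] with q hq
      exact (if_neg hq).symm
    · refine (continuousAt_const (y := f (N.toFun (1, 1)))).congr ?_
      filter_upwards [N.isOpen_range.mem_nhds h] with q ⟨⟨u, z⟩, hq⟩
      by_cases hqK : q ∈ range K
      · exact (if_pos hqK).symm
      · rw [← hfc u z, hq]
        · exact (if_neg hqK).symm
        · rintro rfl
          exact hqK ⟨u, by rw [← hq, N.core]⟩
  have := hS.constant hF.continuousOn (mem_univ x) (mem_univ y)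
  rwa [show F x = f x from if_neg hx, show F y = f y from if_neg hy] at this

include N in
theorem pathConnectedSpace_compl : PathConnectedSpace (KnotComplement K) :=
  isPathConnected_iff_pathConnectedSpace.1 N.isPathConnected_compl

theorem pathConnectedSpace_exterior : PathConnectedSpace N.Exterior := by
  have := N.pathConnectedSpace_compl
  exact Function.Surjective.pathConnectedSpace
    (fun x => ⟨N.ofExterior x, N.toExterior_ofExterior x⟩) N.toExterior.continuous

variable {G : Type*} [Group G]

/-- Pushing outwards changes a holonomy by a gauge transformation. -/
theorem exists_push_conj (Φ : Hol (KnotComplement K) G) (R : ℝ) :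
    ∃ h : KnotComplement K → G, ∀ γ : C(ℝ, KnotComplement K),
      Φ γ = h (γ 0) * Φ ⟨fun t => N.push (γ t, R), by fun_prop⟩ * (h (γ 1))⁻¹ := by
  refine ⟨fun x => Φ ⟨fun t => N.push (x, t * R), by fun_prop⟩, fun γ => ?_⟩
  have h := Φ.square (X := KnotComplement K) ⟨fun v => N.push (γ v.2, v.1 * R), by fun_prop⟩
  have e (a b : ℝ × ℝ) (γ' : C(ℝ, KnotComplement K))
      (h' : ∀ t, γ' t = N.push (γ (a.2 + t * (b.2 - a.2)), (a.1 + t * (b.1 - a.1)) * R)) :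
      (ContinuousMap.seg ⟨fun v => N.push (γ v.2, v.1 * R), by fun_prop⟩ a b :
        C(ℝ, KnotComplement K)) = γ' := by
    ext1 t
    rw [h']
    rfl
  rw [e (0, 0) (0, 1) γ fun t => by simp [push_zero],
    e (0, 1) (1, 1) ⟨fun t => N.push (γ 1, t * R), by fun_prop⟩ fun t => by simp,
    e (0, 0) (1, 0) ⟨fun t => N.push (γ 0, t * R), by fun_prop⟩ fun t => by simp,
    e (1, 0) (1, 1) ⟨fun t => N.push (γ t, R), by fun_prop⟩ fun t => by simp] at h
  rw [← h, mul_inv_cancel_right]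

end TubularNbhd

end

/-! ### Slopes do not depend on the Seifert framed neighbourhood -/

section

open Set Filter Topology

namespace TubularNbhd

variable {K : Circle → S3} (N : TubularNbhd K) {G : Type*} [Group G]

/-- The tori around the knot, with the logarithm of the radius as last coordinate. -/
def torus : C(Circle × Circle × ℝ, KnotComplement K) where
  toFun x := ⟨N.toFun (x.1, (Real.exp x.2.2 : ℂ) * x.2.1), N.not_mem_range
    (mul_ne_zero (by exact_mod_cast (Real.exp_pos _).ne') (Circle.coe_ne_zero _))⟩
  continuous_toFun := Continuous.subtype_mk (N.smooth.continuous.comp (by fun_prop)) _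

theorem torus_val (u v : Circle) (x : ℝ) :
    (N.torus (u, v, x) : S3) = N.toFun (u, (Real.exp x : ℂ) * v) := rfl

theorem torus_log (u : Circle) {z : ℂ} (hz : z ≠ 0) :
    (N.torus (u, Complex.dir z, Real.log ‖z‖) : S3) = N.toFun (u, z) := by
  rw [torus_val, Real.exp_log (norm_pos_iff.2 hz), Complex.norm_mul_dir]

theorem hol_slopeLoop_eq (ρ : Hol (KnotComplement K) G) (r : ℚ) :
    ρ (N.ofExterior.comp (DehnSurgery.slopeLoop N r)) =
      ρ.longitude N.torus ^ (r.den : ℤ) * ρ.meridian N.torus ^ r.num := by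
  obtain ⟨g, -, hg⟩ := ρ.torus_loop N.torus (HasDeg.exp (r.den : ℤ)) (HasDeg.exp r.num)
    (ξ := fun _ => 0) continuous_const rfl (γ := N.ofExterior.comp (DehnSurgery.slopeLoop N r))
    (fun t => by
      apply Subtype.ext
      rw [torus_val, Real.exp_zero, Complex.ofReal_one, one_mul]
      change N.toFun (1 ^ _ * _, ((1 ^ _ * _ : Circle) : ℂ)) = _
      rw [one_zpow, one_zpow, one_mul, one_mul]
      rfl)
  exact hg (by simp) (by simp) rfl

theorem longitude_eq_one {A : Type*} [CommGroup A] (hN : N.IsSeifertFramed)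
    (Φ : Hol (KnotComplement K) A) : Φ.longitude N.torus = 1 := by
  rw [← Φ.eq_one_of_abelianization N.parallel hN]
  refine Φ.congr_Icc fun t ht => Subtype.ext ?_
  simp only [ContinuousMap.comp_apply, ContinuousMap.coe_mk, torus_val, Path.extend_apply _ ht]
  simp [parallel]

/-- The holonomy sending a loop to the power of `A` given by its degree with respect to the
angle function `f`. -/
def angleHol {f : S3 → Circle} (hf : ContinuousOn f (range K)ᶜ) (A : G) :
    Hol (KnotComplement K) G :=
  (Hol.circle A).comap ⟨fun x => f x, hf.comp_continuous continuous_subtype_val fun x => x.2⟩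

theorem angleHol_apply {f : S3 → Circle} (hf : ContinuousOn f (range K)ᶜ) (A : G)
    {γ : C(ℝ, KnotComplement K)} {n : ℤ} (h : HasDeg (fun t => f (γ t)) n) :
    angleHol hf A γ = A ^ n := Hol.circle_apply A h

variable {N}

/-- The degree of an angle function on the meridian of any tubular neighbourhood is one. -/
theorem hasDeg_meridian (N' : TubularNbhd K) {f : S3 → Circle} {g : Circle × ℂ → Circle}
    (hf : ContinuousOn f (range K)ᶜ) (hg : Continuous g)
    (hfg : ∀ u z, z ≠ 0 → f (N.toFun (u, z)) = g (u, z) * Complex.dir z) :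
    HasDeg (fun t => f (N'.torus (1, Circle.exp (2 * Real.pi * t), 0))) 1 := by
  -- The core of `N` crosses the fibre of `N'` over 1 with θ = id and ζ = 0, so the crossing sign is
  -- +1. The radius is then deformed from ε to 1.
  have h := eventually_hasDeg_fibre N' N hg hfg (t₀ := 0) (hasDerivAt_id 0)
    (hasDerivAt_const 0 (0 : ℂ)) one_ne_zero (.of_forall fun t => by
      rw [id, N.core, N'.core])
  obtain ⟨ε, hε, hε0⟩ := (h.and self_mem_nhdsWithin).exists
  refine HasDeg.homotopy
    (fun x : ℝ × ℝ => f (N'.torus (1, Circle.exp (2 * Real.pi * x.2), x.1))) ?_ (fun s => by simp)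
    (Real.log ε) 0 ?_
  · exact hf.comp_continuous (continuous_subtype_val.comp (by fun_prop)) fun x => Subtype.prop _
  · simpa only [torus_val, Real.exp_log hε0, id, Circle.exp_zero, zero_add, sign_one,
      SignType.coe_one] using hε

/-- Two Seifert framed tubular neighbourhoods have the same slopes. -/
theorem slope_eq_one (hN : N.IsSeifertFramed) {N' : TubularNbhd K} (hN' : N'.IsSeifertFramed)
    (ρ : Hol (KnotComplement K) G) {p q : ℤ}
    (h : ρ.longitude N'.torus ^ q * ρ.meridian N'.torus ^ p = 1) :
    ρ.longitude N.torus ^ q * ρ.meridian N.torus ^ p = 1 := by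
  obtain ⟨f, g, hf, hg, hfg⟩ := N.exists_angle
  have hO : IsOpen (N'.toFun ⁻¹' range N.toFun) := N.isOpen_range.preimage N'.smooth.continuous
  -- By compactness of the circle, all sufficiently thin tubes of `N'` lie in the image of `N`.
  obtain ⟨U, V, -, hV, hU, hV0, hUV⟩ := generalized_tube_lemma (s := univ) isCompact_univ
    (t := {(0 : ℂ)}) isCompact_singleton hO (by
      rintro ⟨u, z⟩ ⟨-, rfl⟩
      exact ⟨(u, 0), by rw [N.core, N'.core]⟩)
  obtain ⟨δ, hδ, hball⟩ := Metric.isOpen_iff.1 hV 0 (hV0 rfl)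
  have hmem (u : Circle) {z : ℂ} (hz : ‖z‖ < δ) : N'.toFun (u, z) ∈ range N.toFun :=
    hUV ⟨hU trivial, hball (mem_ball_zero_iff.2 hz)⟩
  let e (t : ℝ) : Circle := Circle.exp (2 * Real.pi * t)
  have he : Continuous e := by fun_prop
  have he01 : e 0 = e 1 := by simp [e]
  -- a small loop in the slope, and its coordinates with respect to `N`
  let x : ℝ → Circle × ℂ := fun t =>
    N.coords (N'.toFun (e t ^ q, (Real.exp (Real.log (δ / 2)) : ℂ) * (e t ^ p : Circle)))
  have hδ2 : 0 < δ / 2 := half_pos hδ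
  have hnorm (c : ℝ) (hc : |c| < δ) (v : Circle) : ‖(c : ℂ) * v‖ < δ := by
    rwa [norm_mul, Circle.norm_coe, mul_one, Complex.norm_real]
  have hexp : |Real.exp (Real.log (δ / 2))| < δ := by
    rw [Real.exp_log hδ2, abs_of_pos hδ2]; exact half_lt_self hδ
  have hmem' (t : ℝ) := hmem (e t ^ q) (hnorm _ hexp (e t ^ p))
  let γ : C(ℝ, KnotComplement K) :=
    ⟨fun t => N'.torus (e t ^ q, e t ^ p, Real.log (δ / 2)),
      N'.torus.continuous.comp ((he.zpow q).prodMk ((he.zpow p).prodMk continuous_const))⟩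
  have hx0 (t : ℝ) : (x t).2 ≠ 0 := N.coords_snd_ne_zero (γ t).2 (hmem' t)
  have hxc : Continuous x := N.continuousOn_coords.comp_continuous
    (continuous_subtype_val.comp γ.continuous) hmem'
  have hx01 : x 0 = x 1 := by simp only [x, he01]
  have hγ (t : ℝ) : γ t = N.torus ((x t).1, Complex.dir (x t).2, Real.log ‖(x t).2‖) := by
    apply Subtype.ext
    rw [N.torus_log _ (hx0 t)]
    exact (N.apply_coords (hmem' t)).symm
  have hξ : Continuous fun t => Real.log ‖(x t).2‖ :=
    (continuous_snd.comp hxc).norm.log fun t => norm_ne_zero_iff.2 (hx0 t)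
  have hξ01 : Real.log ‖(x 0).2‖ = Real.log ‖(x 1).2‖ := by rw [hx01]
  -- the longitudinal degree
  have hα : HasDeg (fun t => (x t).1) q := by
    have h0 : ∀ s : ℝ, |max 0 (min 1 s) * (δ / 2)| < δ := fun s => by
      rw [abs_of_nonneg (mul_nonneg (le_max_left _ _) hδ2.le)]
      have : max 0 (min 1 s) ≤ 1 := max_le zero_le_one (min_le_left _ _)
      nlinarith
    have := HasDeg.homotopy (n := q) (fun y : ℝ × ℝ => (N.coords (N'.toFun (e y.2 ^ q,
        ((max 0 (min 1 y.1) * (δ / 2) : ℝ) : ℂ) * (e y.2 ^ p : Circle)))).1) ?_ (fun s => by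
          simp only [he01]) 0 1 ?_
    · simpa only [min_self, max_eq_right zero_le_one, one_mul, x, Real.exp_log hδ2] using this
    · refine continuous_fst.comp (N.continuousOn_coords.comp_continuous
        (N'.smooth.continuous.comp ?_) fun y => hmem _ (hnorm _ (h0 _) _))
      have h1 : Continuous fun y : ℝ × ℝ => e y.2 ^ q := (he.comp continuous_snd).zpow q
      have h2 : Continuous fun y : ℝ × ℝ => e y.2 ^ p := (he.comp continuous_snd).zpow p
      exact h1.prodMk ((Complex.continuous_ofReal.comp (by fun_prop)).mul
        (continuous_induced_dom.comp h2))
    -- At radius zero the loop lies on the common core, where both neighbourhoods have the same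
    -- longitudinal coordinate.
    · have h0 : max 0 (min 1 (0 : ℝ)) = 0 := by simp
      simp only [h0, zero_mul, Complex.ofReal_zero]
      simp only [N'.core, ← N.core, coords_apply]
      exact HasDeg.exp q
  -- the meridional degree
  obtain ⟨n, hβ⟩ := HasDeg.exists_of_continuous
    ((continuous_snd.comp hxc).dir hx0) (by simp only [Function.comp, hx01])
  -- The integer-valued linking number kills both longitudes and is 1 on both meridians, so the
  -- meridional exponents agree.
  have hn : n = p := by
    let Ψ := angleHol hf (Multiplicative.ofAdd (1 : ℤ))
    have hM (N' : TubularNbhd K) : Ψ.meridian N'.torus = Multiplicative.ofAdd (1 : ℤ) := by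
      rw [Hol.meridian, angleHol_apply hf _ (hasDeg_meridian N' hf hg hfg), zpow_one]
    obtain ⟨g₁, h₁, -⟩ := Ψ.torus_loop N.torus hα hβ hξ hξ01 hγ
    obtain ⟨g₂, h₂, -⟩ := Ψ.torus_loop N'.torus (HasDeg.exp q) (HasDeg.exp p)
      (ξ := fun _ => Real.log (δ / 2)) continuous_const rfl (γ := γ) fun t => rfl
    rw [N.longitude_eq_one hN, hM, one_zpow, one_mul, mul_comm, mul_inv_cancel_left] at h₁
    rw [N'.longitude_eq_one hN', hM, one_zpow, one_mul, mul_comm, mul_inv_cancel_left, h₁] at h₂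
    simpa [← ofAdd_zsmul] using h₂
  -- Up to conjugation, the same small loop computes the slope in either neighbourhood.
  obtain ⟨g₁, h₁, -⟩ := ρ.torus_loop N.torus hα hβ hξ hξ01 hγ
  obtain ⟨g₂, h₂, -⟩ := ρ.torus_loop N'.torus (HasDeg.exp q) (HasDeg.exp p)
    (ξ := fun _ => Real.log (δ / 2)) continuous_const rfl (γ := γ) fun t => rfl
  rw [h, mul_one, inv_mul_cancel, h₁, hn] at h₂
  rw [mul_assoc, inv_mul_eq_one] at h₂
  simpa using h₂.symm

end TubularNbhd

end

/-! ### The degree on a large circle as a sum of local degrees -/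

section

open Set Filter Topology

namespace HasDeg

theorem congr_fun {γ γ' : ℝ → Circle} {n : ℤ} (h : HasDeg γ n) (h' : ∀ t, γ t = γ' t) :
    HasDeg γ' n := funext h' ▸ h

/-- A map of the circle of degree zero has a logarithm. -/
theorem exists_log {F : Circle → Circle} (hF : Continuous F)
    (h : HasDeg (fun t => F (Circle.exp (2 * Real.pi * t))) 0) :
    ∃ ℓ : C(Circle, ℝ), ∀ u, F u = Circle.exp (ℓ u) := by
  obtain ⟨ψ, hψ⟩ := Circle.exists_lift (E := ℝ) ⟨fun t => F (Circle.exp t), by fun_prop⟩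
  simp only [ContinuousMap.coe_mk] at hψ
  have h1 := h.lift_eq (ψ := fun t => ψ (2 * Real.pi * t)) (by fun_prop) fun t => hψ _
  obtain ⟨k, hk⟩ := Circle.lift_sub_lift_eqOn isPreconnected_univ
    (ψ := fun t => ψ (t + 2 * Real.pi)) (ψ' := ψ) (by fun_prop) (by fun_prop) (fun t _ => by
      rw [← hψ, ← hψ, Circle.exp_add, Circle.exp_two_pi, mul_one])
  have hp : Function.Periodic ψ (2 * Real.pi) := fun t => by
    rw [hk t trivial, ← sub_eq_zero, add_sub_cancel_left, ← add_sub_cancel_left (ψ 0) (k * _),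
      ← hk 0 trivial]
    simpa using h1
  have hq : IsQuotientMap Circle.exp := Circle.isAddQuotientCoveringMap_exp.toIsQuotientMap
  have hfac : Function.FactorsThrough ψ Circle.exp := fun a b hab => by
    obtain ⟨m, hm⟩ := Circle.exp_eq_exp.1 hab
    rw [hm]
    exact hp.int_mul m b
  refine ⟨hq.lift (f := Circle.exp) ψ hfac, fun u => ?_⟩
  obtain ⟨t, rfl⟩ := Circle.exp_surjective u
  rw [hψ]
  congr 1
  exact (DFunLike.congr_fun (hq.lift_comp (f := Circle.exp) ψ hfac) t).symm

theorem hasLog_sphere {F : ℂ → Circle} {z : ℂ} {ε : ℝ} (hε : 0 < ε)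
    (hF : ContinuousOn F (Metric.sphere z ε))
    (h : HasDeg (fun t => F (z + ε * Circle.exp (2 * Real.pi * t))) 0) :
    HasLog F (Metric.sphere z ε) := by
  have hmem (u : Circle) : z + ε * u ∈ Metric.sphere z ε := by
    rw [mem_sphere_iff_norm, add_sub_cancel_left, norm_mul, Circle.norm_coe, mul_one,
      Complex.norm_real, Real.norm_of_nonneg hε.le]
  obtain ⟨ℓ, hℓ⟩ := exists_log (F := fun u : Circle => F (z + ε * u))
    (hF.comp_continuous (by fun_prop) hmem) h
  refine ⟨fun w => ℓ (Complex.dir (w - z)), ?_, fun w hw => ?_⟩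
  · refine ℓ.continuous.comp_continuousOn (Complex.continuousOn_dir.comp (by fun_prop) fun w hw => ?_)
    rw [mem_sphere_iff_norm] at hw
    change w - z ≠ 0
    rw [← norm_ne_zero_iff, hw]
    exact hε.ne'
  · rw [← hℓ, ← mem_sphere_iff_norm.1 hw, Complex.norm_mul_dir, add_sub_cancel]

end HasDeg

namespace Complex

theorem hasDeg_dir_circle (z : ℂ) {ε : ℝ} (hε : 0 < ε) :
    HasDeg (fun t => dir (z + ε * Circle.exp (2 * Real.pi * t) - z)) 1 := by
  refine hasDeg_dir (c := ε) (by fun_prop) (by simp) fun t => ?_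
  rw [add_sub_cancel_left, zpow_one, sub_self, norm_zero, Complex.norm_real]
  exact norm_pos_iff.2 hε.ne'

theorem hasDeg_dir_of_lt {z w : ℂ} {ε : ℝ} (hε : 0 ≤ ε) (h : ε < ‖z - w‖) :
    HasDeg (fun t => dir (z + ε * Circle.exp (2 * Real.pi * t) - w)) 0 := by
  refine hasDeg_dir (c := z - w) (by fun_prop) (by simp) fun t => ?_
  rw [zpow_zero, mul_one, show z + ε * Circle.exp (2 * Real.pi * t) - w - (z - w) =
    ε * Circle.exp (2 * Real.pi * t) by ring, norm_mul, Circle.norm_coe, mul_one,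
    Complex.norm_real, Real.norm_of_nonneg hε]
  exact h

theorem hasDeg_dir_of_norm_lt {w : ℂ} {R : ℝ} (h : ‖w‖ < R) :
    HasDeg (fun t => dir (R * Circle.exp (2 * Real.pi * t) - w)) 1 := by
  refine hasDeg_dir (c := R) (by fun_prop) (by simp) fun t => ?_
  rw [zpow_one, sub_sub_cancel_left, norm_neg, Complex.norm_real]
  exact h.trans_le (le_abs_self R)

end Complex

/-- The degree on a large circle is the sum of the local degrees at the punctures. -/
theorem HasDeg.of_punctures {ι : Type*} (T : Finset ι) (ζ : ι → ℂ) (hζ : InjOn ζ T) {R : ℝ}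
    (hR : ∀ i ∈ T, ‖ζ i‖ < R) (n : ι → ℤ) {F : ℂ → Circle} (hF : ContinuousOn F (ζ '' T)ᶜ)
    (hn : ∀ i ∈ T, ∀ᶠ ε : ℝ in 𝓝[>] 0,
      HasDeg (fun t => F (ζ i + ε * Circle.exp (2 * Real.pi * t))) (n i)) :
    HasDeg (fun t => F (R * Circle.exp (2 * Real.pi * t))) (∑ i ∈ T, n i) := by
  classical
  induction T using Finset.induction_on generalizing F with
  | empty =>
    rw [Finset.coe_empty, image_empty, compl_empty, continuousOn_univ] at hF
    refine HasDeg.homotopy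
      (fun x : ℝ × ℝ => F (x.1 * R * Circle.exp (2 * Real.pi * x.2))) (by fun_prop)
      (fun s => by simp) 0 1 ?_ |>.congr_fun ?_
    · simpa using HasDeg.const (F 0)
    · intro t; simp
  | insert i T hi ih =>
    have hζT : ∀ j ∈ T, ζ j ≠ ζ i := fun j hj h => by
      have := hζ (by simp [hj]) (by simp) h
      exact hi (this ▸ hj)
    have hsep : ∀ᶠ ε : ℝ in 𝓝[>] 0, ∀ j ∈ T, ε < ‖ζ j - ζ i‖ := by
      rw [Filter.eventually_all_finset]
      intro j hj
      exact mem_nhdsWithin_of_mem_nhds (gt_mem_nhds (norm_pos_iff.2 (sub_ne_zero.2 (hζT j hj))))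
    have hbig : ∀ᶠ ε : ℝ in 𝓝[>] 0, ε < R - ‖ζ i‖ :=
      mem_nhdsWithin_of_mem_nhds (gt_mem_nhds (sub_pos.2 (hR i (by simp))))
    obtain ⟨ε, ⟨⟨⟨hε, hsep⟩, hbig⟩, hε0 : 0 < ε⟩⟩ :=
      ((((hn i (by simp)).and hsep).and hbig).and self_mem_nhdsWithin).exists
    -- Dividing out the winding at ζ i makes the degree around that puncture zero. The function can
    -- then be redefined on a small disk so that the puncture disappears, and the induction
    -- hypothesis applies.
    let G (w : ℂ) : Circle := F w * Complex.dir (w - ζ i) ^ (-n i)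
    have hG : ContinuousOn G (ζ '' ↑(insert i T))ᶜ := by
      refine hF.mul (ContinuousOn.zpow ?_ _)
      refine Complex.continuousOn_dir.comp (by fun_prop) fun w hw => sub_ne_zero.2 ?_
      rintro rfl
      exact hw ⟨i, by simp, rfl⟩
    have hsph : Metric.sphere (ζ i) ε ⊆ (ζ '' ↑(insert i T))ᶜ := by
      rintro w hw ⟨j, hj, rfl⟩
      rw [mem_sphere_iff_norm] at hw
      rcases Finset.mem_insert.1 (Finset.mem_coe.1 hj) with rfl | hj
      · simp at hw; exact hε0.ne hw
      · exact (hsep j hj).ne hw.symm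
    have hG0 : HasDeg (fun t => G (ζ i + ε * Circle.exp (2 * Real.pi * t))) 0 := by
      have := hε.mul ((Complex.hasDeg_dir_circle (ζ i) hε0).zpow (-n i))
      rwa [mul_one, add_neg_cancel] at this
    obtain ⟨ρ, hρ⟩ := (HasDeg.hasLog_sphere hε0 (hG.mono hsph) hG0).exists_extend
      Metric.isClosed_sphere
    let G' : ℂ → Circle := (Metric.closedBall (ζ i) ε).piecewise ρ G
    have hG'eq {w : ℂ} (hw : ε < ‖w - ζ i‖) : G' w = G w :=
      piecewise_eq_of_notMem _ _ _ fun h => by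
        rw [mem_closedBall_iff_norm] at h; exact absurd hw h.not_gt
    have hG' : ContinuousOn G' (ζ '' T)ᶜ := by
      have := ContinuousOn.piecewise_union (f := ρ) (g := G) (W := (ζ '' T)ᶜ)
        (Metric.isClosed_closedBall (x := ζ i) (ε := ε))
        (Metric.isOpen_ball (x := ζ i) (ε := ε)).isClosed_compl ρ.continuous.continuousOn
        (hG.mono ?_) ?_
      · refine this.mono fun w hw => ⟨?_, hw⟩
        by_cases h : w ∈ Metric.closedBall (ζ i) ε
        · exact Or.inl h
        · exact Or.inr fun h' => h (Metric.ball_subset_closedBall h')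
      · rintro w ⟨hw, hw'⟩ ⟨j, hj, rfl⟩
        rcases Finset.mem_insert.1 (Finset.mem_coe.1 hj) with rfl | hj
        · exact hw (Metric.mem_ball_self hε0)
        · exact hw' ⟨j, hj, rfl⟩
      · rintro w ⟨⟨h1, h2⟩, -⟩
        refine hρ ?_
        rw [Metric.mem_closedBall] at h1
        have h2' : ¬ dist w (ζ i) < ε := h2
        exact Metric.mem_sphere.2 (le_antisymm h1 (not_lt.1 h2'))
    have key := ih (hζ.mono (by simp)) (fun j hj => hR j (by simp [hj])) hG' fun j hj => by
      have h1 : ∀ᶠ η : ℝ in 𝓝[>] 0, η < ‖ζ j - ζ i‖ - ε :=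
        mem_nhdsWithin_of_mem_nhds (gt_mem_nhds (sub_pos.2 (hsep j hj)))
      filter_upwards [hn j (by simp [hj]), h1, self_mem_nhdsWithin] with η hη hη' hη0
      have hη0' : (0 : ℝ) < η := hη0
      have h2 := hη.mul ((Complex.hasDeg_dir_of_lt (z := ζ j) (w := ζ i) hη0'.le
        (by linarith)).zpow (-n i))
      rw [mul_zero, add_zero] at h2
      refine h2.congr_fun fun t => (hG'eq ?_).symm
      have h3 : ‖(η * Circle.exp (2 * Real.pi * t) : ℂ)‖ = η := by
        rw [norm_mul, Circle.norm_coe, mul_one, Complex.norm_real, Real.norm_of_nonneg hη0'.le]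
      have h4 := norm_sub_norm_le (ζ j - ζ i) (-(η * Circle.exp (2 * Real.pi * t) : ℂ))
      rw [norm_neg, h3, sub_neg_eq_add, sub_add_eq_add_sub] at h4
      linarith
    have hR0 : ‖ζ i‖ < R := hR i (by simp)
    -- The winding that was divided out contributes `n i` on the large circle, which encloses ζ i.
    have h5 := key.mul ((Complex.hasDeg_dir_of_norm_lt hR0).zpow (n i))
    rw [mul_one, add_comm, ← Finset.sum_insert hi] at h5
    refine h5.congr_fun fun t => ?_
    rw [hG'eq]
    · simp only [G, mul_assoc, ← zpow_add, neg_add_cancel, zpow_zero, mul_one]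
    · have h3 : ‖(R * Circle.exp (2 * Real.pi * t) : ℂ)‖ = R := by
        rw [norm_mul, Circle.norm_coe, mul_one, Complex.norm_real,
          Real.norm_of_nonneg ((norm_nonneg _).trans hR0.le)]
      have h4 := norm_sub_norm_le (R * Circle.exp (2 * Real.pi * t) : ℂ) (ζ i)
      rw [h3] at h4
      linarith

end

/-! ### The winding number of the pattern as a linking number -/

section

open Set Filter Topology

/-- Near `t` the lift equals θ(t) plus the imaginary part of log (c(s)/c(t)), by continuity of θ. -/
theorem Circle.exists_hasDerivAt_lift {c : ℝ → Circle} {θ : ℝ → ℝ} (hθ : Continuous θ)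
    (h : ∀ t, c t = Circle.exp (θ t)) {t : ℝ} {c' : ℂ} (hc : HasDerivAt (fun t => (c t : ℂ)) c' t) :
    ∃ θ', HasDerivAt θ θ' t := by
  have hval (s : ℝ) : (c s : ℂ) / c t = Complex.exp ((θ s - θ t : ℝ) * Complex.I) := by
    rw [h, h, Circle.coe_exp, Circle.coe_exp, ← Complex.exp_sub]
    congr 1; push_cast; ring
  have h1 : HasDerivAt (fun s => Complex.log ((c s : ℂ) / c t)) _ t :=
    (hc.div_const (c t : ℂ)).clog_real (by rw [hval]; simp [Complex.slitPlane])
  have h2 := (Complex.imCLM.hasFDerivAt.comp_hasDerivAt t h1).add_const (θ t)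
  refine ⟨_, h2.congr_of_eventuallyEq ?_⟩
  have h3 : ∀ᶠ s in 𝓝 t, |θ s - θ t| < Real.pi := by
    have : ContinuousAt (fun s => |θ s - θ t|) t := by fun_prop
    exact this.eventually (gt_mem_nhds (by simpa using Real.pi_pos))
  filter_upwards [h3] with s hs
  rw [abs_lt] at hs
  change θ s = (Complex.log ((c s : ℂ) / c t)).im + θ t
  rw [hval, Complex.log_exp (by simpa using hs.1) (by simpa using hs.2.le)]
  simp

theorem Int.floor_add_ceil_of_mem_Ioo {x : ℝ} {k : ℤ} (h : x ∈ Ioo (k : ℝ) (k + 1)) :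
    ⌊x⌋ + ⌈x⌉ = 2 * k + 1 := by
  have h1 : ⌊x⌋ = k := Int.floor_eq_iff.2 ⟨h.1.le, h.2⟩
  have h2 : ⌈x⌉ = k + 1 := Int.ceil_eq_iff.2 ⟨by push_cast; linarith [h.1], by push_cast; exact h.2.le⟩
  rw [h1, h2]; ring

/-- The number of integers crossed by a function on an interval, counted with sign. -/
theorem sum_sign_crossings {φ φ' : ℝ → ℝ} (hφ : ∀ t, HasDerivAt φ (φ' t) t) {a b : ℝ} (hab : a ≤ b)
    (T : Finset ℝ) (hT : ∀ t, t ∈ T ↔ t ∈ Icc a b ∧ ∃ k : ℤ, φ t = k) (hreg : ∀ t ∈ T, φ' t ≠ 0)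
    (ha : ∀ k : ℤ, φ a ≠ k) (hb : ∀ k : ℤ, φ b ≠ k) :
    ∑ t ∈ T, (SignType.sign (φ' t) : ℤ) = ⌊φ b⌋ - ⌊φ a⌋ := by
  classical
  set σ : ℝ → ℤ := fun t => (SignType.sign (φ' t) : ℤ) with hσ
  -- Twice the difference between the crossing level of φ and the signed count up to x, with both
  -- symmetrized (floor plus ceiling, strict plus weak inequality). In this form it is locally
  -- constant even at the crossings.
  let H (x : ℝ) : ℤ := (⌊φ x⌋ + ⌈φ x⌉) -
    (∑ t ∈ T with t < x, σ t + ∑ t ∈ T with t ≤ x, σ t)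
  have hcont (x : ℝ) : ContinuousAt φ x := (hφ x).continuousAt
  have hnon (x : ℝ) (hx : ∀ k : ℤ, φ x ≠ k) : φ x ∈ Ioo (⌊φ x⌋ : ℝ) (⌊φ x⌋ + 1) :=
    ⟨(Int.floor_le _).lt_of_ne fun h => hx _ h.symm, Int.lt_floor_add_one _⟩
  have hloc : ∀ x ∈ Icc a b, ∀ᶠ y in 𝓝 x, H y = H x := by
    intro x hx
    have hsep : ∀ᶠ y in 𝓝 x, ∀ t ∈ T, t ≠ x → (t < y ↔ t < x) ∧ (t ≤ y ↔ t ≤ x) := by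
      rw [Filter.eventually_all_finset]
      intro t _
      rcases lt_trichotomy t x with h | h | h
      · filter_upwards [lt_mem_nhds h] with y hy _
        simp [hy, h, hy.le, h.le]
      · exact .of_forall fun y h' => absurd h h'
      · filter_upwards [gt_mem_nhds h] with y hy _
        simp [hy.not_gt, h.not_gt, hy.not_ge, h.not_ge]
    by_cases hxT : x ∈ T
    · obtain ⟨-, k, hk⟩ := (hT x).1 hxT
      have hslope : ∀ᶠ y in 𝓝 x, y ≠ x → 0 < φ' x * slope φ x y := eventually_nhdsWithin_iff.1
        ((tendsto_const_nhds.mul (hasDerivAt_iff_tendsto_slope.1 (hφ x))).eventually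
          (lt_mem_nhds (mul_self_pos.2 (hreg x hxT))))
      have hnear : ∀ᶠ y in 𝓝 x, φ y ∈ Ioo ((k : ℝ) - 1) (k + 1) :=
        (hcont x).eventually (Ioo_mem_nhds (by rw [hk]; linarith) (by rw [hk]; linarith))
      have hB : ∑ t ∈ T with t ≤ x, σ t = ∑ t ∈ T with t < x, σ t + σ x := by
        rw [show T.filter (· ≤ x) = insert x (T.filter (· < x)) by
          ext t; simp only [Finset.mem_filter, Finset.mem_insert, le_iff_lt_or_eq]
          constructor
          · rintro ⟨h, h' | h'⟩
            exacts [Or.inr ⟨h, h'⟩, Or.inl h']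
          · rintro (rfl | h)
            exacts [⟨hxT, Or.inr rfl⟩, ⟨h.1, Or.inl h.2⟩],
          Finset.sum_insert (by simp), add_comm]
      have hHx : H x = 2 * k - (2 * ∑ t ∈ T with t < x, σ t + σ x) := by
        simp only [H, hB, hk, Int.floor_intCast, Int.ceil_intCast]; ring
      filter_upwards [hsep, hslope, hnear] with y hy hs hyk
      rcases eq_or_ne y x with rfl | hyx
      · rfl
      have hs := hs hyx
      rw [slope_def_field, hk] at hs
      have hpos : φ y > k → ⌊φ y⌋ + ⌈φ y⌉ = 2 * k + 1 := fun h =>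
        Int.floor_add_ceil_of_mem_Ioo ⟨h, hyk.2⟩
      have hneg : φ y < k → ⌊φ y⌋ + ⌈φ y⌉ = 2 * k - 1 := fun h => by
        rw [Int.floor_add_ceil_of_mem_Ioo (k := k - 1) ⟨by push_cast; exact hyk.1, by
          push_cast; linarith⟩]
        ring
      have hfilter : (∑ t ∈ T with t < y, σ t) = (∑ t ∈ T with t ≤ y, σ t) := by
        congr 1
        refine Finset.filter_congr fun t ht => ?_
        rcases eq_or_ne t x with rfl | h
        · exact ⟨le_of_lt, fun h => h.lt_of_ne hyx.symm⟩
        · rw [(hy t ht h).1, (hy t ht h).2]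
          exact ⟨le_of_lt, fun h' => h'.lt_of_ne h⟩
      rcases lt_or_gt_of_ne hyx with hlt | hgt
      · have hf : (∑ t ∈ T with t < y, σ t) = ∑ t ∈ T with t < x, σ t := by
          congr 1
          refine Finset.filter_congr fun t ht => ?_
          rcases eq_or_ne t x with rfl | h
          · simp [hlt.not_gt]
          · exact (hy t ht h).1
        simp only [hHx]
        simp only [H, ← hfilter, hf]
        rcases lt_or_gt_of_ne (hreg x hxT) with h | h
        · have : 0 < φ y - k := by
            by_contra hc
            have := div_nonneg_of_nonpos (not_lt.1 hc) (sub_neg.2 hlt).le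
            nlinarith
          rw [hpos (sub_pos.1 this), show σ x = -1 by simp [σ, sign_neg h]]
          ring
        · have : φ y - k < 0 := by
            by_contra hc
            have := div_nonpos_of_nonneg_of_nonpos (not_lt.1 hc) (sub_neg.2 hlt).le
            nlinarith
          rw [hneg (sub_neg.1 this), show σ x = 1 by simp [σ, sign_pos h]]
          ring
      · have hf : (∑ t ∈ T with t ≤ y, σ t) = ∑ t ∈ T with t ≤ x, σ t := by
          congr 1
          refine Finset.filter_congr fun t ht => ?_
          rcases eq_or_ne t x with rfl | h
          · simp [hgt.le]
          · exact (hy t ht h).2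
        simp only [hHx]
        simp only [H, hfilter, hf, hB]
        rcases lt_or_gt_of_ne (hreg x hxT) with h | h
        · have : φ y - k < 0 := by
            by_contra hc
            have := div_nonneg (not_lt.1 hc) (sub_pos.2 hgt).le
            nlinarith
          rw [hneg (sub_neg.1 this), show σ x = -1 by simp [σ, sign_neg h]]
          ring
        · have : 0 < φ y - k := by
            by_contra hc
            have := div_nonpos_of_nonpos_of_nonneg (not_lt.1 hc) (sub_pos.2 hgt).le
            nlinarith
          rw [hpos (sub_pos.1 this), show σ x = 1 by simp [σ, sign_pos h]]
          ring
    · have hxk : ∀ k : ℤ, φ x ≠ k := fun k hk => hxT ((hT x).2 ⟨hx, k, hk⟩)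
      filter_upwards [hsep, (hcont x).eventually (Ioo_mem_nhds (hnon x hxk).1 (hnon x hxk).2)]
        with y hy hφy
      have hne : ∀ t ∈ T, t ≠ x := fun t ht h => hxT (h ▸ ht)
      simp only [H]
      rw [Int.floor_add_ceil_of_mem_Ioo hφy, Int.floor_add_ceil_of_mem_Ioo (hnon x hxk),
        Finset.filter_congr fun t ht => (hy t ht (hne t ht)).1,
        Finset.filter_congr fun t ht => (hy t ht (hne t ht)).2]
  have hHab : H a = H b := by
    refine isPreconnected_Icc.constant (s := Icc a b) (fun x hx => ?_) (left_mem_Icc.2 hab)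
      (right_mem_Icc.2 hab)
    exact (tendsto_nhds_of_eventually_eq (hloc x hx)).mono_left inf_le_left
  have e1 : ∀ t ∈ T, a < t := fun t ht => by
    obtain ⟨h1, k, hk⟩ := (hT t).1 ht
    exact h1.1.lt_of_ne fun h => ha k (h ▸ hk)
  have e2 : ∀ t ∈ T, t < b := fun t ht => by
    obtain ⟨h1, k, hk⟩ := (hT t).1 ht
    exact h1.2.lt_of_ne fun h => hb k (h ▸ hk)
  simp only [H] at hHab
  rw [Int.floor_add_ceil_of_mem_Ioo (hnon a ha), Int.floor_add_ceil_of_mem_Ioo (hnon b hb),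
    Finset.filter_false_of_mem fun t ht => (e1 t ht).not_gt,
    Finset.filter_false_of_mem fun t ht => (e1 t ht).not_ge,
    Finset.filter_true_of_mem e2, Finset.filter_true_of_mem fun t ht => (e2 t ht).le,
    Finset.sum_empty] at hHab
  linarith

/-- One-dimensional Sard: the critical values modulo 2π form a null set. So do the countably many
translates of θ(t₀), which are avoided in order that t₀ is not a crossing. -/
theorem exists_regular {θ θ' : ℝ → ℝ} (hθ : ∀ t, HasDerivAt θ (θ' t) t) (t₀ : ℝ) :
    ∃ s : ℝ, (∀ t (k : ℤ), θ t = s + k * (2 * Real.pi) → θ' t ≠ 0) ∧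
      ∀ k : ℤ, θ t₀ ≠ s + k * (2 * Real.pi) := by
  have h1 (k : ℤ) : MeasureTheory.volume ((fun t => θ t - k * (2 * Real.pi)) '' {t | θ' t = 0}) = 0 := by
    refine MeasureTheory.addHaar_image_eq_zero_of_det_fderivWithin_eq_zero _
      (fun t _ => ((hθ t).sub_const _).hasFDerivAt.hasFDerivWithinAt) fun t ht => ?_
    rw [show θ' t = 0 from ht]
    simp [ContinuousLinearMap.det]
  have h2 : MeasureTheory.volume (range fun k : ℤ => θ t₀ - k * (2 * Real.pi)) = 0 :=
    (countable_range _).measure_zero _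
  have h3 := MeasureTheory.measure_union_null (MeasureTheory.measure_iUnion_null h1) h2
  obtain ⟨s, hs⟩ := (MeasureTheory.measure_eq_zero_iff_ae_notMem.1 h3).exists
  rw [mem_union, not_or] at hs
  refine ⟨s, fun t k ht h0 => hs.1 (mem_iUnion.2 ⟨k, t, h0, ?_⟩), fun k hk => hs.2 ⟨k, ?_⟩⟩
  · simp [ht]
  · simp [hk]

/-- Near an accumulation point only the integer closest to φ(x) could be attained. It is avoided on
a punctured neighbourhood, by continuity or by the nonzero derivative. -/
theorem finite_crossings {φ φ' : ℝ → ℝ} (hφ : ∀ t, HasDerivAt φ (φ' t) t)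
    (hreg : ∀ t (k : ℤ), φ t = k → φ' t ≠ 0) (a b : ℝ) :
    {t | t ∈ Icc a b ∧ ∃ k : ℤ, φ t = k}.Finite := by
  by_contra hinf
  obtain ⟨x, -, hacc⟩ := Set.Infinite.exists_accPt_of_subset_isCompact hinf
    (isCompact_Icc (a := a) (b := b)) fun t ht => ht.1
  rw [accPt_iff_frequently_nhdsNE] at hacc
  refine hacc ?_
  have h1 : ∀ᶠ y in 𝓝[≠] x, φ y ≠ round (φ x) := by
    by_cases h : φ x = round (φ x)
    · exact (hφ x).eventually_ne (hreg x _ h)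
    · exact ((hφ x).continuousAt.eventually_ne h).filter_mono nhdsWithin_le_nhds
  have h2 : ∀ᶠ y in 𝓝[≠] x, |φ y - round (φ x)| < 1 := by
    have : ContinuousAt (fun y => |φ y - round (φ x)|) x :=
      ((hφ x).continuousAt.sub continuousAt_const).abs
    refine (this.eventually (gt_mem_nhds ?_)).filter_mono nhdsWithin_le_nhds
    exact (abs_sub_round _).trans_lt (by norm_num)
  filter_upwards [h1, h2] with y hy1 hy2
  rintro ⟨-, k, hk⟩
  rw [hk] at hy1 hy2
  have h3 : |k - round (φ x)| < 1 := by exact_mod_cast hy2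
  exact hy1 (by rw [sub_eq_zero.1 (Int.abs_lt_one_iff.1 h3)])

/-- The meridian of the companion has linking number with the satellite equal to the winding number
of the pattern. -/
theorem IsPattern.hasDeg_meridian {C K : Circle → S3} {P : Circle → Circle × ℂ} (hP : IsPattern P)
    (N : TubularNbhd C) (hK : ∀ u, K u = N.toFun (P u)) (NK : TubularNbhd K) {f : S3 → Circle}
    {g : Circle × ℂ → Circle} (hf : ContinuousOn f (range K)ᶜ) (hg : Continuous g)
    (hfg : ∀ u z, z ≠ 0 → f (NK.toFun (u, z)) = g (u, z) * Complex.dir z)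
    {θ : ℝ → ℝ} (hθc : Continuous θ) (hθ : ∀ t, (P (Circle.exp t)).1 = Circle.exp (θ t)) {d : ℤ}
    (hd : θ (2 * Real.pi) - θ 0 = 2 * Real.pi * d) :
    HasDeg (fun t => f (N.toFun (1, Circle.exp (2 * Real.pi * t)))) d := by
  have hPs : ContMDiff (𝓡 1) ((𝓡 1).prod 𝓘(ℝ, ℂ)) ∞ P := hP.embedding.contMDiff
  have hPe : ContMDiff 𝓘(ℝ, ℝ) ((𝓡 1).prod 𝓘(ℝ, ℂ)) ∞ fun t => P (Circle.exp t) :=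
    hPs.comp contMDiff_circleExp
  have hζ : ContDiff ℝ ∞ fun t => (P (Circle.exp t)).2 :=
    contMDiff_iff_contDiff.1 (contMDiff_snd.comp hPe)
  have hFact : Fact (Module.finrank ℝ ℂ = 1 + 1) := ⟨by simp⟩
  have hc : ContDiff ℝ ∞ fun t => ((P (Circle.exp t)).1 : ℂ) :=
    contMDiff_iff_contDiff.1 ((contMDiff_coe_sphere (n := 1) (E := ℂ)).comp (contMDiff_fst.comp hPe))
  choose θ' hθ' using fun t => Circle.exists_hasDerivAt_lift hθc hθ
    (hc.differentiable (by simp) t).hasDerivAt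
  -- The fibre over e^(is) is transverse to K and misses the point of K with parameter 0.
  obtain ⟨s, hs, hs0⟩ := exists_regular hθ' 0
  have hpi : (0 : ℝ) < 2 * Real.pi := Real.two_pi_pos
  have hφ (t : ℝ) : HasDerivAt (fun t => (θ t - s) / (2 * Real.pi)) (θ' t / (2 * Real.pi)) t :=
    ((hθ' t).sub_const s).div_const _
  have hiff (t : ℝ) (k : ℤ) : (θ t - s) / (2 * Real.pi) = k ↔ θ t = s + k * (2 * Real.pi) := by
    rw [div_eq_iff hpi.ne']
    constructor <;> intro h <;> linarith
  have hreg (t : ℝ) (k : ℤ) (h : (θ t - s) / (2 * Real.pi) = k) : θ' t / (2 * Real.pi) ≠ 0 :=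
    div_ne_zero (hs t k ((hiff t k).1 h)) hpi.ne'
  have hfin := finite_crossings hφ hreg 0 (2 * Real.pi)
  set T := hfin.toFinset with hTdef
  have hT (t : ℝ) : t ∈ T ↔ t ∈ Icc 0 (2 * Real.pi) ∧ ∃ k : ℤ, (θ t - s) / (2 * Real.pi) = k :=
    hfin.mem_toFinset
  have hφ1 : (θ (2 * Real.pi) - s) / (2 * Real.pi) = (θ 0 - s) / (2 * Real.pi) + d := by
    rw [eq_add_of_sub_eq hd]; field_simp; ring
  have h0 (k : ℤ) : (θ 0 - s) / (2 * Real.pi) ≠ k := fun h => hs0 k ((hiff 0 k).1 h)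
  have h2pi (k : ℤ) : (θ (2 * Real.pi) - s) / (2 * Real.pi) ≠ k := fun h =>
    h0 (k - d) (by rw [hφ1] at h; push_cast; linarith)
  -- Since φ increases by d over one turn, the signed number of crossings is d.
  have hsum := sum_sign_crossings hφ hpi.le T hT
    (fun t ht => by obtain ⟨-, k, hk⟩ := (hT t).1 ht; exact hreg t k hk) h0 h2pi
  rw [hφ1, Int.floor_add_intCast, add_sub_cancel_left] at hsum
  have hexp (t : ℝ) (ht : t ∈ T) : Circle.exp (θ t) = Circle.exp s := by
    obtain ⟨-, k, hk⟩ := (hT t).1 ht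
    exact Circle.exp_eq_exp.2 ⟨k, (hiff t k).1 hk⟩
  have hmem {t : ℝ} (ht : t ∈ Ico 0 (2 * Real.pi)) (h : Circle.exp (θ t) = Circle.exp s) : t ∈ T := by
    obtain ⟨k, hk⟩ := Circle.exp_eq_exp.1 h
    exact (hT t).2 ⟨⟨ht.1, ht.2.le⟩, k, (hiff t k).2 hk⟩
  -- The parameter 2π is not a crossing either, so each crossing point has exactly one parameter in
  -- `T`.
  have hT2 (t : ℝ) (ht : t ∈ T) : t ∈ Ico 0 (2 * Real.pi) := by
    obtain ⟨h, k, hk⟩ := (hT t).1 ht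
    exact ⟨h.1, h.2.lt_of_ne fun he => h2pi k (he ▸ hk)⟩
  have hslice (z : ℂ) (hz : N.toFun (Circle.exp s, z) ∈ range K) :
      ∃ t ∈ T, (P (Circle.exp t)).2 = z := by
    obtain ⟨u, hu⟩ := hz
    rw [hK] at hu
    have hu' := N.injective hu
    obtain ⟨t₁, rfl⟩ := Circle.exp_surjective u
    obtain ⟨t, ht, m, hm⟩ : ∃ t ∈ Ico 0 (2 * Real.pi), ∃ m : ℤ, t₁ = t + m * (2 * Real.pi) :=
      ⟨toIcoMod hpi 0 t₁, by simpa using toIcoMod_mem_Ico hpi 0 t₁, toIcoDiv hpi 0 t₁, by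
        rw [toIcoMod, zsmul_eq_mul]; ring⟩
    have he : Circle.exp t₁ = Circle.exp t := Circle.exp_eq_exp.2 ⟨m, hm⟩
    rw [he] at hu'
    exact ⟨t, hmem ht (by rw [← hθ, hu']), by rw [hu']⟩
  have hinj : InjOn (fun t => (P (Circle.exp t)).2) T := by
    intro t ht t' ht' h
    have h1 : P (Circle.exp t) = P (Circle.exp t') :=
      Prod.ext (by rw [hθ, hθ, hexp t ht, hexp t' ht']) h
    have h2 := congrArg N.toFun h1
    rw [← hK, ← hK, ← NK.core, ← NK.core] at h2
    have h3 : Circle.exp t = Circle.exp t' := congrArg Prod.fst (NK.injective h2)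
    obtain ⟨m, hm⟩ := Circle.exp_eq_exp.1 h3
    have h4 := hT2 t ht
    have h5 := hT2 t' ht'
    have h6 : |(m : ℝ)| < 1 := by
      have : |(m : ℝ)| * (2 * Real.pi) < 1 * (2 * Real.pi) := by
        rw [← abs_of_pos hpi, ← abs_mul, abs_of_pos hpi, abs_lt]
        constructor <;> linarith [h4.1, h4.2, h5.1, h5.2]
      exact lt_of_mul_lt_mul_right this hpi.le
    have h7 : m = 0 := Int.abs_lt_one_iff.1 (by exact_mod_cast h6)
    rw [hm, h7]; simp
  have hNc : Continuous fun z : ℂ => N.toFun (Circle.exp s, z) :=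
    N.smooth.continuous.comp (by fun_prop)
  -- The angle function of K, restricted to the fibre, has its punctures in the unit disk at the
  -- crossings, with the crossing signs as local degrees.
  have key := HasDeg.of_punctures T (fun t => (P (Circle.exp t)).2) hinj (R := 1)
    (fun t _ => hP.mem_interior _) (fun t => (SignType.sign (θ' t / (2 * Real.pi)) : ℤ))
    (F := fun z => f (N.toFun (Circle.exp s, z)))
    (hf.comp hNc.continuousOn fun z hz hzK => hz (by
      obtain ⟨t, ht, h⟩ := hslice z hzK
      exact ⟨t, ht, h⟩)) (fun t ht => by
      obtain ⟨-, k, hk⟩ := (hT t).1 ht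
      have := N.eventually_hasDeg_fibre NK hg hfg (hθ' t)
        (hζ.differentiable (by simp) t).hasDerivAt (hs t k ((hiff t k).1 hk))
        (.of_forall fun t => by rw [NK.core, hK, ← hθ])
      rw [hexp t ht] at this
      rwa [div_eq_mul_inv, sign_mul, sign_pos (inv_pos.2 hpi), mul_one])
  rw [hsum] at key
  have hcirc (u v : Circle) : N.toFun (u, v) ∈ (range K)ᶜ := by
    rintro ⟨u', hu'⟩
    rw [hK] at hu'
    have := hP.mem_interior u'
    rw [N.injective hu', Circle.norm_coe] at this
    exact lt_irrefl _ this
  -- The boundary circle of the fibre disk is rotated from the fibre over e^(is) to the one over 1.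
  -- It misses K, since the pattern lies in the open solid torus.
  have := HasDeg.homotopy
    (fun x : ℝ × ℝ => f (N.toFun (Circle.exp x.1, Circle.exp (2 * Real.pi * x.2)))) (n := d) ?_
    (fun x => by simp) s 0 ?_
  · simpa only [Circle.exp_zero] using this
  · exact hf.comp_continuous (N.smooth.continuous.comp (by fun_prop)) fun x => hcirc _ _
  · exact key.congr_fun fun t => by rw [Complex.ofReal_one, one_mul]

end

/-! ### Noncommutativity, and the outside and inside of the companion torus -/

section

open Set Filter Topology

/-- The degree of a composition of maps of the circle. -/
theorem HasDeg.comp {F : Circle → Circle} (hF : Continuous F) {d m : ℤ}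
    (h : HasDeg (fun t => F (Circle.exp (2 * Real.pi * t))) d) {α : ℝ → Circle} (hα : HasDeg α m) :
    HasDeg (fun t => F (α t)) (m * d) := by
  obtain ⟨Θ, hΘ⟩ := Circle.exists_lift (E := ℝ) ⟨fun t => F (Circle.exp t), by fun_prop⟩
  simp only [ContinuousMap.coe_mk] at hΘ
  have h1 := h.lift_eq (ψ := fun t => Θ (2 * Real.pi * t)) (by fun_prop) fun t => hΘ _
  obtain ⟨k, hk⟩ := Circle.lift_sub_lift_eqOn isPreconnected_univ
    (ψ := fun t => Θ (t + 2 * Real.pi)) (ψ' := Θ) (by fun_prop) (by fun_prop) (fun t _ => by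
      rw [← hΘ, ← hΘ, Circle.exp_add, Circle.exp_two_pi, mul_one])
  have hk0 := hk 0 trivial
  simp only [zero_add, mul_one, mul_zero] at h1 hk0
  -- A lift of a degree d map is d x plus a periodic function.
  have hp : Function.Periodic (fun x => Θ x - d * x) (2 * Real.pi) := fun t => by
    simp only
    rw [hk t trivial]
    linear_combination h1 - hk0
  obtain ⟨ψ, hψ, hm⟩ := hα
  refine HasDeg.intro (fun t => Θ (ψ t)) (by fun_prop) (fun t => by rw [hψ, hΘ]) ?_
  have h2 := hp.int_mul m (ψ 0)
  rw [show ψ 0 + m * (2 * Real.pi) = ψ 1 by linarith] at h2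
  push_cast
  linear_combination h2 + d * hm

namespace Hol

variable {X Y G : Type*} [TopologicalSpace X] [TopologicalSpace Y] [Group G]

/-- The holonomies of some two loops with the same base point do not commute. -/
def IsNonComm (Φ : Hol X G) : Prop :=
  ∃ γ₁ γ₂ : C(ℝ, X), γ₁ 0 = γ₁ 1 ∧ γ₂ 0 = γ₁ 0 ∧ γ₂ 1 = γ₁ 0 ∧ ¬ Commute (Φ γ₁) (Φ γ₂)

/-- Noncommutativity is transported along a map which is compatible up to gauge equivalence and
central factors. -/
theorem IsNonComm.transport {Φ : Hol X G} {Ψ : Hol Y G} (hΦ : Φ.IsNonComm) (f : C(X, Y))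
    (h : X → G) (c : C(ℝ, X) → G) (hc : ∀ γ B, Commute (c γ) B)
    (hΨ : ∀ γ, Φ γ = h (γ 0) * (Ψ (f.comp γ) * c γ) * (h (γ 1))⁻¹) : Ψ.IsNonComm := by
  obtain ⟨γ₁, γ₂, h1, h2, h3, hne⟩ := hΦ
  refine ⟨f.comp γ₁, f.comp γ₂, congrArg f h1, congrArg f h2, congrArg f h3, fun hcomm => hne ?_⟩
  rw [hΨ γ₁, hΨ γ₂, ← h1, h2, h3]
  refine Commute.conj_iff (h := h (γ₁ 0)) |>.2 ?_
  exact (hcomm.mul_right (hc γ₂ _).symm).mul_left (hc γ₁ _)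

theorem IsNonComm.transport' {Φ : Hol X G} {Ψ : Hol Y G} (hΦ : Φ.IsNonComm) (f : C(X, Y))
    (h : X → G) (hΨ : ∀ γ, Φ γ = h (γ 0) * Ψ (f.comp γ) * (h (γ 1))⁻¹) : Ψ.IsNonComm :=
  hΦ.transport f h (fun _ => 1) (fun _ _ => Commute.one_left _) fun γ => by rw [mul_one, hΨ]

theorem IsNonComm.not_isGAbelian {Φ : Hol X G} (hΦ : Φ.IsNonComm) : ¬ IsGAbelian G X := by
  obtain ⟨γ₁, γ₂, h1, h2, h3, hne⟩ := hΦ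
  intro hab
  let p₁ : Path (γ₁ 0) (γ₁ 0) := γ₁.toPath.cast rfl h1
  let p₂ : Path (γ₁ 0) (γ₁ 0) := γ₂.toPath.cast h2.symm h3.symm
  have h := hab (γ₁ 0) (Φ.toHom (γ₁ 0)) (FundamentalGroup.fromPath (.mk p₁))
    (FundamentalGroup.fromPath (.mk p₂))
  rw [toHom_fromPath, toHom_fromPath] at h
  have e1 : Φ ⟨p₁.extend, p₁.continuous_extend⟩ = Φ γ₁ :=
    Φ.congr_Icc fun t ht => Path.extend_apply p₁ ht
  have e2 : Φ ⟨p₂.extend, p₂.continuous_extend⟩ = Φ γ₂ :=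
    Φ.congr_Icc fun t ht => Path.extend_apply p₂ ht
  rw [e1, e2] at h
  exact hne (Commute.inv_inv_iff.1 h)

theorem exists_isNonComm (h : ¬ IsGAbelian G X) : ∃ Φ : Hol X G, Φ.IsNonComm := by
  simp only [IsGAbelian, not_forall] at h
  obtain ⟨y, φ, a, b, hab⟩ := h
  obtain ⟨Φ, hΦ⟩ := exists_of_hom y φ
  obtain ⟨p, hp⟩ : ∃ p : Path y y, FundamentalGroup.fromPath (.mk p) = a :=
    Quotient.exists_rep a
  obtain ⟨q, hq⟩ : ∃ p : Path y y, FundamentalGroup.fromPath (.mk p) = b :=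
    Quotient.exists_rep b
  refine ⟨Φ, ⟨p.extend, p.continuous_extend⟩, ⟨q.extend, q.continuous_extend⟩, by simp, by simp,
    by simp, fun hc => hab ?_⟩
  rw [hΦ, hΦ, hp, hq] at hc
  exact Commute.inv_inv_iff.1 hc

end Hol

namespace TubularNbhd

variable {C : Circle → S3} (N : TubularNbhd C) {G : Type*} [Group G]

theorem one_add_exp_pos (x : ℝ) : 0 < 1 + Real.exp x := by positivity

/-- The tori around the knot, of radius greater than one. -/
def outerTorus : C(Circle × Circle × ℝ, KnotComplement C) where
  toFun x := ⟨N.toFun (x.1, ((1 + Real.exp x.2.2 : ℝ) : ℂ) * x.2.1), N.not_mem_range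
    (mul_ne_zero (by exact_mod_cast (one_add_exp_pos _).ne') (Circle.coe_ne_zero _))⟩
  continuous_toFun := Continuous.subtype_mk (N.smooth.continuous.comp (by fun_prop)) _

theorem outerTorus_eq (u v : Circle) (x : ℝ) :
    N.outerTorus (u, v, x) = N.torus (u, v, Real.log (1 + Real.exp x)) := by
  apply Subtype.ext
  rw [torus_val, Real.exp_log (one_add_exp_pos x)]
  rfl

/-- The slope condition can be tested at any radius. -/
theorem outer_slope {q p : ℤ} (ρ : Hol (KnotComplement C) G)
    (h : ρ.longitude N.torus ^ q * ρ.meridian N.torus ^ p = 1) :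
    ρ.longitude N.outerTorus ^ q * ρ.meridian N.outerTorus ^ p = 1 := by
  let γ : C(ℝ, KnotComplement C) := ⟨fun t => N.outerTorus
    (Circle.exp (2 * Real.pi * t) ^ q, Circle.exp (2 * Real.pi * t) ^ p, 0), by
      have (n : ℤ) : Continuous fun t : ℝ => Circle.exp (2 * Real.pi * t) ^ n := by fun_prop
      exact N.outerTorus.continuous.comp ((this q).prodMk ((this p).prodMk continuous_const))⟩
  obtain ⟨g₁, h₁, -⟩ := ρ.torus_loop N.torus (HasDeg.exp q) (HasDeg.exp p)
    (ξ := fun _ => Real.log (1 + Real.exp 0)) continuous_const rfl (γ := γ)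
    fun t => N.outerTorus_eq _ _ _
  obtain ⟨g₂, -, h₂⟩ := ρ.torus_loop N.outerTorus (HasDeg.exp q) (HasDeg.exp p)
    (ξ := fun _ => 0) continuous_const rfl (γ := γ) fun t => rfl
  rw [← h₂ (by simp) (by simp) rfl, h₁, h]
  group

theorem outer_longitude_eq_one {A : Type*} [CommGroup A] (hN : N.IsSeifertFramed)
    (Φ : Hol (KnotComplement C) A) : Φ.longitude N.outerTorus = 1 := by
  obtain ⟨g, hg, -⟩ := Φ.torus_loop N.torus (HasDeg.exp 1) (HasDeg.const 1)
    (ξ := fun _ => Real.log (1 + Real.exp 0)) continuous_const rfl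
    (γ := N.outerTorus.comp ⟨fun t => (Circle.exp (2 * Real.pi * t), 1, 0), by fun_prop⟩)
    fun t => by rw [zpow_one]; exact N.outerTorus_eq _ _ _
  rw [Hol.longitude, hg, N.longitude_eq_one hN]
  simp

/-- An angle function has degree zero on a null-homologous parallel. -/
theorem hasDeg_zero_of_hol {Y : Type*} [TopologicalSpace Y] (F : C(Y, Circle)) (γ : C(ℝ, Y))
    (hγ : γ 0 = γ 1) (h : (Hol.circle (Multiplicative.ofAdd (1 : ℤ))).comap F γ = 1) :
    HasDeg (fun t => F (γ t)) 0 := by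
  obtain ⟨n, hn⟩ := HasDeg.exists_of_continuous (γ := fun t => F (γ t)) (by fun_prop)
    (by rw [hγ])
  have := Hol.circle_apply (Multiplicative.ofAdd (1 : ℤ)) (γ := F.comp γ) hn
  rw [Hol.comap_apply] at h
  rw [h, ← ofAdd_zsmul] at this
  have hn0 : n = 0 := by simpa using this.symm
  rwa [hn0] at hn

/-- The complement of the closed tubular neighbourhood, inside the complement of a knot in the
neighbourhood. -/
def outside (K : Circle → S3) : Set (KnotComplement K) :=
  {x | (x : S3) ∉ N.toFun '' {y | ‖y.2‖ ≤ 1}}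

/-- The part of a knot complement in the tubular neighbourhood. -/
def inside (K : Circle → S3) : Set (KnotComplement K) := {x | (x : S3) ∈ range N.toFun}

variable {K : Circle → S3}

theorem isOpen_outside : IsOpen (N.outside K) := by
  have h : {y : Circle × ℂ | ‖y.2‖ ≤ 1} = univ ×ˢ Metric.closedBall 0 1 := by
    ext y; simp
  have : IsClosed (N.toFun '' {y | ‖y.2‖ ≤ 1}) := by
    rw [h]
    exact ((isCompact_univ.prod (isCompact_closedBall _ _)).image N.smooth.continuous).isClosed
  exact this.isOpen_compl.preimage continuous_subtype_val

theorem isOpen_inside : IsOpen (N.inside K) := N.isOpen_range.preimage continuous_subtype_val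

theorem outside_union_inside : N.outside K ∪ N.inside K = univ := by
  rw [eq_univ_iff_forall]
  intro x
  by_cases h : (x : S3) ∈ N.toFun '' {y | ‖y.2‖ ≤ 1}
  · exact Or.inr (image_subset_range _ _ h)
  · exact Or.inl h

theorem outside_notMem_range {x : KnotComplement K} (hx : x ∈ N.outside K) :
    (x : S3) ∉ range C := by
  rintro ⟨u, hu⟩
  exact hx ⟨(u, 0), by simp, by rw [N.core, hu]⟩

variable (K) in
/-- The inclusion of the outside in the complement of the core. -/
def outsideIncl : C(N.outside K, KnotComplement C) where
  toFun x := ⟨x.1, N.outside_notMem_range x.2⟩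
  continuous_toFun := Continuous.subtype_mk (by fun_prop) _

theorem toFun_mem_outside {u : Circle} {z : ℂ} (hz : 1 < ‖z‖) :
    N.toFun (u, z) ∉ N.toFun '' {y | ‖y.2‖ ≤ 1} := by
  rintro ⟨y, hy, h⟩
  rw [N.injective h] at hy
  exact absurd hy (not_le.2 hz)

/-- The retraction of the complement of the core to the outside. -/
def toOutside (hK : range K ⊆ N.toFun '' {y | ‖y.2‖ ≤ 1}) : C(KnotComplement C, N.outside K) where
  toFun x := ⟨⟨N.push (x, 2), fun h => N.pushFun_notMem (R := 2) (by
      obtain ⟨y, hy, h'⟩ := hK h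
      exact ⟨y, lt_of_le_of_lt (show ‖y.2‖ ≤ 1 from hy) one_lt_two, h'⟩)⟩, fun h =>
      N.pushFun_notMem (R := 2) (by
      obtain ⟨y, hy, h'⟩ := h
      exact ⟨y, lt_of_le_of_lt (show ‖y.2‖ ≤ 1 from hy) one_lt_two, h'⟩)⟩
  continuous_toFun := Continuous.subtype_mk (Continuous.subtype_mk
    (continuous_subtype_val.comp (N.push.continuous.comp (by fun_prop))) _) _

end TubularNbhd

end

/-! ### Construction of the representation of the satellite group -/

section

open Set Filter Topology

namespace TubularNbhd

variable {C K : Circle → S3} (N : TubularNbhd C)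

theorem hasDeg_outer_longitude (hN : N.IsSeifertFramed) {f : S3 → Circle}
    (hf : ContinuousOn f (range C)ᶜ) :
    HasDeg (fun t => f (N.outerTorus (Circle.exp (2 * Real.pi * t), 1, 0))) 0 :=
  hasDeg_zero_of_hol ⟨fun x : KnotComplement C => f x,
    hf.comp_continuous continuous_subtype_val fun x => x.2⟩
    (N.outerTorus.comp ⟨fun t => (Circle.exp (2 * Real.pi * t), 1, 0), by fun_prop⟩)
    (by simp) (N.outer_longitude_eq_one hN _)

theorem hasDeg_outer_meridian {f : S3 → Circle} {g : Circle × ℂ → Circle}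
    (hf : ContinuousOn f (range C)ᶜ) (hg : Continuous g)
    (hfg : ∀ u z, z ≠ 0 → f (N.toFun (u, z)) = g (u, z) * Complex.dir z) :
    HasDeg (fun t => f (N.outerTorus (1, Circle.exp (2 * Real.pi * t), 0))) 1 := by
  have := HasDeg.homotopy
    (fun x : ℝ × ℝ => f (N.torus (1, Circle.exp (2 * Real.pi * x.2), x.1)))
    (hf.comp_continuous (continuous_subtype_val.comp (by fun_prop)) fun x => Subtype.prop _)
    (fun s => by simp) 0 (Real.log (1 + Real.exp 0)) (hasDeg_meridian N hf hg hfg)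
  exact this.congr_fun fun t => by rw [outerTorus_eq]

theorem outerTorus_zero_notMem (u v : Circle) :
    (N.outerTorus (u, v, 0) : S3) ∉ N.toFun '' {y | ‖y.2‖ < 2} := by
  rintro ⟨y, hy, h⟩
  rw [N.injective h] at hy
  change ‖((1 + Real.exp 0 : ℝ) : ℂ) * (v : ℂ)‖ < 2 at hy
  rw [norm_mul, Circle.norm_coe, Complex.norm_real, Real.exp_zero] at hy
  norm_num at hy

/-- The linking number of the longitude of C with K is computed by pulling `f` back along
`toOutside` to the complement of C, where the longitude is null-homologous. The outer torus at
parameter 0 has radius 2, so the retraction fixes it. -/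
theorem hasDeg_outer_longitude_of_subset (hN : N.IsSeifertFramed)
    (hK : range K ⊆ N.toFun '' {y | ‖y.2‖ ≤ 1}) {f : S3 → Circle}
    (hf : ContinuousOn f (range K)ᶜ) :
    HasDeg (fun t => f (N.outerTorus (Circle.exp (2 * Real.pi * t), 1, 0))) 0 := by
  have := hasDeg_zero_of_hol ⟨fun x : KnotComplement C => f (N.toOutside hK x).1,
    hf.comp_continuous (continuous_subtype_val.comp (continuous_subtype_val.comp
      (N.toOutside hK).continuous)) fun x => Subtype.prop _⟩
    (N.outerTorus.comp ⟨fun t => (Circle.exp (2 * Real.pi * t), 1, 0), by fun_prop⟩)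
    (by simp) (N.outer_longitude_eq_one hN _)
  refine this.congr_fun fun t => congrArg f ?_
  exact N.pushFun_of_notMem (N.outerTorus_zero_notMem _ _)

theorem _root_.IsPattern.range_subset {P : Circle → Circle × ℂ} (hP : IsPattern P)
    (hK : ∀ u, K u = N.toFun (P u)) : range K ⊆ N.toFun '' {y | ‖y.2‖ ≤ 1} := by
  rintro _ ⟨u, rfl⟩
  exact ⟨P u, (hP.mem_interior u).le, (hK u).symm⟩

/-- The circle grows from radius 1 to radius 2 = 1 + e⁰ without meeting K, which lies at radius less
than 1. -/
theorem _root_.IsPattern.hasDeg_outer_meridian {P : Circle → Circle × ℂ} (hP : IsPattern P)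
    (hK : ∀ u, K u = N.toFun (P u)) {f : S3 → Circle} (hf : ContinuousOn f (range K)ᶜ) {d : ℤ}
    (h : HasDeg (fun t => f (N.toFun (1, Circle.exp (2 * Real.pi * t)))) d) :
    HasDeg (fun t => f (N.outerTorus (1, Circle.exp (2 * Real.pi * t), 0))) d := by
  have := HasDeg.homotopy (n := d) (fun x : ℝ × ℝ =>
    f (N.toFun (1, ((1 + x.1 ^ 2 : ℝ) : ℂ) * Circle.exp (2 * Real.pi * x.2)))) ?_
    (fun s => by simp) 0 1 ?_
  · refine this.congr_fun fun t => ?_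
    change _ = f (N.toFun (1, ((1 + Real.exp 0 : ℝ) : ℂ) * _))
    rw [Real.exp_zero, one_pow]
  · refine hf.comp_continuous (N.smooth.continuous.comp (by fun_prop)) fun x => ?_
    rintro ⟨u, hu⟩
    rw [hK] at hu
    have := hP.mem_interior u
    rw [N.injective hu, norm_mul, Circle.norm_coe, Complex.norm_real, mul_one,
      Real.norm_of_nonneg (by positivity)] at this
    nlinarith [sq_nonneg x.1]
  · refine h.congr_fun fun t => ?_
    rw [zero_pow two_ne_zero, add_zero, Complex.ofReal_one, one_mul]

/-- The outer tori, in the overlap of the inside and the outside. -/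
def overlapTorus (hK : range K ⊆ N.toFun '' {y | ‖y.2‖ ≤ 1}) :
    C(Circle × Circle × ℝ, ↥(N.outside K ∩ N.inside K)) where
  toFun x := ⟨⟨N.outerTorus x, fun h => N.toFun_mem_outside
      (u := x.1) (z := ((1 + Real.exp x.2.2 : ℝ) : ℂ) * x.2.1) (by
        rw [norm_mul, Circle.norm_coe, Complex.norm_real, mul_one,
          Real.norm_of_nonneg (one_add_exp_pos _).le]
        linarith [Real.exp_pos x.2.2]) (hK h)⟩, N.toFun_mem_outside
      (u := x.1) (z := ((1 + Real.exp x.2.2 : ℝ) : ℂ) * x.2.1) (by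
        rw [norm_mul, Circle.norm_coe, Complex.norm_real, mul_one,
          Real.norm_of_nonneg (one_add_exp_pos _).le]
        linarith [Real.exp_pos x.2.2]), mem_range_self _⟩
  continuous_toFun := Continuous.subtype_mk (Continuous.subtype_mk
    (continuous_subtype_val.comp N.outerTorus.continuous) _) _

/-- The inverse of `overlapTorus`. -/
theorem exists_overlap_coords (hK : range K ⊆ N.toFun '' {y | ‖y.2‖ ≤ 1}) :
    ∃ c : C(↥(N.outside K ∩ N.inside K), Circle × Circle × ℝ),
      (∀ x, N.overlapTorus hK (c x) = x) ∧ ∀ x, c (N.overlapTorus hK x) = x := by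
  have hc : Continuous fun x : ↥(N.outside K ∩ N.inside K) => N.coords x.1.1 :=
    N.continuousOn_coords.comp_continuous (by fun_prop) fun x => x.2.2
  have h1 (x : ↥(N.outside K ∩ N.inside K)) : 1 < ‖(N.coords x.1.1).2‖ :=
    not_le.1 fun h => x.2.1 ⟨N.coords x.1.1, h, N.apply_coords x.2.2⟩
  have h0 (x : ↥(N.outside K ∩ N.inside K)) : (N.coords x.1.1).2 ≠ 0 :=
    norm_pos_iff.1 (one_pos.trans (h1 x))
  refine ⟨⟨fun x => ((N.coords x.1.1).1, Complex.dir (N.coords x.1.1).2,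
    Real.log (‖(N.coords x.1.1).2‖ - 1)), ?_⟩, fun x => ?_, fun x => ?_⟩
  · refine (continuous_fst.comp hc).prodMk (((continuous_snd.comp hc).dir h0).prodMk ?_)
    exact ((continuous_snd.comp hc).norm.sub continuous_const).log fun x => (sub_pos.2 (h1 x)).ne'
  · apply Subtype.ext
    apply Subtype.ext
    change N.toFun ((N.coords x.1.1).1, ((1 + Real.exp (Real.log (‖(N.coords x.1.1).2‖ - 1)) : ℝ) : ℂ) *
      Complex.dir (N.coords x.1.1).2) = x.1.1
    rw [Real.exp_log (sub_pos.2 (h1 x)), add_sub_cancel, Complex.norm_mul_dir]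
    exact N.apply_coords x.2.2
  · obtain ⟨u, v, y⟩ := x
    have e : N.coords (N.overlapTorus hK (u, v, y)).1.1 =
        (u, ((1 + Real.exp y : ℝ) : ℂ) * v) := N.coords_apply _
    simp only [ContinuousMap.coe_mk, e]
    refine Prod.ext rfl (Prod.ext ?_ ?_)
    · rw [Complex.dir_ofReal_mul (one_add_exp_pos y), Complex.dir_circle]
    · simp only
      rw [norm_mul, Circle.norm_coe, Complex.norm_real, mul_one,
        Real.norm_of_nonneg (one_add_exp_pos _).le, add_sub_cancel_left, Real.log_exp]

/-- Two holonomies on the overlap are gauge equivalent if they agree on the longitude and on the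
meridian. -/
theorem exists_gauge_overlap (hK : range K ⊆ N.toFun '' {y | ‖y.2‖ ≤ 1}) {G : Type*} [Group G]
    (Φ Ψ : Hol ↥(N.outside K ∩ N.inside K) G)
    (hl : Φ.longitude (N.overlapTorus hK) = Ψ.longitude (N.overlapTorus hK))
    (hm : Φ.meridian (N.overlapTorus hK) = Ψ.meridian (N.overlapTorus hK)) :
    ∃ g : ↥(N.outside K ∩ N.inside K) → G, ∀ γ, Φ γ = Ψ.gauge g γ := by
  obtain ⟨c, hc, hc'⟩ := N.exists_overlap_coords hK
  have : PathConnectedSpace ↥(N.outside K ∩ N.inside K) :=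
    Function.Surjective.pathConnectedSpace (fun x => ⟨c x, hc x⟩) (N.overlapTorus hK).continuous
  refine Hol.exists_gauge_eq Φ Ψ (N.overlapTorus hK (1, 1, 0)) fun γ h0 h1 => ?_
  have e0 : c (γ 0) = (1, 1, 0) := by rw [h0, hc']
  have e1 : c (γ 1) = (1, 1, 0) := by rw [h1, hc']
  obtain ⟨m, hm'⟩ := HasDeg.exists_of_continuous (γ := fun t => (c (γ t)).1) (by fun_prop)
    (by simp only [e0, e1])
  obtain ⟨n, hn⟩ := HasDeg.exists_of_continuous (γ := fun t => (c (γ t)).2.1) (by fun_prop)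
    (by simp only [e0, e1])
  have key (Φ : Hol ↥(N.outside K ∩ N.inside K) G) : Φ γ =
      Φ.longitude (N.overlapTorus hK) ^ m * Φ.meridian (N.overlapTorus hK) ^ n := by
    obtain ⟨-, -, h⟩ := Φ.torus_loop (N.overlapTorus hK) hm' hn (ξ := fun t => (c (γ t)).2.2)
      (by fun_prop) (by simp only [e0, e1]) fun t => (hc (γ t)).symm
    exact h (by rw [e0]) (by rw [e0]) (by rw [e0])
  rw [key, key, hl, hm]

/-- The degree of an angle function on a slope. -/
theorem hasDeg_slope {N : TubularNbhd K} (hN : N.IsSeifertFramed) {f : S3 → Circle}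
    {g : Circle × ℂ → Circle} (hf : ContinuousOn f (range K)ᶜ) (hg : Continuous g)
    (hfg : ∀ u z, z ≠ 0 → f (N.toFun (u, z)) = g (u, z) * Complex.dir z) (q p : ℤ) (x : ℝ) :
    HasDeg (fun t => f (N.torus (Circle.exp (2 * Real.pi * t) ^ q,
      Circle.exp (2 * Real.pi * t) ^ p, x))) p := by
  let γ : C(ℝ, KnotComplement K) := ⟨fun t => N.torus
    (Circle.exp (2 * Real.pi * t) ^ q, Circle.exp (2 * Real.pi * t) ^ p, x), by
      have (n : ℤ) : Continuous fun t : ℝ => Circle.exp (2 * Real.pi * t) ^ n := by fun_prop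
      exact N.torus.continuous.comp ((this q).prodMk ((this p).prodMk continuous_const))⟩
  let Ψ := angleHol hf (Multiplicative.ofAdd (1 : ℤ))
  have hM : Ψ.meridian N.torus = Multiplicative.ofAdd (1 : ℤ) := by
    rw [Hol.meridian, angleHol_apply hf _ (hasDeg_meridian N hf hg hfg), zpow_one]
  obtain ⟨n, hn⟩ := HasDeg.exists_of_continuous (γ := fun t => f (γ t))
    (hf.comp_continuous (continuous_subtype_val.comp γ.continuous) fun t => (γ t).2)
    (by simp [γ])
  obtain ⟨a, ha, -⟩ := Ψ.torus_loop N.torus (HasDeg.exp q) (HasDeg.exp p)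
    (ξ := fun _ => x) continuous_const rfl (γ := γ) fun t => rfl
  rw [N.longitude_eq_one hN, hM, one_zpow, one_mul, mul_comm, mul_inv_cancel_left,
    angleHol_apply hf _ hn] at ha
  have hnp : n = p := by simpa [← ofAdd_zsmul] using ha
  rwa [hnp] at hn

/-- A slope of the satellite knot, at a small radius, in the coordinates around the companion. -/
theorem exists_slope_inside {P : Circle → Circle × ℂ} (hP : IsPattern P)
    (hK : ∀ u, K u = N.toFun (P u)) (NK : TubularNbhd K) {θ : ℝ → ℝ} (hθc : Continuous θ)
    (hθ : ∀ t, (P (Circle.exp t)).1 = Circle.exp (θ t)) {d : ℤ}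
    (hd : θ (2 * Real.pi) - θ 0 = 2 * Real.pi * d) (q p : ℤ) :
    ∃ x : ℝ, (∀ u v, NK.torus (u, v, x) ∈ N.inside K) ∧
      HasDeg (fun t => (N.coords (NK.torus (Circle.exp (2 * Real.pi * t) ^ q,
        Circle.exp (2 * Real.pi * t) ^ p, x))).1) (q * d) := by
  have hO : IsOpen (NK.toFun ⁻¹' range N.toFun) := N.isOpen_range.preimage NK.smooth.continuous
  obtain ⟨U, V, -, hV, hU, hV0, hUV⟩ := generalized_tube_lemma (s := univ) isCompact_univ
    (t := {(0 : ℂ)}) isCompact_singleton hO (by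
      rintro ⟨u, z⟩ ⟨-, rfl⟩
      exact ⟨P u, by rw [NK.core, hK]⟩)
  obtain ⟨δ, hδ, hball⟩ := Metric.isOpen_iff.1 hV 0 (hV0 rfl)
  have hmem (u : Circle) {z : ℂ} (hz : ‖z‖ < δ) : NK.toFun (u, z) ∈ range N.toFun :=
    hUV ⟨hU trivial, hball (mem_ball_zero_iff.2 hz)⟩
  have hδ2 : 0 < δ / 2 := half_pos hδ
  have hnorm {c : ℝ} (hc : |c| < δ) (v : Circle) : ‖(c : ℂ) * v‖ < δ := by
    rwa [norm_mul, Circle.norm_coe, mul_one, Complex.norm_real]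
  let e (t : ℝ) : Circle := Circle.exp (2 * Real.pi * t)
  have he : Continuous e := by fun_prop
  have he01 : e 0 = e 1 := by simp [e]
  refine ⟨Real.log (δ / 2), fun u v => hmem u (hnorm ?_ v), ?_⟩
  · rw [Real.exp_log hδ2, abs_of_pos hδ2]; exact half_lt_self hδ
  have h0 : ∀ s : ℝ, |max 0 (min 1 s) * (δ / 2)| < δ := fun s => by
    rw [abs_of_nonneg (mul_nonneg (le_max_left _ _) hδ2.le)]
    have : max 0 (min 1 s) ≤ 1 := max_le zero_le_one (min_le_left _ _)
    nlinarith
  have := HasDeg.homotopy (n := q * d) (fun y : ℝ × ℝ => (N.coords (NK.toFun (e y.2 ^ q,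
      ((max 0 (min 1 y.1) * (δ / 2) : ℝ) : ℂ) * (e y.2 ^ p : Circle)))).1) ?_ (fun s => by
        simp only [he01]) 0 1 ?_
  · simpa only [min_self, max_eq_right zero_le_one, one_mul, torus_val, Real.exp_log hδ2] using this
  · refine continuous_fst.comp (N.continuousOn_coords.comp_continuous
      (NK.smooth.continuous.comp ?_) fun y => hmem _ (hnorm (h0 _) _))
    have h1 : Continuous fun y : ℝ × ℝ => e y.2 ^ q := (he.comp continuous_snd).zpow q
    have h2 : Continuous fun y : ℝ × ℝ => e y.2 ^ p := (he.comp continuous_snd).zpow p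
    exact h1.prodMk ((Complex.continuous_ofReal.comp (by fun_prop)).mul
      (continuous_induced_dom.comp h2))
  -- At radius zero the loop runs q times along K, whose longitudinal coordinate around C has degree
  -- d.
  · have h0 : max 0 (min 1 (0 : ℝ)) = 0 := by simp
    simp only [h0, zero_mul, Complex.ofReal_zero, NK.core, hK, coords_apply]
    refine HasDeg.comp (F := fun u => (P u).1)
      (continuous_fst.comp hP.embedding.contMDiff.continuous) ?_ (HasDeg.exp q)
    refine HasDeg.intro (fun t => θ (2 * Real.pi * t)) (by fun_prop) (fun t => hθ _) ?_
    rw [mul_one, mul_zero, hd, mul_comm]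

open Matrix (SpecialLinearGroup) in
/-- A noncommutative representation of the companion group which is trivial on a slope gives rise to
one of the satellite group. -/
theorem exists_satellite_hol {P : Circle → Circle × ℂ} (hP : IsPattern P) (hN : N.IsSeifertFramed)
    (hK : ∀ u, K u = N.toFun (P u)) (NK : TubularNbhd K) (hNK : NK.IsSeifertFramed)
    {θ : ℝ → ℝ} (hθc : Continuous θ) (hθ : ∀ t, (P (Circle.exp t)).1 = Circle.exp (θ t)) {d : ℤ}
    (hd : θ (2 * Real.pi) - θ 0 = 2 * Real.pi * d) (hd0 : d ≠ 0) (r : ℚ)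
    (ρ : Hol (KnotComplement C) (SpecialLinearGroup (Fin 2) ℂ))
    (hρ : ρ.longitude N.torus ^ (r.den : ℤ) * ρ.meridian N.torus ^ r.num = 1)
    (hnc : ρ.IsNonComm) :
    ∃ Ω : Hol (KnotComplement K) (SpecialLinearGroup (Fin 2) ℂ), Ω.IsNonComm ∧
      Ω.longitude NK.torus ^ ((r * d ^ 2).den : ℤ) * Ω.meridian NK.torus ^ (r * d ^ 2).num = 1 := by
  have hKs := hP.range_subset N hK
  obtain ⟨fC, gC, hfC, hgC, hfgC⟩ := N.exists_angle
  obtain ⟨f, g, hf, hg, hfg⟩ := NK.exists_angle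
  set L := ρ.longitude N.outerTorus
  set M := ρ.meridian N.outerTorus
  -- `M` itself may have no d-th root, but its product with the central element `ε` does.
  obtain ⟨ε, A, hε, hA, hAL, hAs⟩ := SL2.exists_slope_root hd0 r
    (ρ.commute_longitude_meridian N.outerTorus) (N.outer_slope ρ hρ)
  -- the twisted representation, on the outside
  let ρ' : Hol (KnotComplement C) (SpecialLinearGroup (Fin 2) ℂ) :=
    ρ.mul (angleHol hfC ε) fun γ γ' => Commute.zpow_right (hε _).symm _
  have hρ' (γ : C(ℝ, KnotComplement C)) {n : ℤ} (h : HasDeg (fun t => fC (γ t)) n) :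
      ρ' γ = ρ γ * ε ^ n := congrArg (ρ γ * ·) (angleHol_apply hfC ε h)
  -- the representation on the inside
  let fV : C(N.inside K, Circle) := ⟨fun x => f x.1.1,
    hf.comp_continuous (by fun_prop) fun x => x.1.2⟩
  let pV : C(N.inside K, Circle) := ⟨fun x => (N.coords x.1.1).1,
    continuous_fst.comp (N.continuousOn_coords.comp_continuous (by fun_prop) fun x => x.2)⟩
  -- The exponents are the linking number with K (for `A`) and the winding number around the solid
  -- torus (for `L`).
  let ρV : Hol (N.inside K) (SpecialLinearGroup (Fin 2) ℂ) :=
    ((Hol.circle A).comap fV).mul ((Hol.circle L).comap pV) fun γ γ' => Hol.commute_circle hAL _ _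
  have hρV (γ : C(ℝ, N.inside K)) {m n : ℤ} (h : HasDeg (fun t => fV (γ t)) m)
      (h' : HasDeg (fun t => pV (γ t)) n) : ρV γ = A ^ m * L ^ n :=
    congrArg₂ (· * ·) (Hol.circle_apply A (γ := fV.comp γ) h)
      (Hol.circle_apply L (γ := pV.comp γ) h')
  -- comparison on the overlap
  let jU : C(↥(N.outside K ∩ N.inside K), N.outside K) := ⟨fun x => ⟨x.1, x.2.1⟩, by fun_prop⟩
  let jV : C(↥(N.outside K ∩ N.inside K), N.inside K) := ⟨fun x => ⟨x.1, x.2.2⟩, by fun_prop⟩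
  let ρU := ρ'.comap (N.outsideIncl K)
  have hpV (x : Circle × Circle × ℝ) : pV (jV (N.overlapTorus hKs x)) = x.1 :=
    congrArg Prod.fst (N.coords_apply _)
  -- The longitude of C has linking numbers 0 with both C and K and winds once, giving L on both
  -- sides. The meridian of C links C once and K exactly d times and does not wind, giving M ε =
  -- A^d.
  obtain ⟨γg, hγg⟩ := N.exists_gauge_overlap hKs (ρU.comap jU) (ρV.comap jV) (by
      have e1 : (ρU.comap jU).longitude (N.overlapTorus hKs) = L * ε ^ (0 : ℤ) :=
        hρ' _ (N.hasDeg_outer_longitude hN hfC)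
      have e2 : (ρV.comap jV).longitude (N.overlapTorus hKs) = A ^ (0 : ℤ) * L ^ (1 : ℤ) :=
        hρV _ (N.hasDeg_outer_longitude_of_subset hN hKs hf)
          ((HasDeg.exp 1).congr_fun fun t => by
            rw [zpow_one]; exact (hpV (Circle.exp (2 * Real.pi * t), 1, 0)).symm)
      rw [e1, e2, zpow_zero, zpow_zero, mul_one, one_mul, zpow_one]) (by
      have e1 : (ρU.comap jU).meridian (N.overlapTorus hKs) = M * ε ^ (1 : ℤ) :=
        hρ' _ (N.hasDeg_outer_meridian hfC hgC hfgC)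
      have e2 : (ρV.comap jV).meridian (N.overlapTorus hKs) = A ^ d * L ^ (0 : ℤ) :=
        hρV _ (hP.hasDeg_outer_meridian N hK hf (hP.hasDeg_meridian N hK NK hf hg hfg hθc hθ hd))
          ((HasDeg.const 1).congr_fun fun t =>
            (hpV (1, Circle.exp (2 * Real.pi * t), 0)).symm)
      rw [e1, e2, zpow_zero, mul_one, zpow_one, hA])
  classical
  -- The gauge function is extended by 1 off the overlap, since gauge functions need not be
  -- continuous.
  let gV (x : N.inside K) : SpecialLinearGroup (Fin 2) ℂ :=
    if h : x.1 ∈ N.outside K ∩ N.inside K then γg ⟨x.1, h⟩ else 1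
  have hcompat : Hol.Compat ρU (ρV.gauge gV) := by
    intro γ γ' hγ
    let γW : C(ℝ, ↥(N.outside K ∩ N.inside K)) :=
      ⟨fun t => ⟨γ t, (γ t).2, by rw [hγ]; exact (γ' t).2⟩, by fun_prop⟩
    have h1 : jU.comp γW = γ := rfl
    have h2 : jV.comp γW = γ' := by
      ext1 t; exact Subtype.ext (hγ t)
    have h3 := hγg γW
    simp only [Hol.gauge_apply, Hol.comap_apply, h1, h2] at h3
    have hgV (t : ℝ) : gV (γ' t) = γg (γW t) := by
      have hm : (γ' t : KnotComplement K) ∈ N.outside K ∩ N.inside K := by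
        rw [← hγ]; exact (γW t).2
      simp only [gV, dif_pos hm]
      congr 1
      exact Subtype.ext (hγ t).symm
    rw [Hol.gauge_apply, hgV, hgV]
    exact h3
  obtain ⟨Ω, hΩU, hΩV⟩ := Hol.exists_glue N.isOpen_outside N.isOpen_inside N.outside_union_inside
    hcompat
  refine ⟨Ω, ?_, ?_⟩
  · -- noncommutativity
    obtain ⟨h, hh⟩ := N.exists_push_conj ρ 2
    -- On the outside the glued holonomy is ρ times powers of the central `ε`, which do not affect
    -- commutators.
    refine hnc.transport ((⟨Subtype.val, by fun_prop⟩ : C(N.outside K, KnotComplement K)).comp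
      (N.toOutside hKs)) h (fun γ => (angleHol hfC ε ((N.outsideIncl K).comp
        ((N.toOutside hKs).comp γ)))⁻¹) (fun γ B => ?_) fun γ => ?_
    · exact (Commute.zpow_left (hε B) _).inv_left
    · rw [hh γ]
      congr 2
      have := hΩU ((N.toOutside hKs).comp γ)
      rw [ContinuousMap.comp_assoc, this]
      exact (mul_inv_cancel_right _ _).symm
  · -- the slope
    obtain ⟨x, hx, hdeg⟩ := N.exists_slope_inside hP hK NK hθc hθ hd
      ((r * d ^ 2).den : ℤ) (r * d ^ 2).num
    let γ : C(ℝ, N.inside K) := ⟨fun t => ⟨NK.torus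
      (Circle.exp (2 * Real.pi * t) ^ ((r * d ^ 2).den : ℤ),
        Circle.exp (2 * Real.pi * t) ^ (r * d ^ 2).num, x), hx _ _⟩, by
      have (n : ℤ) : Continuous fun t : ℝ => Circle.exp (2 * Real.pi * t) ^ n := by fun_prop
      exact Continuous.subtype_mk (NK.torus.continuous.comp
        ((this _).prodMk ((this _).prodMk continuous_const))) _⟩
    -- The slope loop of K on a thin torus links K p' times and winds q' d times, so its value is
    -- the expression that `A` was chosen to make trivial.
    have h1 : ρV γ = 1 := by
      rw [hρV γ (hasDeg_slope hNK hf hg hfg _ _ x) hdeg, mul_comm _ d, hAs]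
    have h2 : γ 0 = γ 1 := Subtype.ext (by simp [γ])
    have h3 := hΩV γ
    rw [Hol.gauge_apply, h1, mul_one, h2, inv_mul_cancel] at h3
    obtain ⟨a, ha, -⟩ := Ω.torus_loop NK.torus (HasDeg.exp _) (HasDeg.exp _)
      (ξ := fun _ => x) continuous_const rfl
      (γ := (⟨Subtype.val, by fun_prop⟩ : C(N.inside K, KnotComplement K)).comp γ) fun t => rfl
    rw [h3, eq_comm, mul_assoc, inv_mul_eq_one] at ha
    simpa using ha.symm

end TubularNbhd

end

/-! ### From knot complements to surgered manifolds and back -/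

section

open Set Filter Topology

namespace TubularNbhd

variable {K : Circle → S3} (N : TubularNbhd K) {G : Type*} [Group G] {r : ℚ}

/-- The holonomy on the knot complement given by a holonomy on the surgered manifold. -/
def ofDehnSurgery (Φ : Hol (DehnSurgery N r) G) : Hol (KnotComplement K) G :=
  (Φ.comap (DehnSurgery.inl N r)).comap N.toExterior

/-- The slope bounds a meridian disk of the surgery solid torus. -/
theorem slope_of_dehnSurgery (Φ : Hol (DehnSurgery N r) G) :
    (N.ofDehnSurgery Φ).longitude N.torus ^ (r.den : ℤ) *
      (N.ofDehnSurgery Φ).meridian N.torus ^ r.num = 1 := by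
  rw [← hol_slopeLoop_eq, ← DehnSurgery.hol_slopeLoop Φ, ofDehnSurgery, Hol.comap_apply,
    Hol.comap_apply]
  congr 2
  ext1 t
  exact N.toExterior_ofExterior _

/-- By `DehnSurgery.exists_conj`, the two noncommuting loops have, up to simultaneous conjugation,
the holonomies of loops in the exterior. -/
theorem isNonComm_of_dehnSurgery {Φ : Hol (DehnSurgery N r) G} (hΦ : Φ.IsNonComm) :
    (N.ofDehnSurgery Φ).IsNonComm := by
  have := N.pathConnectedSpace_exterior
  obtain ⟨e, h, he⟩ := DehnSurgery.exists_conj Φ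
  obtain ⟨γ₁, γ₂, h1, h2, h3, hne⟩ := hΦ
  obtain ⟨p₁, hp₁⟩ := he γ₁
  obtain ⟨p₂, hp₂⟩ := he γ₂
  have key (p : Path e e) : N.ofDehnSurgery Φ (N.ofExterior.comp ⟨p.extend, p.continuous_extend⟩) =
      (Φ.comap (DehnSurgery.inl N r)).onPath p := by
    change Φ.comap (DehnSurgery.inl N r) _ = Φ.comap (DehnSurgery.inl N r) _
    congr 1
    ext1 t
    exact N.toExterior_ofExterior _
  refine ⟨N.ofExterior.comp ⟨p₁.extend, p₁.continuous_extend⟩,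
    N.ofExterior.comp ⟨p₂.extend, p₂.continuous_extend⟩, by simp, by simp, by simp, fun hc => hne ?_⟩
  rw [key, key] at hc
  rw [hp₁, hp₂, ← h1, h2, h3]
  simpa using (Commute.conj_iff (h := (h (γ₁ 0))⁻¹)).2 hc

/-- Triviality on the slope allows an extension over the solid torus. Pushing loops out to the
exterior changes holonomies only by a gauge transformation, so noncommuting loops survive. -/
theorem not_isGAbelian_dehnSurgery {Ω : Hol (KnotComplement K) G} (hΩ : Ω.IsNonComm)
    (h : Ω.longitude N.torus ^ (r.den : ℤ) * Ω.meridian N.torus ^ r.num = 1) :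
    ¬ IsGAbelian G (DehnSurgery N r) := by
  obtain ⟨Ψ, hΨ⟩ := DehnSurgery.exists_extend (N := N) (r := r) (Ω.comap N.ofExterior)
    (by rw [Hol.comap_apply, hol_slopeLoop_eq, h])
  obtain ⟨k, hk⟩ := N.exists_push_conj Ω 1
  refine (hΩ.transport' (Ψ := Ψ) ((DehnSurgery.inl N r).comp N.toExterior) k fun γ => ?_).not_isGAbelian
  rw [ContinuousMap.comp_assoc, hΨ]
  exact hk γ

end TubularNbhd

end

end

theorem mainTheorem8
    (C K : Circle → S3) (hC : IsKnot C) (hK : IsKnot K)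
    (P : Circle → Circle × ℂ) (hP : IsPattern P) (hsat : IsSatellite K P C)
    (w : ℕ) (hw : 1 ≤ w) (hPw : HasWindingNumber P w)
    (r : ℚ)
    (NC : TubularNbhd C) (hNC : NC.IsSeifertFramed)
    (NK : TubularNbhd K) (hNK : NK.IsSeifertFramed)
    (h : ¬ IsGAbelian (Matrix.SpecialLinearGroup (Fin 2) ℂ) (DehnSurgery NC r)) :
    ¬ IsGAbelian (Matrix.SpecialLinearGroup (Fin 2) ℂ) (DehnSurgery NK (r * (w : ℚ) ^ 2)) := by
  obtain ⟨N, hN, hKP⟩ := hsat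
  obtain ⟨θ, hθc, hθ, hw'⟩ := hPw
  -- The construction uses the signed degree d, whereas the surgery slope only sees d² = w².
  obtain ⟨d, hd, hdw⟩ : ∃ d : ℤ, θ (2 * Real.pi) - θ 0 = 2 * Real.pi * d ∧ d.natAbs = w := by
    rcases abs_eq (by positivity) |>.1 hw' with h | h
    · exact ⟨w, by rw [h]; simp, by simp⟩
    · exact ⟨-w, by rw [h]; simp, by simp⟩
  have hd0 : d ≠ 0 := by rintro rfl; simp at hdw; omega
  have hsq : (w : ℚ) ^ 2 = (d : ℚ) ^ 2 := by
    rw [← hdw, Nat.cast_natAbs, Int.cast_abs, sq_abs]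
  rw [hsq]
  obtain ⟨Φ, hΦ⟩ := Hol.exists_isNonComm h
  -- The slope condition holds in the neighbourhood `NC` used for surgery and is carried over to the
  -- neighbourhood `N` that defines the satellite.
  obtain ⟨Ω, hΩ, hΩs⟩ := N.exists_satellite_hol hP hN hKP NK hNK hθc hθ hd hd0 r _
    (TubularNbhd.slope_eq_one hN hNC _ (NC.slope_of_dehnSurgery Φ))
    (NC.isNonComm_of_dehnSurgery hΦ)
  exact NK.not_isGAbelian_dehnSurgery hΩ hΩs
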